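/- **Setting.** Let $\mathbb{R}^{1,2}$ be $\mathbb{R}^3$ with $\langle x,y\rangle=-x_0y_0+x_1y_1+x_2y_2$, and let $x\boxtimes y$ be the cross product given by $\langle x\boxtimes y,v\rangle=\det(x,y,v)$ for all $v$. Let $\mathbb{H}^2=\{p : \langle p,p\rangle=-1,\ p_0>0\}$ be the hyperboloid with its induced metric, Levi-Civita connection $\nabla$ and complex structure $\mathrm{J}_p v=p\boxtimes v$. Write $\Pi(p)=(p_1,p_2)/p_0$ for the projection of $\mathbb{H}^2$ onto the unit disk $\mathbb{D}^2\subset\mathbb{R}^2=\mathbb{C}$ (Klein model) and $G(p)=(p_1,p_2)/(1+p_0)$ for the isometry onto the Poincaré disk. *Mean surfaces.* For $u:\mathbb{H}^2\to\mathbb{R}$ let $\overline u:\mathbb{D}^2\to\mathbb{R}$ be defined by $u(\Pi^{-1}(\eta))=\overline u(\eta)/\sqrt{1-|\eta|^2}$. Lift half-pipe space $\mathbb{HP}^3\cong\mathbb{H}^2\times\mathbb{R}$ to $\{(x,t)\in\mathbb{R}^{1,2}\times\mathbb{R}: x\in\mathbb{H}^2\}\subset\mathbb{R}^4$, with the connection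 $\nabla^{\mathbb{HP}^3}_VW=D_VW-\langle V,W\rangle N$, where $D$ is the flat connection of $\mathbb{R}^4$, $N$ is the position vector, and $\langle V,W\rangle$ is the Minkowski product of the $\mathbb{R}^{1,2}$-components. For smooth $u$, the second fundamental form of the graph $S$ of $u$ is the component of $\nabla^{\mathbb{HP}^3}_VW$ ($V,W$ tangent to $S$) along the vertical field $T=(0,1)$ in the splitting $\mathrm{T}S\oplus\mathbb{R}T$; $S$ is a *mean surface* if the trace of this form with respect to the hyperbolic metric vanishes. The boundary at infinity of $S$ is the graph of $\phi:\mathbb{S}^1\to\mathbb{R}$ if $\overline u(\eta)\to\phi(z)$ as $\eta\to z$, $\eta\in\mathbb{D}^2$, for every $z\in\mathbb{S}^1$. The vector field associated with $S$ is $V_S(p)=p\boxtimes\sigma$, where $\sigma\in\mathbb{R}^{1,2}$ is the vector with $\langle(1,\eta),\sigma\rangle=\overline u(\eta_0)+\mathrm{d}_{\eta_0}\overline u(\eta-\eta_0)$ for all $\eta$, and $\eta_0=\Pi(p)$. *Vector fields on the circle.* A continuous vector field $X$ on $\mathbb{S}^1$ is written $X(z)=iz\,\phi_X(z)$ with $\phi_X:\mathbb{S}^1\to\mathbb{R}$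 continuous. For a quadruple $Q=[a,b,c,d]$ of points of $\mathbb{S}^1$ in counter-clockwise order put $$\mathrm{cr}(Q)=\frac{(b-a)(d-c)}{(c-b)(d-a)},\qquad S(Q)=\min\{|a-b|,|b-c|,|c-d|,|d-a|\},$$ $$X[Q]=\frac{X(b)-X(a)}{b-a}-\frac{X(c)-X(b)}{c-b}+\frac{X(d)-X(c)}{d-c}-\frac{X(a)-X(d)}{a-d}.$$ $X$ is *Zygmund* if $\sup_{\mathrm{cr}(Q)=1}|X[Q]|<\infty$. It is *little Zygmund* if it is Zygmund and $\sup\limsup_{n\to\infty}|X[Q_n]|=0$, the supremum being over all sequences $(Q_n)$ with $\mathrm{cr}(Q_n)=1$ for all $n$ and $S(Q_n)\to0$. *Width and $\overline\partial$.* Let $\phi_X^-(\eta)$ (resp. $\phi_X^+(\eta)$) be the supremum (resp. infimum) of $a(\eta)$ over the affine functions $a:\mathbb{R}^2\to\mathbb{R}$ with $a\le\phi_X$ (resp. $a\ge\phi_X$) on $\mathbb{S}^1$, and for $\eta\in\mathbb{D}^2$ let $$\omega_X(\eta)=\frac{\phi_X^+(\eta)-\phi_X^-(\eta)}{\sqrt{1-|\eta|^2}}.$$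 For a smooth vector field $V$ on $\mathbb{H}^2$ let $\overline\partial V(Y)=\tfrac12(\nabla_YV+\mathrm{J}\nabla_{\mathrm{J}Y}V)$, and let $\lVert\overline\partial V_p\rVert$ be its operator norm on $\mathrm{T}_p\mathbb{H}^2$ for the hyperbolic metric. **Theorem.** Let $X$ be a continuous vector field on $\mathbb{S}^1$. There is a unique smooth $u_X:\mathbb{H}^2\to\mathbb{R}$ whose graph $S_X$ is a mean surface with boundary at infinity the graph of $\phi_X$. Put $\mathrm{HL}(X)=V_{S_X}$. Then the following are equivalent: 1. $X$ is little Zygmund. 2. $\lVert\overline\partial\,\mathrm{HL}(X)_p\rVert\to0$ as $p\in\mathbb{H}^2$ tends to the boundary of $\mathbb{H}^2$, that is, as $|G(p)|\to1$. 3. $\omega_X(z)\to0$ as $|z|\to1$, $z\in\mathbb{D}^2$. -/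

import Mathlib

open Filter Topology
open scoped ENNReal ContDiff

noncomputable section

namespace HalfPipe

/-! ### Minkowski space and the hyperboloid -/

/-- The vector space underlying Minkowski space `ℝ^{1,2}`, with coordinates `(x₀, x₁, x₂)`. -/
abbrev Mink : Type := Fin 3 → ℝ

/-- The Minkowski bilinear form `-x₀y₀ + x₁y₁ + x₂y₂`. -/
def mink (x y : Mink) : ℝ := -(x 0 * y 0) + x 1 * y 1 + x 2 * y 2

/-- The Minkowski cross product `x ⊠ y`. -/
def cross (x y : Mink) : Mink :=
  ![-(x 1 * y 2 - x 2 * y 1), x 2 * y 0 - x 0 * y 2, x 0 * y 1 - x 1 * y 0]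

/-- The defining property of the cross product: `⟨x ⊠ y, v⟩ = det (x, y, v)`. -/
theorem mink_cross (x y v : Mink) : mink (cross x y) v = Matrix.det (Matrix.of ![x, y, v]) := by
  simp [mink, cross, Matrix.det_fin_three]
  ring

/-- The hyperboloid model of the hyperbolic plane. -/
def H2 : Type := {p : Mink // mink p p = -1 ∧ 0 < p 0}

instance : Coe H2 Mink := ⟨Subtype.val⟩

/-- The point `(1, η)` of Minkowski space, for `η ∈ ℝ² = ℂ`. -/
def lift1 (η : ℂ) : Mink := ![1, η.re, η.im]

/-- The base point `(1, 0, 0)`. -/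
def basePoint : H2 := ⟨![1, 0, 0], by simp [mink], by simp⟩

instance : Nonempty H2 := ⟨basePoint⟩

/-- The radial projection `Π` onto the Klein disk. -/
def klein (p : H2) : ℂ := ⟨p.1 1 / p.1 0, p.1 2 / p.1 0⟩

theorem lift1_mem {η : ℂ} (h : ‖η‖ < 1) :
    mink ((√(1 - ‖η‖ ^ 2))⁻¹ • lift1 η) ((√(1 - ‖η‖ ^ 2))⁻¹ • lift1 η) = -1 ∧
      0 < ((√(1 - ‖η‖ ^ 2))⁻¹ • lift1 η) 0 := by
  have h0 : 0 < 1 - ‖η‖ ^ 2 := by nlinarith [norm_nonneg η]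
  have hs : 0 < √(1 - ‖η‖ ^ 2) := Real.sqrt_pos.2 h0
  have hq : √(1 - ‖η‖ ^ 2) ^ 2 = 1 - ‖η‖ ^ 2 := Real.sq_sqrt h0.le
  have hn : ‖η‖ ^ 2 = η.re ^ 2 + η.im ^ 2 := by
    rw [Complex.sq_norm, Complex.normSq_apply]; ring
  constructor
  · simp only [mink, lift1, Pi.smul_apply, smul_eq_mul, Matrix.cons_val]
    field_simp
    rw [hq, hn]
    ring
  · simpa [lift1] using hs

open Classical in
/-- The inverse `η ↦ (1, η) / √(1 - |η|²)` of the radial projection, on the open unit disk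
(with an irrelevant value elsewhere). -/
def kleinInv (η : ℂ) : H2 :=
  if h : ‖η‖ < 1 then ⟨(√(1 - ‖η‖ ^ 2))⁻¹ • lift1 η, lift1_mem h⟩ else basePoint

/-- The isometry `G` from the hyperboloid onto the Poincaré disk. -/
def poincare (p : H2) : ℂ := ⟨p.1 1 / (1 + p.1 0), p.1 2 / (1 + p.1 0)⟩

/-- `v` is tangent to the hyperboloid at `p`. -/
def IsTangentAt (p : H2) (v : Mink) : Prop := mink p v = 0

/-- The orthogonal projection of Minkowski space onto the tangent plane at `p`. -/
def tangentProj (p : H2) (x : Mink) : Mink := x + mink x p • p.1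

/-- The norm of a tangent vector in the hyperbolic metric. -/
def hypNorm (v : Mink) : ℝ := √(mink v v)

/-- The complex structure `J` of the hyperbolic plane. -/
def J (p : H2) (v : Mink) : Mink := cross p v

/-- The differential of the radial projection at `p`, applied to the tangent vector `v`. -/
def dKlein (p : H2) (v : Mink) : ℂ :=
  ⟨(v 1 - v 0 * (klein p).re) / p.1 0, (v 2 - v 0 * (klein p).im) / p.1 0⟩

/-- The derivative at `p` of a vector-valued function on the hyperbolic plane, in the direction of
the tangent vector `v`, computed in the global chart given by the Klein model. -/
def dirDeriv {F : Type*} [NormedAddCommGroup F] [NormedSpace ℝ F]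
    (f : H2 → F) (p : H2) (v : Mink) : F :=
  fderiv ℝ (f ∘ kleinInv) (klein p) (dKlein p v)

/-- The Levi-Civita connection `∇_v V` of the hyperboloid: the tangential part of the flat
derivative of the tangent vector field `V`. -/
def leviCivita (V : H2 → Mink) (p : H2) (v : Mink) : Mink :=
  tangentProj p (dirDeriv V p v)

/-- The tensor `∂̄V(Y) = (∇_Y V + J ∇_{JY} V) / 2`. -/
def dbar (V : H2 → Mink) (p : H2) (Y : Mink) : Mink :=
  (1 / 2 : ℝ) • (leviCivita V p Y + J p (leviCivita V p (J p Y)))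

/-- The pointwise operator norm `‖∂̄V_p‖` with respect to the hyperbolic metric. -/
def dbarNorm (V : H2 → Mink) (p : H2) : ℝ :=
  sSup {r : ℝ | ∃ Y : Mink, IsTangentAt p Y ∧ Y ≠ 0 ∧ r = hypNorm (dbar V p Y) / hypNorm Y}

/-! ### Spacelike graphs in the half-pipe space `H² × ℝ` -/

/-- The tangent vector field along the graph of `u`, inside the lift `{(x, t) : x ∈ H²}` of the
half-pipe space in `ℝ⁴`, that lies above the tangent vector field `q ↦ tangentProj q w`. -/
def graphField (u : H2 → ℝ) (w : Mink) (q : H2) : Mink × ℝ :=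
  (tangentProj q w, dirDeriv u q (tangentProj q w))

/-- The half-pipe covariant derivative `D_V W - ⟨V, W⟩ N` of `graphField u w` in the direction of
the graph lying above `v`, where `N` is the position vector `(p, u p)`. -/
def halfPipeDeriv (u : H2 → ℝ) (p : H2) (v w : Mink) : Mink × ℝ :=
  dirDeriv (graphField u w) p v - mink v w • (p.1, u p)

/-- The second fundamental form of the graph of `u`, for `v`, `w` tangent at `p`: the component
along the vertical field `T = (0, 1)` in the splitting of the tangent space of the half-pipe space
into the tangent plane `{(x, du x)}` of the graph and the line spanned by `T`. -/
def secondFF (u : H2 → ℝ) (p : H2) (v w : Mink) : ℝ :=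
  (halfPipeDeriv u p v w).2 - dirDeriv u p (halfPipeDeriv u p v w).1

/-- The graph of `u` is a mean surface: the trace of its second fundamental form with respect to
the hyperbolic metric vanishes. -/
def IsMean (u : H2 → ℝ) : Prop :=
  ∀ (p : H2) (e₁ e₂ : Mink), IsTangentAt p e₁ → IsTangentAt p e₂ →
    mink e₁ e₁ = 1 → mink e₂ e₂ = 1 → mink e₁ e₂ = 0 →
    secondFF u p e₁ e₁ + secondFF u p e₂ e₂ = 0

/-- Smooth functions on the hyperbolic plane. -/
def IsSmooth (u : H2 → ℝ) : Prop :=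
  ContDiffOn ℝ ∞ (u ∘ kleinInv) (Metric.ball 0 1)

/-- The function `ū` on the Klein disk with `u(Π⁻¹ η) = ū(η) / √(1 - |η|²)`; its graph is the graph
of `u` seen in the Klein model of the half-pipe space. -/
def kleinFun (u : H2 → ℝ) (η : ℂ) : ℝ := √(1 - ‖η‖ ^ 2) * u (kleinInv η)

/-- `u` is smooth, its graph is a mean surface, and the boundary at infinity of this surface is the
graph of `φ`. -/
structure IsMeanGraph (φ : Circle → ℝ) (u : H2 → ℝ) : Prop where
  smooth : IsSmooth u
  mean : IsMean u
  boundary : ∀ z : Circle, Tendsto (kleinFun u) (𝓝[Metric.ball 0 1] (z : ℂ)) (𝓝 (φ z))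

/-- The vector `σ` of Minkowski space dual to the tangent plane at `(η₀, f η₀)` of the graph of a
function `f` on the Klein disk. -/
def dualVector (f : ℂ → ℝ) (η₀ : ℂ) : Mink :=
  ![-(f η₀ - fderiv ℝ f η₀ η₀), fderiv ℝ f η₀ 1, fderiv ℝ f η₀ Complex.I]

/-- The tangent plane is `{(η, t) : ⟨(1, η), σ⟩ = t}`. -/
theorem mink_lift1_dualVector (f : ℂ → ℝ) (η₀ η : ℂ) :
    mink (lift1 η) (dualVector f η₀) = f η₀ + fderiv ℝ f η₀ (η - η₀) := by
  have h : fderiv ℝ f η₀ η = η.re * fderiv ℝ f η₀ 1 + η.im * fderiv ℝ f η₀ Complex.I := by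
    have h1 : η = η.re • (1 : ℂ) + η.im • Complex.I := by
      apply Complex.ext <;> simp
    conv_lhs => rw [h1]
    simp only [map_add, map_smul, smul_eq_mul]
  rw [map_sub, h]
  simp [mink, lift1, dualVector]
  ring

/-- The vector field `V_S(p) = p ⊠ σ` associated with the graph `S` of `u`, where `σ` is dual to
the tangent plane of `S` above `p`. -/
def surfaceField (u : H2 → ℝ) (p : H2) : Mink :=
  cross p (dualVector (kleinFun u) (klein p))

/-! ### Vector fields on the circle -/

/-- `X` is tangent to the unit circle. -/
def IsTangentField (X : Circle → ℂ) : Prop := ∀ z : Circle, inner ℝ (z : ℂ) (X z) = 0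

/-- The support function `φ_X`, determined by `X z = i z φ_X z`. -/
def supportFun (X : Circle → ℂ) (z : Circle) : ℝ := (X z / (Complex.I * z)).re

theorem IsTangentField.eq_supportFun {X : Circle → ℂ} (hX : IsTangentField X) (z : Circle) :
    X z = Complex.I * z * supportFun X z := by
  have hz : (z : ℂ) ≠ 0 := z.coe_ne_zero
  have h0 : (X z / (Complex.I * z)).im = 0 := by
    have h1 := hX z
    have h2 : X z / (Complex.I * z) = -Complex.I * (X z * (starRingEnd ℂ) z) := by
      rw [← Circle.coe_inv_eq_conj, Circle.coe_inv]
      field_simp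
      simp
    rw [h2]
    rw [Complex.inner] at h1
    simp at h1 ⊢
    linarith
  have h3 : ((supportFun X z : ℝ) : ℂ) = X z / (Complex.I * z) := by
    apply Complex.ext <;> simp [supportFun, h0]
  rw [h3]
  field_simp

/-- The function `u_X` whose graph is the mean surface with boundary at infinity the graph of the
support function of `X`. -/
def meanFun (X : Circle → ℂ) : H2 → ℝ := Classical.epsilon (IsMeanGraph (supportFun X))

/-- The harmonic Lagrangian vector field `HL(X)`. -/
def HL (X : Circle → ℂ) : H2 → Mink := surfaceField (meanFun X)

/-- `φ⁻`: the supremum of the affine functions lying below `φ` on the circle. -/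
def lowerEnv (φ : Circle → ℝ) (η : ℂ) : ℝ :=
  sSup {t : ℝ | ∃ a : ℂ →ᵃ[ℝ] ℝ, (∀ z : Circle, a z ≤ φ z) ∧ t = a η}

/-- `φ⁺`: the infimum of the affine functions lying above `φ` on the circle. -/
def upperEnv (φ : Circle → ℝ) (η : ℂ) : ℝ :=
  sInf {t : ℝ | ∃ a : ℂ →ᵃ[ℝ] ℝ, (∀ z : Circle, φ z ≤ a z) ∧ t = a η}

/-- The pointwise width `ω_X` on the Klein disk. -/
def width (X : Circle → ℂ) (η : ℂ) : ℝ :=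
  (upperEnv (supportFun X) η - lowerEnv (supportFun X) η) / √(1 - ‖η‖ ^ 2)

/-- A quadruple of points of the circle in counter-clockwise order. -/
structure Quadruple where
  (a b c d : Circle)
  ccw : ∃ α β γ δ : ℝ, α < β ∧ β < γ ∧ γ < δ ∧ δ < α + 2 * Real.pi ∧
    a = Circle.exp α ∧ b = Circle.exp β ∧ c = Circle.exp γ ∧ d = Circle.exp δ

/-- The cross-ratio of a quadruple. -/
def Quadruple.cr (Q : Quadruple) : ℂ :=
  ((Q.b - Q.a : ℂ) * (Q.d - Q.c)) / ((Q.c - Q.b) * (Q.d - Q.a))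

/-- The minimal scale of a quadruple. -/
def Quadruple.scale (Q : Quadruple) : ℝ :=
  min (min ‖(Q.a - Q.b : ℂ)‖ ‖(Q.b - Q.c : ℂ)‖) (min ‖(Q.c - Q.d : ℂ)‖ ‖(Q.d - Q.a : ℂ)‖)

/-- The cross-ratio distortion `X[Q]`. -/
def distortion (X : Circle → ℂ) (Q : Quadruple) : ℂ :=
  (X Q.b - X Q.a) / (Q.b - Q.a) - (X Q.c - X Q.b) / (Q.c - Q.b)
    + (X Q.d - X Q.c) / (Q.d - Q.c) - (X Q.a - X Q.d) / (Q.a - Q.d)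

/-- The cross-ratio distortion norm of `X`. -/
def crNorm (X : Circle → ℂ) : ℝ≥0∞ := ⨆ (Q : Quadruple) (_ : Q.cr = 1), ‖distortion X Q‖ₑ

/-- Zygmund vector fields. -/
def IsZygmund (X : Circle → ℂ) : Prop := Continuous X ∧ crNorm X < ⊤

/-- Degenerating sequences of quadruples. -/
def IsDegenerating (Q : ℕ → Quadruple) : Prop :=
  (∀ n, (Q n).cr = 1) ∧ Tendsto (fun n => (Q n).scale) atTop (𝓝 0)

/-- Little Zygmund vector fields. -/
def IsLittleZygmund (X : Circle → ℂ) : Prop :=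
  IsZygmund X ∧
    (⨆ (Q : ℕ → Quadruple) (_ : IsDegenerating Q),
      limsup (fun n => ‖distortion X (Q n)‖ₑ) atTop) = 0

end HalfPipe

end

open HalfPipe

noncomputable section

namespace HalfPipe

/-! ### Elementary geometry of the hyperboloid -/

/-! In the Klein model everything is governed by the degree-one homogeneous extension `x ↦ x₀
f(x₁/x₀, x₂/x₀)` of `f = kleinFun u` to the future cone. Its Hessian on the tangent plane at `p` is
`hessForm`, which equals the second fundamental form of the graph (`secondFF_eq`). So a mean surface
is one with trace-free Hessian. For such a surface `∂̄` of the associated field is `J` composed with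
the shape operator (`dbar_surfaceField`), and `‖∂̄‖` is the size of the Hessian.

Uniqueness is the maximum principle for this linear elliptic equation, which has no zeroth-order
term in `f`. Existence is a Poisson formula: `u p` is the mean of `φ(θ) (-⟨p, ℓ_θ⟩)⁻²` over the null
vectors `ℓ_θ = (1, cos θ, sin θ)`.

1 ⇒ 2. Parametrize the circle by the visual angle `τ` from `p`. The Hessian in the unit direction of
angle `τ₀` is the mean of `3 cos 2(τ - τ₀)` times the boundary function seen from `p`
(`hessForm_eq_integral`). This kernel changes sign under a quarter turn, so only the alternating sum
of the boundary function over four points at quarter turns matters. That sum is the distortion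
`X[Q]` of a quadruple of cross-ratio one (`distortion_visQuad`), whose scale is at most `2 / p₀`.

2 ⇒ 3. On the line `p + t v`, which for unit `v` reaches the light cone at `t = 1`, the second
derivative of the homogeneous extension is at most `(1 - t²)^(-3/2) ‖∂̄‖`. If `‖∂̄‖ ≤ ε + K
p₀^(-1/2)`, integrating twice still converges at `t = 1`, so `φ` stays close to the tangent plane at
`p` (`abs_boundary_sub_tangent_le`). Two affine functions then enclose `φ` and bound the width.

3 ⇒ 1. When the cross-ratio is one, the coefficients of `φ` in `X[Q]` are positive weights that
balance on the two diagonals of the quadrilateral. These diagonals meet at a point `klein p`, and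
comparing `φ` along them with the two envelopes gives `|X[Q]| ≤ 2 ω_X` there
(`exists_norm_distortion_le`). Since `p₀` times the scale is bounded below, degenerating quadruples
send `p` to infinity. -/

theorem H2.pos (p : H2) : 0 < p.1 0 := p.2.2

theorem H2.sq (p : H2) : p.1 0 ^ 2 = 1 + p.1 1 ^ 2 + p.1 2 ^ 2 := by
  have := p.2.1
  simp only [mink] at this
  linarith

theorem H2.one_le (p : H2) : 1 ≤ p.1 0 := by
  nlinarith [p.pos, p.sq, sq_nonneg (p.1 1), sq_nonneg (p.1 2)]

theorem sq_norm_eq (η : ℂ) : ‖η‖ ^ 2 = η.re ^ 2 + η.im ^ 2 := by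
  rw [Complex.sq_norm, Complex.normSq_apply]; ring

theorem one_sub_sq_norm_klein (p : H2) : 1 - ‖klein p‖ ^ 2 = (p.1 0 ^ 2)⁻¹ := by
  have := p.pos
  rw [sq_norm_eq]
  simp only [klein]
  field_simp
  linarith [p.sq]

theorem sqrt_klein (p : H2) : √(1 - ‖klein p‖ ^ 2) = (p.1 0)⁻¹ := by
  rw [one_sub_sq_norm_klein, ← inv_pow, Real.sqrt_sq (inv_nonneg.2 p.pos.le)]

theorem norm_klein_lt (p : H2) : ‖klein p‖ < 1 := by
  have h : 0 < 1 - ‖klein p‖ ^ 2 := by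
    rw [one_sub_sq_norm_klein]
    have := p.pos
    positivity
  nlinarith [norm_nonneg (klein p)]

theorem klein_mem_ball (p : H2) : klein p ∈ Metric.ball (0 : ℂ) 1 := by
  simpa using norm_klein_lt p

theorem lift1_klein (p : H2) : p.1 0 • lift1 (klein p) = p.1 := by
  have := p.pos
  ext i
  fin_cases i <;> simp [lift1, klein] <;> field_simp

theorem kleinInv_val {η : ℂ} (h : ‖η‖ < 1) :
    (kleinInv η).1 = (√(1 - ‖η‖ ^ 2))⁻¹ • lift1 η := by
  simp [kleinInv, h]

theorem kleinInv_klein (p : H2) : kleinInv (klein p) = p := by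
  apply Subtype.ext
  rw [kleinInv_val (norm_klein_lt p), sqrt_klein, inv_inv, lift1_klein]

theorem sqrt_pos_of_norm_lt {η : ℂ} (h : ‖η‖ < 1) : 0 < √(1 - ‖η‖ ^ 2) :=
  Real.sqrt_pos.2 (by nlinarith [norm_nonneg η])

theorem kleinInv_zero {η : ℂ} (h : ‖η‖ < 1) : (kleinInv η).1 0 = (√(1 - ‖η‖ ^ 2))⁻¹ := by
  simp [kleinInv_val h, lift1]

theorem klein_kleinInv {η : ℂ} (h : ‖η‖ < 1) : klein (kleinInv η) = η := by
  have := sqrt_pos_of_norm_lt h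
  apply Complex.ext <;> simp [klein, kleinInv_val h, lift1] <;> field_simp

theorem kleinFun_klein (u : H2 → ℝ) (p : H2) : kleinFun u (klein p) = (p.1 0)⁻¹ * u p := by
  rw [kleinFun, sqrt_klein, kleinInv_klein]

/-- The first vector of the standard orthonormal frame of the hyperboloid. -/
def frameFst (p : H2) : Mink :=
  ![p.1 1, 1 + p.1 1 ^ 2 / (1 + p.1 0), p.1 1 * p.1 2 / (1 + p.1 0)]

/-- The second vector of the standard orthonormal frame of the hyperboloid. -/
def frameSnd (p : H2) : Mink :=
  ![p.1 2, p.1 1 * p.1 2 / (1 + p.1 0), 1 + p.1 2 ^ 2 / (1 + p.1 0)]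

theorem mink_comm (x y : Mink) : mink x y = mink y x := by simp only [mink]; ring

theorem mink_add_right (x y z : Mink) : mink x (y + z) = mink x y + mink x z := by
  simp [mink]; ring

theorem mink_add_left (x y z : Mink) : mink (x + y) z = mink x z + mink y z := by
  simp [mink]; ring

theorem mink_smul_right (c : ℝ) (x y : Mink) : mink x (c • y) = c * mink x y := by
  simp [mink]; ring

theorem mink_smul_left (c : ℝ) (x y : Mink) : mink (c • x) y = c * mink x y := by
  simp [mink]; ring

theorem mink_frameFst (p : H2) : mink p.1 (frameFst p) = 0 := by
  have := p.pos
  have := p.sq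
  simp only [mink, frameFst, Matrix.cons_val]
  field_simp
  linear_combination (-p.1 1) * p.sq

theorem mink_frameSnd (p : H2) : mink p.1 (frameSnd p) = 0 := by
  have := p.pos
  simp only [mink, frameSnd, Matrix.cons_val]
  field_simp
  linear_combination (-p.1 2) * p.sq

theorem mink_frameFst_self (p : H2) : mink (frameFst p) (frameFst p) = 1 := by
  have := p.pos
  simp only [mink, frameFst, Matrix.cons_val]
  field_simp
  linear_combination (-p.1 1 ^ 2) * p.sq

theorem mink_frameSnd_self (p : H2) : mink (frameSnd p) (frameSnd p) = 1 := by
  have := p.pos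
  simp only [mink, frameSnd, Matrix.cons_val]
  field_simp
  linear_combination (-p.1 2 ^ 2) * p.sq

theorem mink_frameFst_frameSnd (p : H2) : mink (frameFst p) (frameSnd p) = 0 := by
  have := p.pos
  simp only [mink, frameFst, frameSnd, Matrix.cons_val]
  field_simp
  linear_combination (-p.1 1 * p.1 2) * p.sq

theorem J_frameFst (p : H2) : J p (frameFst p) = frameSnd p := by
  have := p.pos
  ext i
  fin_cases i <;> simp [J, cross, frameFst, frameSnd] <;> field_simp
  · ring
  · ring
  · linear_combination p.sq

theorem J_frameSnd (p : H2) : J p (frameSnd p) = -frameFst p := by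
  have := p.pos
  ext i
  fin_cases i <;> simp [J, cross, frameFst, frameSnd] <;> field_simp
  · ring
  · linear_combination -p.sq
  · ring

theorem tangent_eq_frame {p : H2} {Y : Mink} (hY : IsTangentAt p Y) :
    Y = mink Y (frameFst p) • frameFst p + mink Y (frameSnd p) • frameSnd p := by
  have h0 := p.pos
  have h1 := p.sq
  -- The frame is polynomial in `p` and `r`; `hr2` and `hr3` are the hyperboloid equation in a form
  -- free of denominators.
  obtain ⟨r, hr⟩ : ∃ r : ℝ, r = (1 + p.1 0)⁻¹ := ⟨_, rfl⟩
  have hr1 : r * (1 + p.1 0) = 1 := by rw [hr]; field_simp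
  have hr2 : (p.1 1 ^ 2 + p.1 2 ^ 2) * r = p.1 0 - 1 := by
    linear_combination (p.1 0 - 1) * hr1 - r * h1
  have hr3 : (p.1 1 ^ 2 + p.1 2 ^ 2) * r ^ 2 = 1 - 2 * r := by
    linear_combination r * hr2 + hr1
  simp only [IsTangentAt, mink] at hY
  ext i
  fin_cases i <;>
    simp only [mink, frameFst, frameSnd, Matrix.cons_val, div_eq_mul_inv, ← hr, Pi.add_apply,
      Pi.smul_apply, smul_eq_mul, Fin.zero_eta, Fin.mk_one, Fin.reduceFinMk]
  · linear_combination (-Y 0) * h1 - (Y 1 * p.1 1 + Y 2 * p.1 2) * hr2 - p.1 0 * hY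
  · linear_combination (-p.1 1 * (p.1 1 * Y 1 + p.1 2 * Y 2)) * hr3 - p.1 1 * hY + p.1 1 * Y 0 * hr2
  · linear_combination (-p.1 2 * (p.1 1 * Y 1 + p.1 2 * Y 2)) * hr3 - p.1 2 * hY + p.1 2 * Y 0 * hr2

theorem mink_self_tangent {p : H2} {Y : Mink} (hY : IsTangentAt p Y) :
    mink Y Y = mink Y (frameFst p) ^ 2 + mink Y (frameSnd p) ^ 2 := by
  conv_lhs => rw [tangent_eq_frame hY]
  simp only [mink_add_left, mink_add_right, mink_smul_left, mink_smul_right, mink_frameFst_self,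
    mink_frameSnd_self, mink_frameFst_frameSnd, mink_comm (frameSnd p) (frameFst p)]
  ring

/-! ### The second fundamental form and the `∂̄` operator in the Klein model -/

/-- The factor `1 / √(1 - |η|²)`. -/
def lorentz (η : ℂ) : ℝ := (√(1 - ‖η‖ ^ 2))⁻¹

theorem lorentz_pos {η : ℂ} (h : ‖η‖ < 1) : 0 < lorentz η := inv_pos.2 (sqrt_pos_of_norm_lt h)

theorem lorentz_klein (p : H2) : lorentz (klein p) = p.1 0 := by
  rw [lorentz, sqrt_klein, inv_inv]

/-- The Euclidean inner product with `η`, as a linear form on `ℂ`. -/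
def dotL (η : ℂ) : ℂ →L[ℝ] ℝ := η.re • Complex.reCLM + η.im • Complex.imCLM

theorem dotL_apply (η ξ : ℂ) : dotL η ξ = η.re * ξ.re + η.im * ξ.im := by simp [dotL]

theorem hasFDerivAt_lorentz {η : ℂ} (h : ‖η‖ < 1) :
    HasFDerivAt lorentz (lorentz η ^ 3 • dotL η) η := by
  have h0 : 0 < 1 - ‖η‖ ^ 2 := by nlinarith [norm_nonneg η]
  have hs := sqrt_pos_of_norm_lt h
  have h1 : HasFDerivAt (fun η : ℂ => 1 - ‖η‖ ^ 2) (-(2 : ℝ) • dotL η) η := by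
    have h2 : HasFDerivAt (fun η : ℂ => 1 - (η.re ^ 2 + η.im ^ 2)) _ η :=
      (((Complex.reCLM.hasFDerivAt (x := η)).pow 2).add
        ((Complex.imCLM.hasFDerivAt (x := η)).pow 2)).const_sub 1
    have h3 : (fun η : ℂ => 1 - ‖η‖ ^ 2) = fun η : ℂ => 1 - (η.re ^ 2 + η.im ^ 2) := by
      ext η; rw [sq_norm_eq]
    rw [h3]
    refine h2.congr_fderiv ?_
    ext; simp [dotL]; ring
  have h2 := (hasDerivAt_inv hs.ne').comp_hasFDerivAt η (h1.sqrt h0.ne')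
  refine h2.congr_fderiv ?_
  ext; simp [lorentz]; field_simp

theorem contDiffOn_lorentz : ContDiffOn ℝ ∞ lorentz (Metric.ball 0 1) := by
  intro η hη
  have h : ‖η‖ < 1 := by simpa using hη
  have h0 : 0 < 1 - ‖η‖ ^ 2 := by nlinarith [norm_nonneg η]
  have h1 : ContDiffAt ℝ ∞ (fun η : ℂ => 1 - ‖η‖ ^ 2) η :=
    contDiffAt_const.sub (contDiff_norm_sq ℝ).contDiffAt
  exact ((h1.sqrt h0.ne').inv (sqrt_pos_of_norm_lt h).ne').contDiffWithinAt

theorem kleinFun_eq {u : H2 → ℝ} {η : ℂ} (h : ‖η‖ < 1) :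
    u (kleinInv η) = lorentz η * kleinFun u η := by
  have := sqrt_pos_of_norm_lt h
  rw [kleinFun, lorentz]
  field_simp

theorem IsSmooth.kleinFun {u : H2 → ℝ} (hu : IsSmooth u) :
    ContDiffOn ℝ ∞ (kleinFun u) (Metric.ball 0 1) := by
  have h1 : ContDiffOn ℝ ∞ (fun η => (lorentz η)⁻¹ * (u ∘ kleinInv) η) (Metric.ball 0 1) :=
    (contDiffOn_lorentz.inv fun η hη => (lorentz_pos (by simpa using hη)).ne').mul hu
  refine h1.congr fun η _ => ?_
  simp [lorentz, HalfPipe.kleinFun]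

/-- The inclusion `η ↦ (1, η)` has this derivative. -/
def lift1D : ℂ →L[ℝ] Mink :=
  ContinuousLinearMap.pi ![0, Complex.reCLM, Complex.imCLM]

theorem lift1D_apply (ξ : ℂ) : lift1D ξ = ![0, ξ.re, ξ.im] := by
  ext i; fin_cases i <;> simp [lift1D]

theorem hasFDerivAt_lift1 (η : ℂ) : HasFDerivAt lift1 lift1D η := by
  have h : lift1 = fun η => lift1D η + ![1, 0, 0] := by
    ext η i; fin_cases i <;> simp [lift1D, lift1]
  rw [h]
  exact lift1D.hasFDerivAt.add_const _

/-- The derivative of the inverse of the radial projection. -/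
def kleinInvD (η : ℂ) : ℂ →L[ℝ] Mink :=
  lorentz η • lift1D + (lorentz η ^ 3 • dotL η).smulRight (lift1 η)

theorem eventually_norm_lt {η : ℂ} (h : ‖η‖ < 1) : ∀ᶠ ξ in 𝓝 η, ‖ξ‖ < 1 :=
  continuous_norm.continuousAt.eventually_lt continuousAt_const h

theorem hasFDerivAt_kleinInv {η : ℂ} (h : ‖η‖ < 1) :
    HasFDerivAt (fun η => (kleinInv η).1) (kleinInvD η) η := by
  refine ((hasFDerivAt_lorentz h).smul (hasFDerivAt_lift1 η)).congr_of_eventuallyEq ?_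
  filter_upwards [eventually_norm_lt h] with ξ hξ
  rw [kleinInv_val hξ]; rfl

theorem kleinInvD_dKlein {p : H2} {v : Mink} (hv : IsTangentAt p v) :
    kleinInvD (klein p) (dKlein p v) = v := by
  have h0 := p.pos
  have h1 := p.sq
  simp only [IsTangentAt, mink] at hv
  have h2 : (p.1 0 ^ 3 * dotL (klein p) (dKlein p v)) = v 0 := by
    simp only [dotL_apply, dKlein, klein]
    field_simp
    linear_combination p.1 0 * hv + v 0 * h1
  simp only [kleinInvD, lorentz_klein, add_apply,
    smul_apply, ContinuousLinearMap.smulRight_apply, lift1D_apply, smul_eq_mul,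
    h2]
  ext i
  fin_cases i <;> simp [lift1, dKlein] <;> field_simp <;> ring

/-- The Minkowski product with `w` as a continuous linear form. -/
def minkL (w : Mink) : Mink →L[ℝ] ℝ :=
  (-w 0) • ContinuousLinearMap.proj 0 + w 1 • ContinuousLinearMap.proj 1
    + w 2 • ContinuousLinearMap.proj 2

theorem minkL_apply (w x : Mink) : minkL w x = mink w x := by simp [minkL, mink]

/-- The flat Hessian of a function on the Klein disk, as a bilinear form on the tangent plane of
the hyperboloid, weighted so as to be invariant under isometries. -/
def hessForm (f : ℂ → ℝ) (p : H2) (v w : Mink) : ℝ :=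
  p.1 0 * fderiv ℝ (fderiv ℝ f) (klein p) (dKlein p v) (dKlein p w)

/-- The affine vector field `η ↦ (w₁, w₂) - w₀ η`, proportional to the projection of `w`. -/
def affField (w : Mink) (η : ℂ) : ℂ := ⟨w 1, w 2⟩ - w 0 • η

theorem hasFDerivAt_affField (w : Mink) (η : ℂ) :
    HasFDerivAt (affField w) (-(w 0 • ContinuousLinearMap.id ℝ ℂ)) η :=
  ((hasFDerivAt_id η).const_smul (w 0)).const_sub _

theorem dKlein_tangentProj {η : ℂ} (h : ‖η‖ < 1) (w : Mink) :
    dKlein (kleinInv η) (tangentProj (kleinInv η) w) = (lorentz η)⁻¹ • affField w η := by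
  have hs := sqrt_pos_of_norm_lt h
  apply Complex.ext <;>
    simp [dKlein, tangentProj, klein_kleinInv h, kleinInv_val h, affField, lorentz, lift1] <;>
    field_simp <;> ring

theorem dKlein_eq (p : H2) (v : Mink) : dKlein p v = (p.1 0)⁻¹ • affField v (klein p) := by
  apply Complex.ext <;> simp [dKlein, affField] <;> field_simp

variable {f : ℂ → ℝ}

theorem ContDiffOn.hasFDerivAt_ball (hf : ContDiffOn ℝ ∞ f (Metric.ball 0 1)) {η : ℂ}
    (h : ‖η‖ < 1) : HasFDerivAt f (fderiv ℝ f η) η := by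
  have h1 : ContDiffAt ℝ ∞ f η := hf.contDiffAt (Metric.isOpen_ball.mem_nhds (by simpa using h))
  exact (h1.differentiableAt (by simp)).hasFDerivAt

theorem ContDiffOn.hasFDerivAt_fderiv_ball (hf : ContDiffOn ℝ ∞ f (Metric.ball 0 1)) {η : ℂ}
    (h : ‖η‖ < 1) : HasFDerivAt (fderiv ℝ f) (fderiv ℝ (fderiv ℝ f) η) η := by
  have h1 : ContDiffAt ℝ ∞ f η := hf.contDiffAt (Metric.isOpen_ball.mem_nhds (by simpa using h))
  have h2 : ContDiffAt ℝ 1 (fderiv ℝ f) η := h1.fderiv_right (by norm_cast)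
  exact (h2.differentiableAt (by simp)).hasFDerivAt

/-- The factor `(lorentz η)⁻¹` of the projected field cancels the one in `u = lorentz · kleinFun u`,
which leaves derivatives along the affine field `affField w`. -/
theorem graphField_kleinInv_snd {u : H2 → ℝ} (hu : IsSmooth u) (w : Mink) {η : ℂ} (h : ‖η‖ < 1) :
    (graphField u w (kleinInv η)).2 = fderiv ℝ (kleinFun u) η (affField w η)
      + kleinFun u η * lorentz η ^ 2 * dotL η (affField w η) := by
  have h1 : HasFDerivAt (u ∘ kleinInv) _ η :=
    ((hasFDerivAt_lorentz h).mul (ContDiffOn.hasFDerivAt_ball hu.kleinFun h)).congr_of_eventuallyEq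
      (by filter_upwards [eventually_norm_lt h] with ξ hξ using kleinFun_eq hξ)
  have h2 := lorentz_pos h
  simp only [graphField, dirDeriv, klein_kleinInv h, dKlein_tangentProj h, h1.fderiv]
  simp only [add_apply, smul_apply, map_smul, smul_eq_mul]
  field_simp

/-- All terms of order at most one in `f` cancel, because graphs of affine functions in the Klein
model are totally geodesic in half-pipe space. -/
theorem secondFF_eq {u : H2 → ℝ} (hu : IsSmooth u) {p : H2} {v w : Mink}
    (hv : IsTangentAt p v) (hw : IsTangentAt p w) :
    secondFF u p v w = hessForm (kleinFun u) p v w := by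
  set η := klein p with hη
  have h : ‖η‖ < 1 := norm_klein_lt p
  have hf := hu.kleinFun
  set f := kleinFun u with hfdef
  have h1 := hasFDerivAt_kleinInv h
  have hA : HasFDerivAt (fun ξ => tangentProj (kleinInv ξ) w) _ η :=
    (((minkL w).hasFDerivAt.comp η h1).smul h1).const_add w
      |>.congr_of_eventuallyEq (.of_forall fun ξ => by
        simp [tangentProj, minkL_apply])
  have hB : HasFDerivAt (fun ξ => (graphField u w (kleinInv ξ)).2) _ η :=
    ((ContDiffOn.hasFDerivAt_fderiv_ball hf h).clm_apply (hasFDerivAt_affField w η)).add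
      (((ContDiffOn.hasFDerivAt_ball hf h).mul ((hasFDerivAt_lorentz h).pow 2)).mul
        ((((Complex.reCLM.hasFDerivAt (x := η)).mul
          (Complex.reCLM.hasFDerivAt.comp η (hasFDerivAt_affField w η))).add
        ((Complex.imCLM.hasFDerivAt (x := η)).mul
          (Complex.imCLM.hasFDerivAt.comp η (hasFDerivAt_affField w η))))))
      |>.congr_of_eventuallyEq (by
        filter_upwards [eventually_norm_lt h] with ξ hξ
        rw [graphField_kleinInv_snd hu w hξ, dotL_apply]; rfl)
  have hC : HasFDerivAt (graphField u w ∘ kleinInv) _ η := hA.prodMk hB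
  have h0 := p.pos
  have hsq := p.sq
  -- The derivative of `q ↦ w + ⟨w, q⟩ q` along `v` is `⟨w, v⟩ p + ⟨w, p⟩ v`; the first term is what
  -- the connection subtracts, and the second vanishes by tangency.
  have hfst : (halfPipeDeriv u p v w).1 = 0 := by
    simp only [halfPipeDeriv, dirDeriv, ← hη, hC.fderiv]
    simp only [kleinInvD_dKlein hv, Prod.fst_sub, ContinuousLinearMap.prod_apply,
      Prod.smul_fst, add_apply, smul_apply,
      ContinuousLinearMap.smulRight_apply, ContinuousLinearMap.comp_apply, hη, minkL_apply,
      kleinInv_klein, Function.comp_apply]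
    rw [mink_comm w p.1, show mink p.1 w = 0 from hw, mink_comm w v]
    simp
  have hzero : dirDeriv u p 0 = 0 := by
    have : dKlein p 0 = 0 := by apply Complex.ext <;> simp [dKlein]
    rw [dirDeriv, this, map_zero]
  rw [secondFF, hfst, hzero, sub_zero, hessForm]
  simp only [halfPipeDeriv, dirDeriv, ← hη, hC.fderiv]
  have hup : u p = p.1 0 * f η := by
    rw [hfdef, hη, kleinFun_klein]; field_simp
  have hlo : lorentz η = p.1 0 := lorentz_klein p
  have hLw : affField w η = p.1 0 • dKlein p w := by
    rw [dKlein_eq, ← hη, smul_smul, mul_inv_cancel₀ h0.ne', one_smul]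
  simp only [Prod.snd_sub, ContinuousLinearMap.prod_apply, Prod.smul_snd, hup, hlo]
  have hre : (affField w η).re = w 1 - w 0 * η.re := by simp [affField]
  have him : (affField w η).im = w 2 - w 0 * η.im := by simp [affField]
  simp [hre, him, dotL_apply, hlo]
  rw [hLw, map_smul, smul_eq_mul]
  simp only [IsTangentAt, mink] at hv hw
  -- `k1` and `k2` express the tangency of `w` and the product `mink v w` in Klein coordinates; they
  -- absorb the terms in `f` and `fderiv ℝ f`.
  have k1 : p.1 0 ^ 2 * (η.re * (w 1 - w 0 * η.re) + η.im * (w 2 - w 0 * η.im)) = w 0 := by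
    simp only [show η.re = p.1 1 / p.1 0 from rfl, show η.im = p.1 2 / p.1 0 from rfl]
    field_simp
    linear_combination p.1 0 * hw + w 0 * hsq
  have k2 : p.1 0 * (w 1 * (dKlein p v).re + w 2 * (dKlein p v).im) = mink v w := by
    simp only [dKlein, klein, mink]
    field_simp
    linear_combination (-v 0) * hw
  linear_combination (fderiv ℝ f η (dKlein p v) +
    2 * f η * p.1 0 ^ 2 * (η.re * (dKlein p v).re + η.im * (dKlein p v).im)) * k1
    + (f η * p.1 0) * k2

/-! ### Bilinearity of the Hessian form and the mean equation. -/

theorem dKlein_add (p : H2) (v w : Mink) : dKlein p (v + w) = dKlein p v + dKlein p w := by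
  apply Complex.ext <;> simp [dKlein] <;> ring

theorem dKlein_smul (p : H2) (c : ℝ) (v : Mink) : dKlein p (c • v) = c • dKlein p v := by
  apply Complex.ext <;> simp [dKlein] <;> ring

theorem hessForm_add_left (f : ℂ → ℝ) (p : H2) (v v' w : Mink) :
    hessForm f p (v + v') w = hessForm f p v w + hessForm f p v' w := by
  simp [hessForm, dKlein_add]; ring

theorem hessForm_add_right (f : ℂ → ℝ) (p : H2) (v w w' : Mink) :
    hessForm f p v (w + w') = hessForm f p v w + hessForm f p v w' := by
  simp [hessForm, dKlein_add]; ring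

theorem hessForm_smul_left (f : ℂ → ℝ) (p : H2) (c : ℝ) (v w : Mink) :
    hessForm f p (c • v) w = c * hessForm f p v w := by
  rw [hessForm, dKlein_smul, map_smul, smul_apply, smul_eq_mul, hessForm]; ring

theorem hessForm_smul_right (f : ℂ → ℝ) (p : H2) (c : ℝ) (v w : Mink) :
    hessForm f p v (c • w) = c * hessForm f p v w := by
  rw [hessForm, dKlein_smul, map_smul, smul_eq_mul, hessForm]; ring

theorem hessForm_comm (hf : ContDiffOn ℝ ∞ f (Metric.ball 0 1)) (p : H2) (v w : Mink) :
    hessForm f p v w = hessForm f p w v := by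
  have h1 : ContDiffAt ℝ ∞ f (klein p) :=
    hf.contDiffAt (Metric.isOpen_ball.mem_nhds (klein_mem_ball p))
  have h2 : IsSymmSndFDerivAt ℝ f (klein p) :=
    h1.isSymmSndFDerivAt (by simp; norm_cast)
  rw [hessForm, hessForm, h2]

/-- The quadratic form of a symmetric bilinear form in the standard frame. -/
theorem hessForm_frame (hf : ContDiffOn ℝ ∞ f (Metric.ball 0 1)) (p : H2) (x y : ℝ) :
    hessForm f p (x • frameFst p + y • frameSnd p) (x • frameFst p + y • frameSnd p)
      = x ^ 2 * hessForm f p (frameFst p) (frameFst p)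
        + 2 * x * y * hessForm f p (frameFst p) (frameSnd p)
        + y ^ 2 * hessForm f p (frameSnd p) (frameSnd p) := by
  simp only [hessForm_add_left, hessForm_add_right, hessForm_smul_left, hessForm_smul_right,
    hessForm_comm hf p (frameSnd p) (frameFst p)]
  ring

theorem hessForm_eq_of_tangent (f : ℂ → ℝ) {p : H2} {Y : Mink} (hY : IsTangentAt p Y) (w : Mink) :
    hessForm f p Y w = mink Y (frameFst p) * hessForm f p (frameFst p) w
      + mink Y (frameSnd p) * hessForm f p (frameSnd p) w := by
  conv_lhs => rw [tangent_eq_frame hY]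
  rw [hessForm_add_left, hessForm_smul_left, hessForm_smul_left]

theorem isMean_iff {u : H2 → ℝ} (hu : IsSmooth u) :
    IsMean u ↔ ∀ p, hessForm (kleinFun u) p (frameFst p) (frameFst p)
      + hessForm (kleinFun u) p (frameSnd p) (frameSnd p) = 0 := by
  constructor
  · intro h p
    have := h p _ _ (mink_frameFst p) (mink_frameSnd p) (mink_frameFst_self p)
      (mink_frameSnd_self p) (mink_frameFst_frameSnd p)
    rwa [secondFF_eq hu (mink_frameFst p) (mink_frameFst p),
      secondFF_eq hu (mink_frameSnd p) (mink_frameSnd p)] at this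
  · intro h p e₁ e₂ h1 h2 h11 h22 h12
    rw [secondFF_eq hu h1 h1, secondFF_eq hu h2 h2]
    have k1 := tangent_eq_frame h1
    have k2 := tangent_eq_frame h2
    rw [mink_self_tangent h1] at h11
    rw [mink_self_tangent h2] at h22
    generalize mink e₁ (frameFst p) = x at *
    generalize mink e₁ (frameSnd p) = y at *
    generalize mink e₂ (frameFst p) = z at *
    generalize mink e₂ (frameSnd p) = w at *
    rw [k1, k2] at h12 ⊢
    simp only [mink_add_left, mink_add_right, mink_smul_left, mink_smul_right, mink_frameFst_self,
      mink_frameSnd_self, mink_frameFst_frameSnd, mink_comm (frameSnd p) (frameFst p)] at h12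
    rw [hessForm_frame hu.kleinFun, hessForm_frame hu.kleinFun]
    -- The matrix with rows `(x, y)` and `(z, w)` is orthogonal; `h3`, `h4` and `h5` turn the row
    -- relations into column relations.
    have h3 : x ^ 2 = w ^ 2 := by
      linear_combination (-x ^ 2) * h22 + w ^ 2 * h11 + (x * z - y * w) * h12
    have h4 : x * y + z * w = 0 := by
      linear_combination (y * z + x * w) * h12 - x * y * h22 - z * w * h11
    have h5 : z ^ 2 = y ^ 2 := by linarith
    linear_combination (y ^ 2 + w ^ 2) * h p
      + hessForm (kleinFun u) p (frameFst p) (frameFst p) * (h3 + h5)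
      + 2 * hessForm (kleinFun u) p (frameFst p) (frameSnd p) * h4

/-! #### The `∂̄` operator -/

/-- The derivative of the dual vector along the projection of `Y`: the shape operator. -/
def shape (f : ℂ → ℝ) (p : H2) (Y : Mink) : Mink :=
  ![fderiv ℝ (fderiv ℝ f) (klein p) (dKlein p Y) (klein p),
    fderiv ℝ (fderiv ℝ f) (klein p) (dKlein p Y) 1,
    fderiv ℝ (fderiv ℝ f) (klein p) (dKlein p Y) Complex.I]

theorem clm_apply_eq (L : ℂ →L[ℝ] ℝ) (η : ℂ) : L η = η.re * L 1 + η.im * L Complex.I := by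
  have h1 : η = η.re • (1 : ℂ) + η.im • Complex.I := by
    apply Complex.ext <;> simp
  conv_lhs => rw [h1]
  simp only [map_add, map_smul, smul_eq_mul]

theorem mink_shape (f : ℂ → ℝ) (p : H2) (Y v : Mink) :
    mink (shape f p Y) v = hessForm f p Y v := by
  have h0 := p.pos
  simp only [mink, shape, hessForm, Matrix.cons_val]
  rw [clm_apply_eq _ (klein p), clm_apply_eq _ (dKlein p v)]
  simp only [klein, dKlein]
  field_simp
  ring

theorem isTangentAt_shape (f : ℂ → ℝ) (p : H2) (Y : Mink) : IsTangentAt p (shape f p Y) := by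
  have h0 := p.pos
  have h : dKlein p p.1 = 0 := by
    apply Complex.ext <;> simp [dKlein, klein] <;> field_simp <;> simp
  rw [IsTangentAt, mink_comm, mink_shape, hessForm, h, map_zero, mul_zero]

theorem shape_eq (f : ℂ → ℝ) (p : H2) (Y : Mink) : shape f p Y =
    hessForm f p Y (frameFst p) • frameFst p + hessForm f p Y (frameSnd p) • frameSnd p := by
  rw [← mink_shape, ← mink_shape]
  exact tangent_eq_frame (isTangentAt_shape f p Y)

/-- The tangential part of `σ` contributes only a normal vector to `Y ⊠ σ`, and its normal part is
`-⟨p, σ⟩ p`. -/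
theorem tangentProj_cross {p : H2} {Y : Mink} (hY : IsTangentAt p Y) (σ : Mink) :
    tangentProj p (cross Y σ) = mink p.1 σ • J p Y := by
  have h := p.sq
  simp only [IsTangentAt, mink] at hY
  ext i
  fin_cases i <;> simp [tangentProj, cross, mink, J]
  · linear_combination (Y 1 * σ 2 - Y 2 * σ 1) * h + (p.1 1 * σ 2 - p.1 2 * σ 1) * hY
  · linear_combination (Y 0 * σ 2 - Y 2 * σ 0) * h + (p.1 0 * σ 2 - p.1 2 * σ 0) * hY
  · linear_combination (Y 1 * σ 0 - Y 0 * σ 1) * h + (p.1 1 * σ 0 - p.1 0 * σ 1) * hY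

theorem tangentProj_of_tangent {p : H2} {Y : Mink} (hY : IsTangentAt p Y) :
    tangentProj p Y = Y := by
  rw [tangentProj, mink_comm, show mink p.1 Y = 0 from hY, zero_smul, add_zero]

theorem isTangentAt_J (p : H2) (Y : Mink) : IsTangentAt p (J p Y) := by
  simp [IsTangentAt, J, mink, cross]; ring

theorem J_J {p : H2} {Y : Mink} (hY : IsTangentAt p Y) : J p (J p Y) = -Y := by
  have h := p.sq
  simp only [IsTangentAt, mink] at hY
  ext i
  fin_cases i <;> simp [cross, J]
  · linear_combination (-Y 0) * h - p.1 0 * hY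
  · linear_combination (-Y 1) * h - p.1 1 * hY
  · linear_combination (-Y 2) * h - p.1 2 * hY

theorem J_add (p : H2) (x y : Mink) : J p (x + y) = J p x + J p y := by
  ext i; fin_cases i <;> simp [cross, J] <;> ring

theorem J_smul (p : H2) (c : ℝ) (x : Mink) : J p (c • x) = c • J p x := by
  ext i; fin_cases i <;> simp [cross, J] <;> ring

theorem tangentProj_add (p : H2) (x y : Mink) :
    tangentProj p (x + y) = tangentProj p x + tangentProj p y := by
  simp only [tangentProj, mink_add_left, add_smul]; abel

/-- The cross product as a continuous bilinear map. -/
def crossL : Mink →L[ℝ] Mink →L[ℝ] Mink :=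
  LinearMap.toContinuousLinearMap
    (LinearMap.toContinuousLinearMap.toLinearMap ∘ₗ LinearMap.mk₂ ℝ cross
      (by intro a b c; ext i; fin_cases i <;> simp [cross] <;> ring)
      (by intro a b c; ext i; fin_cases i <;> simp [cross] <;> ring)
      (by intro a b c; ext i; fin_cases i <;> simp [cross] <;> ring)
      (by intro a b c; ext i; fin_cases i <;> simp [cross] <;> ring))

theorem crossL_apply (x y : Mink) : crossL x y = cross x y := by simp [crossL]

/-- As for a Legendre transform, the two terms `fderiv ℝ f η ξ` in the derivative of the time
component cancel, so only the Hessian of `f` remains. -/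
theorem hasFDerivAt_dualVector (hf : ContDiffOn ℝ ∞ f (Metric.ball 0 1)) {η : ℂ} (h : ‖η‖ < 1)
    (ξ : ℂ) : ∃ D : ℂ →L[ℝ] Mink, HasFDerivAt (dualVector f) D η ∧
      D ξ = ![fderiv ℝ (fderiv ℝ f) η ξ η, fderiv ℝ (fderiv ℝ f) η ξ 1,
        fderiv ℝ (fderiv ℝ f) η ξ Complex.I] := by
  have h2 := ContDiffOn.hasFDerivAt_fderiv_ball hf h
  obtain ⟨D₀, k₀, e₀⟩ : ∃ D : ℂ →L[ℝ] ℝ,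
      HasFDerivAt (fun y => -(f y - fderiv ℝ f y y)) D η ∧ D ξ = fderiv ℝ (fderiv ℝ f) η ξ η :=
    ⟨_, ((ContDiffOn.hasFDerivAt_ball hf h).sub (h2.clm_apply (hasFDerivAt_id η))).neg, by simp⟩
  have k (c : ℂ) : HasFDerivAt (fun y => fderiv ℝ f y c) ((fderiv ℝ (fderiv ℝ f) η).flip c) η := by
    simpa using h2.clm_apply (hasFDerivAt_const c η)
  refine ⟨ContinuousLinearMap.pi ![D₀, (fderiv ℝ (fderiv ℝ f) η).flip 1,
    (fderiv ℝ (fderiv ℝ f) η).flip Complex.I], hasFDerivAt_pi.2 fun i => ?_, ?_⟩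
  · fin_cases i
    · exact k₀
    · exact k 1
    · exact k Complex.I
  · ext i; fin_cases i <;> simp [e₀]

/-- Product rule for `p ⊠ σ`: the first factor gives `u p • J p Y` because `⟨p, σ⟩ = u p`, and the
second gives `p ⊠ dσ`, which is already tangent. -/
theorem leviCivita_surfaceField {u : H2 → ℝ} (hu : IsSmooth u) {p : H2} {Y : Mink}
    (hY : IsTangentAt p Y) :
    leviCivita (surfaceField u) p Y = u p • J p Y + J p (shape (kleinFun u) p Y) := by
  have h := norm_klein_lt p
  obtain ⟨D, hD, hDξ⟩ := hasFDerivAt_dualVector hu.kleinFun h (dKlein p Y)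
  have h1 : HasFDerivAt (surfaceField u ∘ kleinInv) _ (klein p) :=
    (crossL.hasFDerivAt_of_bilinear (hasFDerivAt_kleinInv h) hD).congr_of_eventuallyEq (by
      filter_upwards [eventually_norm_lt h] with ξ hξ
      simp [surfaceField, klein_kleinInv hξ, crossL_apply])
  have h2 : mink p.1 (dualVector (kleinFun u) (klein p)) = u p := by
    have h0 := p.pos
    conv_lhs => rw [← lift1_klein p]
    rw [mink_smul_left, mink_lift1_dualVector, sub_self, map_zero, add_zero, kleinFun_klein]
    field_simp
  rw [leviCivita, dirDeriv, h1.fderiv]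
  simp only [add_apply, ContinuousLinearMap.precompR_apply, ContinuousLinearMap.precompL_apply,
    crossL_apply, ContinuousLinearMap.compL_apply, ContinuousLinearMap.comp_apply, kleinInvD_dKlein hY,
    kleinInv_klein, hDξ]
  rw [tangentProj_add, tangentProj_cross hY, h2, add_comm]
  congr 1
  exact tangentProj_of_tangent (isTangentAt_J p (shape (kleinFun u) p Y))

theorem J_shape (f : ℂ → ℝ) (p : H2) (Y : Mink) : J p (shape f p Y) =
    -hessForm f p Y (frameSnd p) • frameFst p + hessForm f p Y (frameFst p) • frameSnd p := by
  rw [shape_eq, J_add, J_smul, J_smul, J_frameFst, J_frameSnd, smul_neg, neg_smul, add_comm]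

/-- A trace-free symmetric operator of the plane anticommutes with `J`, so `∂̄` keeps `J ∘ shape`;
the term `u J` is complex linear and is killed. -/
theorem dbar_surfaceField {u : H2 → ℝ} (hu : IsSmooth u) (hm : IsMean u) {p : H2} {Y : Mink}
    (hY : IsTangentAt p Y) :
    dbar (surfaceField u) p Y = J p (shape (kleinFun u) p Y) := by
  have htr := (isMean_iff hu).1 hm p
  have hcomm := hessForm_comm hu.kleinFun p (frameSnd p) (frameFst p)
  have h1 : shape (kleinFun u) p (J p Y) = -J p (shape (kleinFun u) p Y) := by
    have hJ : J p Y = mink Y (frameFst p) • frameSnd p + (-mink Y (frameSnd p)) • frameFst p := by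
      conv_lhs => rw [tangent_eq_frame hY]
      rw [J_add, J_smul, J_smul, J_frameFst, J_frameSnd, smul_neg, neg_smul]
    have k1 : hessForm (kleinFun u) p (J p Y) (frameFst p)
        = hessForm (kleinFun u) p Y (frameSnd p) := by
      rw [hJ, hessForm_eq_of_tangent _ hY]
      simp only [hessForm_add_left, hessForm_smul_left]
      linear_combination mink Y (frameFst p) * hcomm - mink Y (frameSnd p) * htr
    have k2 : hessForm (kleinFun u) p (J p Y) (frameSnd p)
        = -hessForm (kleinFun u) p Y (frameFst p) := by
      rw [hJ, hessForm_eq_of_tangent _ hY]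
      simp only [hessForm_add_left, hessForm_smul_left]
      linear_combination mink Y (frameSnd p) * hcomm + mink Y (frameFst p) * htr
    rw [J_shape, shape_eq, k1, k2]
    module
  rw [dbar, leviCivita_surfaceField hu hY, leviCivita_surfaceField hu (isTangentAt_J p Y), J_add,
    J_smul, J_J (isTangentAt_J p Y), J_J (isTangentAt_shape _ p _), h1]
  module

/-- The square of a symmetric matrix with rows `(b, c)` and `(c, -b)` is `b² + c²` times the
identity. All vectors are stretched equally, so the supremum is over one value. -/
theorem dbarNorm_surfaceField {u : H2 → ℝ} (hu : IsSmooth u) (hm : IsMean u) (p : H2) :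
    dbarNorm (surfaceField u) p = √(hessForm (kleinFun u) p (frameFst p) (frameFst p) ^ 2
      + hessForm (kleinFun u) p (frameFst p) (frameSnd p) ^ 2) := by
  have htr := (isMean_iff hu).1 hm p
  have hcomm := hessForm_comm hu.kleinFun p (frameSnd p) (frameFst p)
  set f := kleinFun u
  set R := hessForm f p (frameFst p) (frameFst p) ^ 2 + hessForm f p (frameFst p) (frameSnd p) ^ 2
  have key : ∀ Y : Mink, IsTangentAt p Y → Y ≠ 0 →
      hypNorm (dbar (surfaceField u) p Y) / hypNorm Y = √R := by
    intro Y hY hY0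
    have hpos : 0 < mink Y Y := by
      rw [mink_self_tangent hY]
      by_contra! hneg
      have e1 : mink Y (frameFst p) = 0 := by
        nlinarith [sq_nonneg (mink Y (frameFst p)), sq_nonneg (mink Y (frameSnd p))]
      have e2 : mink Y (frameSnd p) = 0 := by
        nlinarith [sq_nonneg (mink Y (frameFst p)), sq_nonneg (mink Y (frameSnd p))]
      apply hY0
      rw [tangent_eq_frame hY, e1, e2]
      simp
    have h1 : mink (dbar (surfaceField u) p Y) (dbar (surfaceField u) p Y) = R * mink Y Y := by
      rw [dbar_surfaceField hu hm hY, J_shape]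
      simp only [mink_add_left, mink_add_right, mink_smul_left, mink_smul_right,
        mink_frameFst_self, mink_frameSnd_self, mink_frameFst_frameSnd,
        mink_comm (frameSnd p) (frameFst p)]
      rw [mink_self_tangent hY]
      have e1 : hessForm f p Y (frameFst p) = mink Y (frameFst p) * hessForm f p (frameFst p)
          (frameFst p) + mink Y (frameSnd p) * hessForm f p (frameFst p) (frameSnd p) := by
        rw [hessForm_eq_of_tangent _ hY, hcomm]
      have e2 : hessForm f p Y (frameSnd p) = mink Y (frameFst p) * hessForm f p (frameFst p)
          (frameSnd p) - mink Y (frameSnd p) * hessForm f p (frameFst p) (frameFst p) := by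
        rw [hessForm_eq_of_tangent _ hY]
        linear_combination mink Y (frameSnd p) * htr
      change -hessForm f p Y (frameSnd p) * (-hessForm f p Y (frameSnd p) * 1 + _) + _ = _
      rw [e1, e2]
      ring
    rw [hypNorm, hypNorm, h1, Real.sqrt_mul (by positivity)]
    have := Real.sqrt_pos.2 hpos
    field_simp
  have hne : frameFst p ≠ 0 := by
    intro h
    have := mink_frameFst_self p
    rw [h] at this
    simp [mink] at this
  have hset : {r : ℝ | ∃ Y : Mink, IsTangentAt p Y ∧ Y ≠ 0 ∧
      r = hypNorm (dbar (surfaceField u) p Y) / hypNorm Y} = {√R} := by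
    ext r
    simp only [Set.mem_ofPred_eq, Set.mem_singleton_iff]
    constructor
    · rintro ⟨Y, hY, hY0, rfl⟩
      exact key Y hY hY0
    · rintro rfl
      exact ⟨frameFst p, mink_frameFst p, hne, (key _ (mink_frameFst p) hne).symm⟩
  rw [dbarNorm, hset, csSup_singleton]

/-- Cauchy–Schwarz for `(b, c)` and `(x² - y², 2xy)`, the second of which has norm `x² + y²`. -/
theorem abs_hessForm_le {u : H2 → ℝ} (hu : IsSmooth u) (hm : IsMean u) {p : H2} {Y : Mink}
    (hY : IsTangentAt p Y) :
    |hessForm (kleinFun u) p Y Y| ≤ dbarNorm (surfaceField u) p * mink Y Y := by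
  have htr := (isMean_iff hu).1 hm p
  rw [dbarNorm_surfaceField hu hm, mink_self_tangent hY]
  conv_lhs => rw [tangent_eq_frame hY, hessForm_frame hu.kleinFun]
  generalize mink Y (frameFst p) = x
  generalize mink Y (frameSnd p) = y
  generalize hessForm (kleinFun u) p (frameFst p) (frameSnd p) = c
  rw [eq_neg_of_add_eq_zero_right htr]
  generalize hessForm (kleinFun u) p (frameFst p) (frameFst p) = b
  refine abs_le_of_sq_le_sq ?_ (by positivity)
  rw [mul_pow, Real.sq_sqrt (by positivity)]
  nlinarith [sq_nonneg (2 * x * y * b - (x ^ 2 - y ^ 2) * c)]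

/-! ### Uniqueness of the mean surface -/

/-- If `c > 0`, the second derivative test makes `0` a local minimum as well, so `g` is locally
constant and `c = 0`. -/
theorem second_deriv_nonpos_of_isLocalMax {g g₁ : ℝ → ℝ} {c : ℝ}
    (h : ∀ᶠ t in 𝓝 (0 : ℝ), HasDerivAt g (g₁ t) t) (h₁ : HasDerivAt g₁ c 0)
    (hmax : IsLocalMax g 0) : c ≤ 0 := by
  by_contra! hc
  have e1 : deriv g =ᶠ[𝓝 0] g₁ := h.mono fun t ht => ht.deriv
  have e2 : deriv (deriv g) 0 = c := by rw [e1.deriv_eq, h₁.deriv]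
  have hmin : IsLocalMin g 0 := isLocalMin_of_deriv_deriv_pos (by rw [e2]; exact hc)
    hmax.deriv_eq_zero h.self_of_nhds.continuousAt
  have e3 : g =ᶠ[𝓝 0] fun _ => g 0 := by
    filter_upwards [hmax, hmin] with t h1 h2 using le_antisymm h1 h2
  have e4 : deriv g =ᶠ[𝓝 0] fun _ => 0 := by
    filter_upwards [e3.eventuallyEq_nhds] with t ht
    rw [ht.deriv_eq, deriv_const]
  rw [e4.deriv_eq, deriv_const] at e2
  exact hc.ne e2

theorem hessian_le_of_isLocalMax {f : ℂ → ℝ} (hf : ContDiffOn ℝ ∞ f (Metric.ball 0 1)) {η₁ : ℂ}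
    (h₁ : ‖η₁‖ < 1) {ε : ℝ} (hloc : IsLocalMax (fun η => f η + ε * (η.re ^ 2 + η.im ^ 2 - 1)) η₁)
    (ξ : ℂ) : fderiv ℝ (fderiv ℝ f) η₁ ξ ξ + 2 * ε * ‖ξ‖ ^ 2 ≤ 0 := by
  have hl (t : ℝ) : HasDerivAt (fun t : ℝ => η₁ + t • ξ) ξ t := by
    simpa using ((hasDerivAt_id t).smul_const ξ).const_add η₁
  have hre (t : ℝ) : HasDerivAt (fun t : ℝ => (η₁ + t • ξ).re) ξ.re t :=
    Complex.reCLM.hasFDerivAt.comp_hasDerivAt t (hl t)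
  have him (t : ℝ) : HasDerivAt (fun t : ℝ => (η₁ + t • ξ).im) ξ.im t :=
    Complex.imCLM.hasFDerivAt.comp_hasDerivAt t (hl t)
  have hc : ContinuousAt (fun t : ℝ => η₁ + t • ξ) 0 := (hl 0).continuousAt
  have h0 : η₁ + (0 : ℝ) • ξ = η₁ := by simp
  have hev : ∀ᶠ t in 𝓝 (0 : ℝ), ‖η₁ + t • ξ‖ < 1 := by
    have := hc.norm
    exact this.eventually_lt continuousAt_const (by simpa using h₁)
  refine second_deriv_nonpos_of_isLocalMax
    (g := fun t : ℝ => f (η₁ + t • ξ) + ε * ((η₁ + t • ξ).re ^ 2 + (η₁ + t • ξ).im ^ 2 - 1))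
    (g₁ := fun t : ℝ => fderiv ℝ f (η₁ + t • ξ) ξ
      + ε * (2 * (η₁ + t • ξ).re * ξ.re + 2 * (η₁ + t • ξ).im * ξ.im)) ?_ ?_ ?_
  · filter_upwards [hev] with t ht
    refine (((ContDiffOn.hasFDerivAt_ball hf ht).comp_hasDerivAt t (hl t)).add
      (((((hre t).pow 2).add ((him t).pow 2)).sub_const 1).const_mul ε)).congr_deriv ?_
    simp
  · have k0 : HasDerivAt (fun t : ℝ => fderiv ℝ f (η₁ + t • ξ))
        (fderiv ℝ (fderiv ℝ f) η₁ ξ) 0 :=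
      (ContDiffOn.hasFDerivAt_fderiv_ball hf h₁).comp_hasDerivAt_of_eq 0 (hl 0) h0.symm
    have k1 : HasDerivAt (fun t : ℝ => fderiv ℝ f (η₁ + t • ξ) ξ)
        (fderiv ℝ (fderiv ℝ f) η₁ ξ ξ) 0 := by
      simpa using k0.clm_apply (hasDerivAt_const 0 ξ)
    refine (k1.add ((((hre 0).const_mul 2).mul_const ξ.re).add
      (((him 0).const_mul 2).mul_const ξ.im) |>.const_mul ε)).congr_deriv ?_
    rw [sq_norm_eq]
    simp
    ring
  · have := hc.tendsto
    rw [h0] at this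
    have h2 := this.eventually hloc
    filter_upwards [h2] with t ht
    simpa using ht

/-- Maximum principle. The strictly convex term `ε (|η|² - 1)` vanishes on the circle; at an
interior maximum of the sum the Hessian of `f` would be negative definite, against the vanishing
trace. -/
theorem nonpos_of_trace_eq_zero {f : ℂ → ℝ} (hf : ContDiffOn ℝ ∞ f (Metric.ball 0 1))
    (htr : ∀ p, hessForm f p (frameFst p) (frameFst p)
      + hessForm f p (frameSnd p) (frameSnd p) = 0)
    (hb : ∀ z : Circle, Tendsto f (𝓝[Metric.ball 0 1] (z : ℂ)) (𝓝 0)) {η₀ : ℂ} (h₀ : ‖η₀‖ < 1) :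
    f η₀ ≤ 0 := by
  classical
  by_contra! hpos
  -- With this `ε` the perturbed function is at least `ε` at `η₀`, so its maximum is positive and
  -- cannot be on the circle.
  set ε := f η₀ / 2 with hε
  have hε0 : 0 < ε := by positivity
  set F : ℂ → ℝ := fun η => if ‖η‖ < 1 then f η else 0 with hF
  have hFc : ContinuousOn F (Metric.closedBall 0 1) := by
    intro η hη
    rcases (lt_or_eq_of_le (by simpa using hη : ‖η‖ ≤ 1)) with h | h
    · refine ContinuousAt.continuousWithinAt ?_
      refine (ContDiffOn.hasFDerivAt_ball hf h).continuousAt.congr ?_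
      filter_upwards [eventually_norm_lt h] with ξ hξ
      simp [hF, hξ]
    · have hz : F η = 0 := by simp [hF, h]
      rw [ContinuousWithinAt, hz, ← Metric.ball_union_sphere, nhdsWithin_union]
      refine Tendsto.sup ?_ ?_
      · refine (hb ⟨η, by simp [Submonoid.unitSphere, h]⟩).congr' ?_
        filter_upwards [self_mem_nhdsWithin] with ξ hξ
        have : ‖ξ‖ < 1 := by simpa using hξ
        simp [hF, this]
      · refine tendsto_const_nhds.congr' ?_
        filter_upwards [self_mem_nhdsWithin] with ξ hξ
        have : ‖ξ‖ = 1 := by simpa using hξ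
        simp [hF, this]
  obtain ⟨η₁, hη₁, hmax⟩ := (isCompact_closedBall (0 : ℂ) 1).exists_isMaxOn
    ⟨0, by simp⟩ (hFc.add (f := F) (g := fun η => ε * (‖η‖ ^ 2 - 1)) (by fun_prop))
  have hval : 0 < F η₁ + ε * (‖η₁‖ ^ 2 - 1) := by
    have h1 := hmax (show η₀ ∈ Metric.closedBall (0 : ℂ) 1 by simpa using h₀.le)
    simp only [Set.mem_ofPred_eq, Pi.add_apply, hF, if_pos h₀] at h1
    have : f η₀ = 2 * ε := by rw [hε]; ring
    refine lt_of_lt_of_le ?_ h1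
    nlinarith [sq_nonneg ‖η₀‖]
  have h₁ : ‖η₁‖ < 1 := by
    rcases (lt_or_eq_of_le (by simpa using hη₁ : ‖η₁‖ ≤ 1)) with h | h
    · exact h
    · simp [hF, h] at hval
  have hloc : IsLocalMax (fun η => f η + ε * (η.re ^ 2 + η.im ^ 2 - 1)) η₁ := by
    filter_upwards [eventually_norm_lt h₁] with ξ hξ
    have h1 := hmax (show ξ ∈ Metric.closedBall (0 : ℂ) 1 by simpa using hξ.le)
    simp only [Set.mem_ofPred_eq, Pi.add_apply, hF, if_pos h₁, if_pos hξ] at h1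
    simpa only [sq_norm_eq] using h1
  have key := hessian_le_of_isLocalMax hf h₁ hloc
  have h2 := key (dKlein (kleinInv η₁) (frameFst (kleinInv η₁)))
  have h3 := key (dKlein (kleinInv η₁) (frameSnd (kleinInv η₁)))
  have h4 := htr (kleinInv η₁)
  have hp := (kleinInv η₁).pos
  rw [hessForm, hessForm, klein_kleinInv h₁, ← mul_add] at h4
  have h5 := (mul_eq_zero.1 h4).resolve_left hp.ne'
  have hne : dKlein (kleinInv η₁) (frameFst (kleinInv η₁)) ≠ 0 := by
    intro h
    have k := kleinInvD_dKlein (mink_frameFst (kleinInv η₁))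
    rw [h, map_zero] at k
    have := mink_frameFst_self (kleinInv η₁)
    rw [← k] at this
    simp [mink] at this
  have h6 : 0 < ‖dKlein (kleinInv η₁) (frameFst (kleinInv η₁))‖ := norm_pos_iff.2 hne
  nlinarith [sq_nonneg ‖dKlein (kleinInv η₁) (frameSnd (kleinInv η₁))‖, mul_pos hε0 (pow_pos h6 2)]

theorem hessForm_sub {f g : ℂ → ℝ} (hf : ContDiffOn ℝ ∞ f (Metric.ball 0 1))
    (hg : ContDiffOn ℝ ∞ g (Metric.ball 0 1)) (p : H2) (v w : Mink) :
    hessForm (fun η => f η - g η) p v w = hessForm f p v w - hessForm g p v w := by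
  have h := norm_klein_lt p
  have e : fderiv ℝ (fun η => f η - g η) =ᶠ[𝓝 (klein p)] fun η => fderiv ℝ f η - fderiv ℝ g η := by
    filter_upwards [eventually_norm_lt h] with ξ hξ
    exact ((ContDiffOn.hasFDerivAt_ball hf hξ).sub (ContDiffOn.hasFDerivAt_ball hg hξ)).fderiv
  have e2 := ((ContDiffOn.hasFDerivAt_fderiv_ball hf h).sub
    (ContDiffOn.hasFDerivAt_fderiv_ball hg h)).fderiv
  rw [hessForm, e.fderiv_eq]
  erw [e2]
  simp only [hessForm, sub_apply]
  ring

theorem IsMeanGraph.kleinFun_le {φ : Circle → ℝ} {u v : H2 → ℝ} (hu : IsMeanGraph φ u)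
    (hv : IsMeanGraph φ v) {η : ℂ} (h : ‖η‖ < 1) : kleinFun u η ≤ kleinFun v η := by
  have := nonpos_of_trace_eq_zero (f := fun η => kleinFun u η - kleinFun v η)
    (hu.smooth.kleinFun.sub hv.smooth.kleinFun) (fun p => by
      rw [hessForm_sub hu.smooth.kleinFun hv.smooth.kleinFun,
        hessForm_sub hu.smooth.kleinFun hv.smooth.kleinFun]
      linear_combination (isMean_iff hu.smooth).1 hu.mean p - (isMean_iff hv.smooth).1 hv.mean p)
    (fun z => by simpa using (hu.boundary z).sub (hv.boundary z)) h
  linarith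

theorem IsMeanGraph.unique {φ : Circle → ℝ} {u v : H2 → ℝ} (hu : IsMeanGraph φ u)
    (hv : IsMeanGraph φ v) : u = v := by
  ext p
  have h := norm_klein_lt p
  have := le_antisymm (hu.kleinFun_le hv h) (hv.kleinFun_le hu h)
  rw [kleinFun_klein, kleinFun_klein] at this
  exact mul_left_cancel₀ (inv_ne_zero p.pos.ne') this

/-! ### Restriction of homogeneous functions to lines -/

/-- The projection to the Klein model of the point `p + t v` of Minkowski space. -/
def kleinLine (p : H2) (v : Mink) (t : ℝ) : ℂ :=
  (p.1 0 + t * v 0)⁻¹ • ((⟨p.1 1, p.1 2⟩ : ℂ) + t • (⟨v 1, v 2⟩ : ℂ))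

/-- The restriction to the line `p + t v` of the homogeneous extension of `f`. -/
def lineFun (f : ℂ → ℝ) (p : H2) (v : Mink) (t : ℝ) : ℝ :=
  (p.1 0 + t * v 0) * f (kleinLine p v t)

/-- The derivative of `lineFun`. -/
def lineFunD (f : ℂ → ℝ) (p : H2) (v : Mink) (t : ℝ) : ℝ :=
  v 0 * f (kleinLine p v t)
    + (p.1 0 + t * v 0)⁻¹ * fderiv ℝ f (kleinLine p v t) (p.1 0 ^ 2 • dKlein p v)

theorem hasDerivAt_kleinLine {p : H2} {v : Mink} {t : ℝ} (ht : 0 < p.1 0 + t * v 0) :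
    HasDerivAt (kleinLine p v) ((p.1 0 + t * v 0)⁻¹ ^ 2 • p.1 0 ^ 2 • dKlein p v) t := by
  have hp := p.pos
  have h1 : HasDerivAt (fun t : ℝ => p.1 0 + t * v 0) (v 0) t := by
    simpa using ((hasDerivAt_id t).mul_const (v 0)).const_add (p.1 0)
  have h2 : HasDerivAt (fun t : ℝ => (⟨p.1 1, p.1 2⟩ : ℂ) + t • (⟨v 1, v 2⟩ : ℂ)) ⟨v 1, v 2⟩ t := by
    simpa using ((hasDerivAt_id t).smul_const (⟨v 1, v 2⟩ : ℂ)).const_add (⟨p.1 1, p.1 2⟩ : ℂ)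
  refine ((h1.inv ht.ne').smul h2).congr_deriv ?_
  apply Complex.ext <;> simp only [Complex.add_re, Complex.add_im, Complex.smul_re,
    Complex.smul_im, dKlein, klein, smul_eq_mul, Pi.inv_apply] <;> field_simp <;> ring

theorem hasDerivAt_lineFun {f : ℂ → ℝ} (hf : ContDiffOn ℝ ∞ f (Metric.ball 0 1)) {p : H2}
    {v : Mink} {t : ℝ} (ht : 0 < p.1 0 + t * v 0) (hb : ‖kleinLine p v t‖ < 1) :
    HasDerivAt (lineFun f p v) (lineFunD f p v t) t := by
  have h1 : HasDerivAt (fun t : ℝ => p.1 0 + t * v 0) (v 0) t := by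
    simpa using ((hasDerivAt_id t).mul_const (v 0)).const_add (p.1 0)
  refine (h1.mul ((ContDiffOn.hasFDerivAt_ball hf hb).comp_hasDerivAt t
    (hasDerivAt_kleinLine ht))).congr_deriv ?_
  rw [map_smul, smul_eq_mul, lineFunD]
  simp only [Function.comp_apply]
  field_simp

/-- The first-order terms cancel because the extension is homogeneous of degree one. At `t = 0` the
value is `hessForm f p v v`. -/
theorem hasDerivAt_lineFunD {f : ℂ → ℝ} (hf : ContDiffOn ℝ ∞ f (Metric.ball 0 1)) {p : H2}
    {v : Mink} {t : ℝ} (ht : 0 < p.1 0 + t * v 0) (hb : ‖kleinLine p v t‖ < 1) :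
    HasDerivAt (lineFunD f p v) ((p.1 0 + t * v 0)⁻¹ ^ 3 * p.1 0 ^ 4 *
      fderiv ℝ (fderiv ℝ f) (kleinLine p v t) (dKlein p v) (dKlein p v)) t := by
  have h1 : HasDerivAt (fun t : ℝ => p.1 0 + t * v 0) (v 0) t := by
    simpa using ((hasDerivAt_id t).mul_const (v 0)).const_add (p.1 0)
  have h2 := hasDerivAt_kleinLine ht
  refine ((((ContDiffOn.hasFDerivAt_ball hf hb).comp_hasDerivAt t h2).const_mul (v 0)).add
    ((h1.inv ht.ne').mul (((ContDiffOn.hasFDerivAt_fderiv_ball hf hb).comp_hasDerivAt t h2).clm_apply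
      (hasDerivAt_const t (p.1 0 ^ 2 • dKlein p v))))).congr_deriv ?_
  simp only [map_smul, smul_apply, smul_eq_mul, map_zero, Function.comp_apply, Pi.inv_apply]
  generalize p.1 0 + t * v 0 = s at ht ⊢
  field_simp
  ring

theorem kleinLine_zero (p : H2) (v : Mink) : kleinLine p v 0 = klein p := by
  have := p.pos
  apply Complex.ext <;> simp [kleinLine, klein] <;> field_simp

/-! ### Integrals of powers of the Poisson kernel -/

/-- The open future cone of Minkowski space. -/
def futureCone : Set Mink := {x | √(x 1 ^ 2 + x 2 ^ 2) < x 0}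

theorem isOpen_futureCone : IsOpen futureCone :=
  isOpen_lt (by fun_prop) (by fun_prop)

theorem mem_futureCone {x : Mink} (h0 : 0 < x 0) (h : x 1 ^ 2 + x 2 ^ 2 < x 0 ^ 2) :
    x ∈ futureCone := (Real.sqrt_lt' h0).2 h

theorem H2.mem_futureCone (p : H2) : p.1 ∈ futureCone :=
  HalfPipe.mem_futureCone p.pos (by linarith [p.sq])

/-- The Minkowski product with the null vector `(1, cos θ, sin θ)`. -/
def nullL (θ : ℝ) : Mink →L[ℝ] ℝ :=
  -ContinuousLinearMap.proj 0 + Real.cos θ • ContinuousLinearMap.proj 1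
    + Real.sin θ • ContinuousLinearMap.proj 2

theorem nullL_apply (θ : ℝ) (x : Mink) :
    nullL θ x = -x 0 + Real.cos θ * x 1 + Real.sin θ * x 2 := by simp [nullL]

theorem continuous_nullL : Continuous nullL := by
  unfold nullL; fun_prop

theorem nullL_neg {x : Mink} (hx : x ∈ futureCone) (θ : ℝ) : 0 < -nullL θ x := by
  have h1 : Real.cos θ * x 1 + Real.sin θ * x 2 ≤ √(x 1 ^ 2 + x 2 ^ 2) := by
    apply Real.le_sqrt_of_sq_le
    nlinarith [Real.sin_sq_add_cos_sq θ, sq_nonneg (Real.cos θ * x 2 - Real.sin θ * x 1)]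
  have h2 : √(x 1 ^ 2 + x 2 ^ 2) < x 0 := hx
  rw [nullL_apply]
  linarith

variable {E : Type} [NormedAddCommGroup E] [NormedSpace ℝ E]

/-- The integral of `G` against the power `(-⟨x, ℓ⟩)⁻ⁿ` over null vectors `ℓ = (1, cos θ, sin θ)`. -/
def kerInt (n : ℕ) (G : ℝ → E) (x : Mink) : E :=
  ∫ θ in 0..2 * Real.pi, (-nullL θ x)⁻¹ ^ n • G θ

/-- The weight appearing in the derivative of `kerInt`. -/
def kerWeight (n : ℕ) (G : ℝ → E) (θ : ℝ) : Mink →L[ℝ] E := (n : ℝ) • (nullL θ).smulRight (G θ)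

theorem continuous_kerWeight (n : ℕ) {G : ℝ → E} (hG : Continuous G) :
    Continuous (kerWeight n G) := by
  have : kerWeight n G =
      fun θ => (n : ℝ) • ContinuousLinearMap.smulRightL ℝ Mink E (nullL θ) (G θ) := by
    ext; simp [kerWeight]
  rw [this]
  have := continuous_nullL
  fun_prop

theorem continuousOn_kernel (n : ℕ) {G : ℝ → E} (hG : Continuous G) :
    ContinuousOn (fun q : Mink × ℝ => (-nullL q.2 q.1)⁻¹ ^ n • G q.2)
      (futureCone ×ˢ Set.univ) := by
  have h1 : Continuous fun q : Mink × ℝ => -nullL q.2 q.1 :=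
    ((continuous_nullL.comp continuous_snd).clm_apply continuous_fst).neg
  exact ((h1.continuousOn.inv₀ fun q hq => (nullL_neg hq.1 q.2).ne').pow n).smul
    (hG.comp continuous_snd).continuousOn

theorem continuous_kernel (n : ℕ) {G : ℝ → E} (hG : Continuous G) {x : Mink}
    (hx : x ∈ futureCone) : Continuous fun θ => (-nullL θ x)⁻¹ ^ n • G θ :=
  (continuousOn_kernel n hG).comp_continuous (f := fun θ => (x, θ)) (by fun_prop)
    fun θ => ⟨hx, trivial⟩

theorem hasFDerivAt_kernel (n : ℕ) (G : ℝ → E) (θ : ℝ) {x : Mink} (hx : x ∈ futureCone) :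
    HasFDerivAt (fun x => (-nullL θ x)⁻¹ ^ n • G θ)
      ((-nullL θ x)⁻¹ ^ (n + 1) • kerWeight n G θ) x := by
  have h0 := nullL_neg hx θ
  have h1 : HasDerivAt (fun y : ℝ => y⁻¹ ^ n) (-(n * (-nullL θ x)⁻¹ ^ (n + 1))) (-nullL θ x) := by
    refine ((hasDerivAt_inv h0.ne').pow n).congr_deriv ?_
    rcases n with _ | n
    · simp
    · simp only [Nat.add_sub_cancel]
      rw [← inv_pow]
      ring
  have h2 : HasFDerivAt (fun x => -nullL θ x) (-nullL θ) x := (nullL θ).hasFDerivAt.neg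
  refine ((h1.comp_hasFDerivAt x h2).smul_const (G θ)).congr_fderiv ?_
  ext v
  simp [kerWeight, smul_smul]
  congr 1
  ring

/-- The derivative is again a `kerInt`, with a higher exponent and an operator-valued weight, so
smoothness will follow by iteration. -/
theorem hasFDerivAt_kerInt (n : ℕ) {G : ℝ → E} (hG : Continuous G) {x : Mink}
    (hx : x ∈ futureCone) : HasFDerivAt (kerInt n G) (kerInt (n + 1) (kerWeight n G) x) x := by
  obtain ⟨r, hr, hsub⟩ := Metric.nhds_basis_closedBall.mem_iff.1 (isOpen_futureCone.mem_nhds hx)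
  have hK : IsCompact (Metric.closedBall x r ×ˢ Set.Icc 0 (2 * Real.pi)) :=
    (isCompact_closedBall x r).prod isCompact_Icc
  obtain ⟨C, hC⟩ := hK.exists_bound_of_continuousOn
    ((continuousOn_kernel (n + 1) (continuous_kerWeight n hG)).mono
      (Set.prod_mono hsub (Set.subset_univ _)))
  refine intervalIntegral.hasFDerivAt_integral_of_dominated_of_fderiv_le
    (bound := fun _ => C) (F' := fun x θ => (-nullL θ x)⁻¹ ^ (n + 1) • kerWeight n G θ)
    (Metric.closedBall_mem_nhds x hr) ?_ ?_ ?_ ?_ ?_ ?_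
  · filter_upwards [isOpen_futureCone.mem_nhds hx] with y hy
    exact (continuous_kernel n hG hy).aestronglyMeasurable
  · exact (continuous_kernel n hG hx).intervalIntegrable _ _
  · exact (continuous_kernel (n + 1) (continuous_kerWeight n hG) hx).aestronglyMeasurable
  · refine .of_forall fun θ hθ y hy => hC (y, θ) ⟨hy, ?_⟩
    rw [Set.uIoc_of_le (by positivity)] at hθ
    exact ⟨hθ.1.le, hθ.2⟩
  · exact intervalIntegrable_const
  · exact .of_forall fun θ _ y hy => hasFDerivAt_kernel n G θ (hsub hy)

/-- The target space and exponent are quantified inside the induction, since each derivative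
replaces `E` by `Mink →L[ℝ] E` and `n` by `n + 1`. -/
theorem contDiffOn_kerInt_nat (k : ℕ) : ∀ {E : Type} [NormedAddCommGroup E] [NormedSpace ℝ E]
    (n : ℕ) {G : ℝ → E}, Continuous G → ContDiffOn ℝ k (kerInt n G) futureCone := by
  induction k with
  | zero =>
    intro E _ _ n G hG
    exact contDiffOn_zero.2 fun x hx =>
      (hasFDerivAt_kerInt n hG hx).continuousAt.continuousWithinAt
  | succ k ih =>
    intro E _ _ n G hG
    rw [Nat.cast_succ, contDiffOn_succ_iff_fderiv_of_isOpen isOpen_futureCone]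
    refine ⟨fun x hx => (hasFDerivAt_kerInt n hG hx).differentiableAt.differentiableWithinAt,
      by simp, ?_⟩
    exact (ih (n + 1) (continuous_kerWeight n hG)).congr fun x hx =>
      (hasFDerivAt_kerInt n hG hx).fderiv

theorem contDiffOn_kerInt (n : ℕ) {G : ℝ → E} (hG : Continuous G) :
    ContDiffOn ℝ ∞ (kerInt n G) futureCone :=
  contDiffOn_infty.2 fun k => contDiffOn_kerInt_nat k n hG

theorem kerInt_smul (n : ℕ) (G : ℝ → E) (c : ℝ) (x : Mink) :
    kerInt n G (c • x) = c⁻¹ ^ n • kerInt n G x := by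
  rw [kerInt, kerInt, ← intervalIntegral.integral_smul]
  congr 1
  ext θ
  rw [map_smul, smul_eq_mul, ← mul_neg, mul_inv, mul_pow, smul_smul]

theorem hasDerivAt_kerInt_line (n : ℕ) {G : ℝ → ℝ} (hG : Continuous G) (x v : Mink) {t : ℝ}
    (hx : x + t • v ∈ futureCone) :
    HasDerivAt (fun t : ℝ => kerInt n G (x + t • v))
      (n * kerInt (n + 1) (fun θ => nullL θ v * G θ) (x + t • v)) t := by
  have h1 : HasDerivAt (fun t : ℝ => x + t • v) v t := by
    simpa using ((hasDerivAt_id t).smul_const v).const_add x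
  refine ((hasFDerivAt_kerInt n hG hx).comp_hasDerivAt t h1).congr_deriv ?_
  rw [kerInt, ContinuousLinearMap.intervalIntegral_apply, kerInt,
    ← intervalIntegral.integral_const_mul]
  · congr 1
    ext θ
    simp [kerWeight]
    ring
  · exact (continuous_kernel (n + 1) (continuous_kerWeight n hG) hx).intervalIntegrable _ _

/-! ### Lines through the hyperboloid -/

theorem sq_le_of_tangent {p : H2} {v : Mink} (hv : IsTangentAt p v) (h1 : mink v v = 1) :
    v 0 ^ 2 ≤ p.1 0 ^ 2 - 1 := by
  have hp := p.sq
  have hp0 := p.pos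
  simp only [IsTangentAt, mink] at hv h1
  have h2 : p.1 0 * v 0 = p.1 1 * v 1 + p.1 2 * v 2 := by linarith
  have h3 : (p.1 0 * v 0) ^ 2 ≤ (p.1 1 ^ 2 + p.1 2 ^ 2) * (v 1 ^ 2 + v 2 ^ 2) := by
    rw [h2]; nlinarith [sq_nonneg (p.1 1 * v 2 - p.1 2 * v 1)]
  have h4 : v 1 ^ 2 + v 2 ^ 2 = 1 + v 0 ^ 2 := by linarith
  rw [h4] at h3
  nlinarith

theorem abs_lt_of_tangent {p : H2} {v : Mink} (hv : IsTangentAt p v) (h1 : mink v v = 1) :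
    |v 0| < p.1 0 :=
  abs_lt_of_sq_lt_sq (by linarith [sq_le_of_tangent hv h1]) p.pos.le

theorem line_zero_pos {p : H2} {v : Mink} (hv : IsTangentAt p v) (h1 : mink v v = 1) {t : ℝ}
    (ht : |t| ≤ 1) : 0 < p.1 0 + t * v 0 := by
  have h2 := abs_lt_of_tangent hv h1
  have h3 : |t * v 0| ≤ |v 0| := by
    rw [abs_mul]; exact mul_le_of_le_one_left (abs_nonneg _) ht
  linarith [neg_abs_le (t * v 0)]

/-- So `p + t v` is timelike for `|t| < 1`, where it projects to the geodesic through `p`, and null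
at `t = ±1`, the ideal endpoints. -/
theorem line_mink {p : H2} {v : Mink} (hv : IsTangentAt p v) (h1 : mink v v = 1) (t : ℝ) :
    (p.1 0 + t * v 0) ^ 2 - (p.1 1 + t * v 1) ^ 2 - (p.1 2 + t * v 2) ^ 2 = 1 - t ^ 2 := by
  have hp := p.sq
  simp only [IsTangentAt, mink] at hv h1
  linear_combination hp - 2 * t * hv - t ^ 2 * h1

theorem line_mem_futureCone {p : H2} {v : Mink} (hv : IsTangentAt p v) (h1 : mink v v = 1) {t : ℝ}
    (ht : |t| < 1) : p.1 + t • v ∈ futureCone := by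
  have h2 := line_mink hv h1 t
  have h3 : t ^ 2 < 1 := (sq_lt_one_iff_abs_lt_one t).2 ht
  refine mem_futureCone ?_ ?_
  · simpa using line_zero_pos hv h1 ht.le
  · simp only [Pi.add_apply, Pi.smul_apply, smul_eq_mul]; linarith

theorem kleinLine_re (p : H2) (v : Mink) (t : ℝ) :
    (kleinLine p v t).re = (p.1 0 + t * v 0)⁻¹ * (p.1 1 + t * v 1) := by
  simp only [kleinLine, Complex.smul_re, Complex.add_re, smul_eq_mul]

theorem kleinLine_im (p : H2) (v : Mink) (t : ℝ) :
    (kleinLine p v t).im = (p.1 0 + t * v 0)⁻¹ * (p.1 2 + t * v 2) := by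
  simp only [kleinLine, Complex.smul_im, Complex.add_im, smul_eq_mul]

theorem one_sub_sq_norm_kleinLine {p : H2} {v : Mink} (hv : IsTangentAt p v) (h1 : mink v v = 1)
    {t : ℝ} (ht : |t| ≤ 1) :
    1 - ‖kleinLine p v t‖ ^ 2 = (1 - t ^ 2) / (p.1 0 + t * v 0) ^ 2 := by
  have h2 := line_zero_pos hv h1 ht
  rw [← line_mink hv h1 t, sq_norm_eq, kleinLine_re, kleinLine_im]
  field_simp
  ring

theorem norm_kleinLine_lt {p : H2} {v : Mink} (hv : IsTangentAt p v) (h1 : mink v v = 1)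
    {t : ℝ} (ht : |t| < 1) : ‖kleinLine p v t‖ < 1 := by
  have h2 := one_sub_sq_norm_kleinLine hv h1 ht.le
  have h3 : t ^ 2 < 1 := (sq_lt_one_iff_abs_lt_one t).2 ht
  have h4 := line_zero_pos hv h1 ht.le
  have h5 : 0 < (1 - t ^ 2) / (p.1 0 + t * v 0) ^ 2 := by
    have : 0 < 1 - t ^ 2 := by linarith
    positivity
  nlinarith [norm_nonneg (kleinLine p v t)]

theorem lift1_kleinLine {p : H2} {v : Mink} {t : ℝ} (h : 0 < p.1 0 + t * v 0) :
    lift1 (kleinLine p v t) = (p.1 0 + t * v 0)⁻¹ • (p.1 + t • v) := by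
  ext i
  fin_cases i <;> simp [lift1, kleinLine_re, kleinLine_im]
  field_simp

theorem kleinInv_kleinLine {p : H2} {v : Mink} (hv : IsTangentAt p v) (h1 : mink v v = 1)
    {t : ℝ} (ht : |t| < 1) :
    (kleinInv (kleinLine p v t)).1 = (√(1 - t ^ 2))⁻¹ • (p.1 + t • v) := by
  have h4 := line_zero_pos hv h1 ht.le
  rw [kleinInv_val (norm_kleinLine_lt hv h1 ht), one_sub_sq_norm_kleinLine hv h1 ht.le,
    lift1_kleinLine h4, Real.sqrt_div' _ (by positivity), Real.sqrt_sq h4.le, inv_div, smul_smul]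
  congr 1
  field_simp

/-! ### The mean surface with given boundary at infinity -/

/-- The solution of the Dirichlet problem at infinity, as an integral of a Poisson kernel. -/
def poissonSol (φ : Circle → ℝ) (p : H2) : ℝ :=
  (2 * Real.pi)⁻¹ * kerInt 2 (fun θ => φ (Circle.exp θ)) p.1

variable {φ : Circle → ℝ}

theorem isSmooth_poissonSol (hφ : Continuous φ) : IsSmooth (poissonSol φ) := by
  have hG : Continuous fun θ => φ (Circle.exp θ) := hφ.comp Circle.exp.continuous
  have hl : ContDiff ℝ ∞ lift1 := by
    have h : lift1 = fun η => lift1D η + ![1, 0, 0] := by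
      ext η i; fin_cases i <;> simp [lift1D, lift1]
    rw [h]
    exact lift1D.contDiff.add contDiff_const
  have h1 : ContDiffOn ℝ ∞ (fun η => lorentz η • lift1 η) (Metric.ball 0 1) :=
    contDiffOn_lorentz.smul hl.contDiffOn
  have h2 : ∀ η ∈ Metric.ball (0 : ℂ) 1, (kleinInv η).1 = lorentz η • lift1 η :=
    fun η hη => kleinInv_val (by simpa using hη)
  refine (contDiffOn_const.mul ((contDiffOn_kerInt 2 hG).comp h1 ?_)).congr
    (f := fun η => (2 * Real.pi)⁻¹ *
      (kerInt 2 (fun θ => φ (Circle.exp θ)) ∘ fun η => lorentz η • lift1 η) η) ?_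
  · intro η hη
    change lorentz η • lift1 η ∈ futureCone
    rw [← h2 η hη]
    exact (kleinInv η).mem_futureCone
  · intro η hη
    simp only [Function.comp_apply, poissonSol, h2 η hη]

/-- The kernel integral has degree `-2`, so the degree-one extension of `u` is the cube of the
Minkowski length `√(1 - t²)` times it. -/
theorem lineFun_poissonSol {p : H2} {v : Mink} (hv : IsTangentAt p v) (h1 : mink v v = 1)
    {t : ℝ} (ht : |t| < 1) : lineFun (kleinFun (poissonSol φ)) p v t = √(1 - t ^ 2) ^ 3 *
      ((2 * Real.pi)⁻¹ * kerInt 2 (fun θ => φ (Circle.exp θ)) (p.1 + t • v)) := by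
  have h4 := line_zero_pos hv h1 ht.le
  rw [lineFun, kleinFun, poissonSol, kleinInv_kleinLine hv h1 ht, kerInt_smul,
    one_sub_sq_norm_kleinLine hv h1 ht.le, Real.sqrt_div' _ (by positivity), Real.sqrt_sq h4.le,
    inv_inv, smul_eq_mul]
  field_simp

/-- The second derivative at `t = 0` of `(1 - t²)^(3/2)` times the kernel integral: `-3` comes from
the first factor and `6 = 2 · 3` from the exponents of the kernel. -/
theorem hessForm_poissonSol (hφ : Continuous φ) {p : H2} {v : Mink} (hv : IsTangentAt p v)
    (h1 : mink v v = 1) : hessForm (kleinFun (poissonSol φ)) p v v = (2 * Real.pi)⁻¹ *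
      (6 * kerInt 4 (fun θ => nullL θ v * (nullL θ v * φ (Circle.exp θ))) p.1
        - 3 * kerInt 2 (fun θ => φ (Circle.exp θ)) p.1) := by
  have hf := (isSmooth_poissonSol hφ).kleinFun
  have hG : Continuous fun θ => φ (Circle.exp θ) := hφ.comp Circle.exp.continuous
  have hG' : Continuous fun θ => nullL θ v * φ (Circle.exp θ) :=
    (continuous_nullL.clm_apply continuous_const).mul hG
  have hnear : ∀ᶠ t : ℝ in 𝓝 0, |t| < 1 :=
    continuous_abs.continuousAt.eventually_lt continuousAt_const (by simp)
  have hK {t : ℝ} (ht : |t| < 1) :=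
    hasDerivAt_kerInt_line 2 hG p.1 v (line_mem_futureCone hv h1 ht)
  have hK' {t : ℝ} (ht : |t| < 1) :=
    hasDerivAt_kerInt_line 3 hG' p.1 v (line_mem_futureCone hv h1 ht)
  have hs {t : ℝ} (ht : |t| < 1) :
      HasDerivAt (fun t : ℝ => √(1 - t ^ 2)) (-t / √(1 - t ^ 2)) t := by
    have h3 : t ^ 2 < 1 := (sq_lt_one_iff_abs_lt_one t).2 ht
    have h4 : HasDerivAt (fun t : ℝ => 1 - t ^ 2) (-(2 * t)) t := by
      simpa using ((hasDerivAt_pow 2 t).const_sub 1)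
    refine (h4.sqrt (by linarith)).congr_deriv ?_
    field_simp
  have hs3 {t : ℝ} (ht : |t| < 1) :
      HasDerivAt (fun t : ℝ => √(1 - t ^ 2) ^ 3) (-3 * t * √(1 - t ^ 2)) t := by
    have h3 : t ^ 2 < 1 := (sq_lt_one_iff_abs_lt_one t).2 ht
    have h4 : 0 < √(1 - t ^ 2) := Real.sqrt_pos.2 (by linarith)
    refine ((hs ht).pow 3).congr_deriv ?_
    norm_num
    field_simp
  -- Uniqueness of derivatives identifies `lineFunD` with an explicit formula on a whole
  -- neighbourhood of `0`, so that it can be differentiated again.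
  have hD : lineFunD (kleinFun (poissonSol φ)) p v =ᶠ[𝓝 0] fun t =>
      (2 * Real.pi)⁻¹ * (-3 * t * √(1 - t ^ 2) *
          kerInt 2 (fun θ => φ (Circle.exp θ)) (p.1 + t • v) +
        √(1 - t ^ 2) ^ 3 * (2 * kerInt 3 (fun θ => nullL θ v * φ (Circle.exp θ)) (p.1 + t • v))) := by
    filter_upwards [hnear.eventually_nhds] with t ht
    have ht0 := ht.self_of_nhds
    have k1 := hasDerivAt_lineFun hf (line_zero_pos hv h1 ht0.le) (norm_kleinLine_lt hv h1 ht0)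
    have k2 := ((hs3 ht0).mul ((hK ht0).const_mul (2 * Real.pi)⁻¹)).congr_of_eventuallyEq
      (f₁ := lineFun (kleinFun (poissonSol φ)) p v)
      (ht.mono fun s hs => lineFun_poissonSol hv h1 hs)
    rw [k1.unique k2]
    push_cast
    ring
  have h0 : |(0 : ℝ)| < 1 := by simp
  have k1 := hasDerivAt_lineFunD hf (line_zero_pos hv h1 h0.le) (norm_kleinLine_lt hv h1 h0)
  have k2 : HasDerivAt (fun t : ℝ => -3 * t * √(1 - t ^ 2)) (-3) 0 := by
    refine (((hasDerivAt_id (0 : ℝ)).const_mul (-3)).mul (hs h0)).congr_deriv ?_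
    simp
  have k3 := (((k2.mul (hK h0)).add ((hs3 h0).mul ((hK' h0).const_mul 2))).const_mul
    (2 * Real.pi)⁻¹).congr_of_eventuallyEq hD
  have k4 := k1.unique k3
  have hp := p.pos
  rw [kleinLine_zero] at k4
  rw [hessForm]
  simp only [zero_smul, add_zero, zero_mul] at k4
  have e : (p.1 0)⁻¹ ^ 3 * p.1 0 ^ 4 = p.1 0 := by field_simp
  rw [e] at k4
  rw [k4]
  norm_num
  ring

/-- This is `⟨ℓ, ℓ⟩ = 0` expanded in the orthonormal basis `p`, `frameFst p`, `frameSnd p`. -/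
theorem nullL_frame (p : H2) (θ : ℝ) :
    nullL θ (frameFst p) ^ 2 + nullL θ (frameSnd p) ^ 2 = (-nullL θ p.1) ^ 2 := by
  have h := p.sq
  have h0 := p.pos
  obtain ⟨q, hq⟩ : ∃ q : ℝ, q = (p.1 1 * Real.cos θ + p.1 2 * Real.sin θ) / (1 + p.1 0) - 1 :=
    ⟨_, rfl⟩
  have hq1 : q * (1 + p.1 0) = p.1 1 * Real.cos θ + p.1 2 * Real.sin θ - (1 + p.1 0) := by
    rw [hq]; field_simp
  have e1 : nullL θ (frameFst p) = Real.cos θ + p.1 1 * q := by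
    simp only [nullL_apply, frameFst, Matrix.cons_val, hq]; field_simp; ring
  have e2 : nullL θ (frameSnd p) = Real.sin θ + p.1 2 * q := by
    simp only [nullL_apply, frameSnd, Matrix.cons_val, hq]; field_simp; ring
  rw [e1, e2, nullL_apply]
  linear_combination Real.sin_sq_add_cos_sq θ - q ^ 2 * h + ((p.1 0 - 1) * q +
    (p.1 1 * Real.cos θ + p.1 2 * Real.sin θ) - (p.1 0 - 1)) * hq1

/-- By `nullL_frame`, the terms in `kerInt 4` add up over the frame to `6` times `kerInt 2`, which
cancels the two terms `-3 · kerInt 2`. -/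
theorem isMean_poissonSol (hφ : Continuous φ) : IsMean (poissonSol φ) := by
  rw [isMean_iff (isSmooth_poissonSol hφ)]
  intro p
  have hG : Continuous fun θ => φ (Circle.exp θ) := hφ.comp Circle.exp.continuous
  have hG' (v : Mink) : Continuous fun θ => nullL θ v * (nullL θ v * φ (Circle.exp θ)) :=
    (continuous_nullL.clm_apply continuous_const).mul
      ((continuous_nullL.clm_apply continuous_const).mul hG)
  rw [hessForm_poissonSol hφ (mink_frameFst p) (mink_frameFst_self p),
    hessForm_poissonSol hφ (mink_frameSnd p) (mink_frameSnd_self p)]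
  have h : kerInt 4 (fun θ => nullL θ (frameFst p) * (nullL θ (frameFst p) * φ (Circle.exp θ))) p.1
      + kerInt 4 (fun θ => nullL θ (frameSnd p) * (nullL θ (frameSnd p) * φ (Circle.exp θ))) p.1
      = kerInt 2 (fun θ => φ (Circle.exp θ)) p.1 := by
    rw [kerInt, kerInt, kerInt, ← intervalIntegral.integral_add
      ((continuous_kernel 4 (hG' _) p.mem_futureCone).intervalIntegrable _ _)
      ((continuous_kernel 4 (hG' _) p.mem_futureCone).intervalIntegrable _ _)]
    congr 1
    ext θ
    have h1 := nullL_neg p.mem_futureCone θ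
    have h2 := nullL_frame p θ
    simp only [smul_eq_mul]
    generalize -nullL θ p.1 = d at h1 h2 ⊢
    field_simp
    linear_combination φ (Circle.exp θ) * h2
  linear_combination (2 * Real.pi)⁻¹ * 6 * h

/-! ### The visual parametrization of the circle from a point of the hyperbolic plane -/

/-- The null vector `p + cos τ e₁ + sin τ e₂`. -/
def nullVec (p : H2) (τ : ℝ) : Mink :=
  p.1 + (Real.cos τ • frameFst p + Real.sin τ • frameSnd p)

/-- The time component of `nullVec`. -/
def visWeight (p : H2) (τ : ℝ) : ℝ := p.1 0 + (p.1 1 * Real.cos τ + p.1 2 * Real.sin τ)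

/-- The denominator `(1 + p₀) + (p₁ - i p₂) exp (i τ)` of a Möbius transformation sending the base
point to `p`. -/
def visDen (p : H2) (τ : ℝ) : ℂ :=
  ⟨1 + visWeight p τ, p.1 1 * Real.sin τ - p.1 2 * Real.cos τ⟩

/-- The angle of the endpoint of the geodesic ray from `p` with direction `cos τ e₁ + sin τ e₂`. -/
def visAngle (p : H2) (τ : ℝ) : ℝ := τ - 2 * (Complex.log (visDen p τ)).im

theorem visWeight_pos (p : H2) (τ : ℝ) : 0 < visWeight p τ := by
  have h := p.sq
  have h1 : |p.1 1 * Real.cos τ + p.1 2 * Real.sin τ| < p.1 0 := by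
    refine abs_lt_of_sq_lt_sq ?_ p.pos.le
    nlinarith [Real.sin_sq_add_cos_sq τ, sq_nonneg (p.1 1 * Real.sin τ - p.1 2 * Real.cos τ)]
  rw [visWeight]
  linarith [neg_abs_le (p.1 1 * Real.cos τ + p.1 2 * Real.sin τ)]

theorem visWeight_le (p : H2) (τ : ℝ) : visWeight p τ ≤ 2 * p.1 0 := by
  have h := p.sq
  have h1 : |p.1 1 * Real.cos τ + p.1 2 * Real.sin τ| < p.1 0 := by
    refine abs_lt_of_sq_lt_sq ?_ p.pos.le
    nlinarith [Real.sin_sq_add_cos_sq τ, sq_nonneg (p.1 1 * Real.sin τ - p.1 2 * Real.cos τ)]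
  rw [visWeight]
  linarith [le_abs_self (p.1 1 * Real.cos τ + p.1 2 * Real.sin τ)]

theorem visDen_mem_slitPlane (p : H2) (τ : ℝ) : visDen p τ ∈ Complex.slitPlane :=
  Or.inl (by have := visWeight_pos p τ; simp only [visDen]; linarith)

theorem normSq_visDen (p : H2) (τ : ℝ) :
    Complex.normSq (visDen p τ) = 2 * (1 + p.1 0) * visWeight p τ := by
  simp only [Complex.normSq_apply, visDen, visWeight]
  linear_combination (p.1 1 ^ 2 + p.1 2 ^ 2) * Real.sin_sq_add_cos_sq τ - p.sq

/-- With `w = visDen p` and `W = visWeight p`, the derivative is `1 - 2 Im(w'/w) = 1 - (W - 1)/W`.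
Since `Re w > 0`, the principal logarithm gives one smooth lift of the angle to all of `ℝ`. -/
theorem hasDerivAt_visAngle (p : H2) (τ : ℝ) : HasDerivAt (visAngle p) (visWeight p τ)⁻¹ τ := by
  have hre : HasDerivAt (fun τ => 1 + visWeight p τ)
      (p.1 1 * -Real.sin τ + p.1 2 * Real.cos τ) τ :=
    ((((Real.hasDerivAt_cos τ).const_mul _).add
      ((Real.hasDerivAt_sin τ).const_mul _)).const_add _).const_add 1
  have him : HasDerivAt (fun τ => p.1 1 * Real.sin τ - p.1 2 * Real.cos τ)
      (p.1 1 * Real.cos τ - p.1 2 * -Real.sin τ) τ :=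
    ((Real.hasDerivAt_sin τ).const_mul _).sub ((Real.hasDerivAt_cos τ).const_mul _)
  have hw : HasDerivAt (visDen p) (⟨p.1 1 * -Real.sin τ + p.1 2 * Real.cos τ,
      p.1 1 * Real.cos τ - p.1 2 * -Real.sin τ⟩ : ℂ) τ := by
    have e1 : visDen p = fun τ => ((1 + visWeight p τ : ℝ) : ℂ) +
        ((p.1 1 * Real.sin τ - p.1 2 * Real.cos τ : ℝ) : ℂ) * Complex.I := by
      ext τ; rw [← Complex.mk_eq_add_mul_I]; rfl
    rw [e1, Complex.mk_eq_add_mul_I]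
    exact hre.ofReal_comp.add (him.ofReal_comp.mul_const _)
  have h1 := (hasDerivAt_id τ).sub ((Complex.imCLM.hasFDerivAt.comp_hasDerivAt τ
    (hw.clog_real (visDen_mem_slitPlane p τ))).const_mul 2)
  refine h1.congr_deriv ?_
  have hpos := visWeight_pos p τ
  have hp := p.pos
  rw [Complex.imCLM_apply, Complex.div_im, normSq_visDen]
  have key : (p.1 1 * Real.cos τ - p.1 2 * -Real.sin τ) * (visDen p τ).re
      - (p.1 1 * -Real.sin τ + p.1 2 * Real.cos τ) * (visDen p τ).im
      = (1 + p.1 0) * (visWeight p τ - 1) := by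
    simp only [visDen, visWeight]
    linear_combination (p.1 1 ^ 2 + p.1 2 ^ 2) * Real.sin_sq_add_cos_sq τ - p.sq
  rw [← sub_div, key]
  field_simp
  ring

theorem continuous_visAngle (p : H2) : Continuous (visAngle p) :=
  continuous_iff_continuousAt.2 fun τ => (hasDerivAt_visAngle p τ).continuousAt

theorem continuous_visWeight (p : H2) : Continuous (visWeight p) := by
  unfold visWeight; fun_prop

theorem strictMono_visAngle (p : H2) : StrictMono (visAngle p) :=
  strictMono_of_deriv_pos fun τ => by
    rw [(hasDerivAt_visAngle p τ).deriv]; exact inv_pos.2 (visWeight_pos p τ)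

theorem visWeight_add_two_pi (p : H2) (τ : ℝ) :
    visWeight p (τ + 2 * Real.pi) = visWeight p τ := by simp [visWeight]

theorem visAngle_add_two_pi (p : H2) (τ : ℝ) :
    visAngle p (τ + 2 * Real.pi) = visAngle p τ + 2 * Real.pi := by
  have : visDen p (τ + 2 * Real.pi) = visDen p τ := by
    simp [visDen, visWeight_add_two_pi]
  rw [visAngle, visAngle, this]; ring

/-- Subtracting `2 arg w` from an angle multiplies its exponential by `conj w / w`. -/
theorem exp_visAngle (p : H2) (τ : ℝ) :
    visDen p τ * Complex.exp (visAngle p τ * Complex.I)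
      = Complex.exp (τ * Complex.I) * (starRingEnd ℂ) (visDen p τ) := by
  have h0 : visDen p τ ≠ 0 := Complex.slitPlane_ne_zero (visDen_mem_slitPlane p τ)
  set w := visDen p τ with hw
  have e1 : (visAngle p τ : ℂ) * Complex.I
      = τ * Complex.I - (2 * Complex.arg w : ℝ) * Complex.I := by
    rw [visAngle, ← hw, Complex.log_im]; push_cast; ring
  have h1 : (‖w‖ : ℂ) * Complex.exp (Complex.arg w * Complex.I) = w :=
    Complex.norm_mul_exp_arg_mul_I w
  have h2 : (starRingEnd ℂ) w = ‖w‖ * Complex.exp (-(Complex.arg w * Complex.I)) := by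
    conv_lhs => rw [← h1]
    rw [map_mul, Complex.conj_ofReal, ← Complex.exp_conj, map_mul, Complex.conj_ofReal,
      Complex.conj_I, mul_neg]
  rw [e1, Complex.exp_sub, h2, Complex.exp_neg]
  push_cast
  rw [show (2 * (Complex.arg w : ℂ)) * Complex.I = Complex.arg w * Complex.I +
    Complex.arg w * Complex.I by ring, Complex.exp_add]
  have hE := Complex.exp_ne_zero (Complex.arg w * Complex.I)
  rw [eq_div_of_mul_eq hE h1]
  field_simp

theorem nullVec_eq (p : H2) (τ : ℝ) : nullVec p τ =
    visWeight p τ • ![1, Real.cos (visAngle p τ), Real.sin (visAngle p τ)] := by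
  have h := exp_visAngle p τ
  have hp := p.pos
  have hsq := p.sq
  have hcs := Real.sin_sq_add_cos_sq τ
  have hN := normSq_visDen p τ
  rw [Complex.normSq_apply] at hN
  rw [Complex.exp_mul_I, Complex.exp_mul_I] at h
  have hr := congrArg Complex.re h
  have hi := congrArg Complex.im h
  simp only [← Complex.ofReal_cos, ← Complex.ofReal_sin, Complex.mul_re, Complex.mul_im,
    Complex.add_re, Complex.add_im, Complex.ofReal_re, Complex.ofReal_im, Complex.I_re,
    Complex.I_im, Complex.conj_re, Complex.conj_im] at hr hi
  ring_nf at hr hi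
  have hpos := visWeight_pos p τ
  have hC : (visDen p τ).re * Real.cos (visAngle p τ) - (visDen p τ).im * Real.sin (visAngle p τ)
      = (1 + p.1 0) * Real.cos τ + p.1 1 := by
    trans (visDen p τ).re * Real.cos τ + (visDen p τ).im * Real.sin τ
    · linear_combination hr
    · simp only [visDen, visWeight]
      linear_combination p.1 1 * hcs
  have hS : (visDen p τ).re * Real.sin (visAngle p τ) + (visDen p τ).im * Real.cos (visAngle p τ)
      = (1 + p.1 0) * Real.sin τ + p.1 2 := by
    trans (visDen p τ).re * Real.sin τ - (visDen p τ).im * Real.cos τ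
    · linear_combination hi
    · simp only [visDen, visWeight]
      linear_combination p.1 2 * hcs
  have hk : (0 : ℝ) < 1 + p.1 0 := by linarith
  -- `hC` and `hS` form a linear system for the cosine and sine of the visual angle, with
  -- determinant `normSq (visDen p τ)`; `kC` and `kS` are its solution.
  have kC : (1 + p.1 0) * (visWeight p τ * Real.cos (visAngle p τ)) = (1 + p.1 0) *
      (p.1 1 + Real.cos τ) + p.1 1 * (p.1 1 * Real.cos τ + p.1 2 * Real.sin τ) := by
    have : 2 * ((1 + p.1 0) * (visWeight p τ * Real.cos (visAngle p τ))) =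
        (visDen p τ).re * ((1 + p.1 0) * Real.cos τ + p.1 1)
          + (visDen p τ).im * ((1 + p.1 0) * Real.sin τ + p.1 2) := by
      rw [← hC, ← hS]; linear_combination (-Real.cos (visAngle p τ)) * hN
    simp only [visDen, visWeight] at this ⊢
    linear_combination this / 2 + (1 + p.1 0) * p.1 1 / 2 * hcs + Real.cos τ / 2 * hsq
  have kS : (1 + p.1 0) * (visWeight p τ * Real.sin (visAngle p τ)) = (1 + p.1 0) *
      (p.1 2 + Real.sin τ) + p.1 2 * (p.1 1 * Real.cos τ + p.1 2 * Real.sin τ) := by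
    have : 2 * ((1 + p.1 0) * (visWeight p τ * Real.sin (visAngle p τ))) =
        (visDen p τ).re * ((1 + p.1 0) * Real.sin τ + p.1 2)
          - (visDen p τ).im * ((1 + p.1 0) * Real.cos τ + p.1 1) := by
      rw [← hC, ← hS]; linear_combination (-Real.sin (visAngle p τ)) * hN
    simp only [visDen, visWeight] at this ⊢
    linear_combination this / 2 + (1 + p.1 0) * p.1 2 / 2 * hcs + Real.sin τ / 2 * hsq
  ext i
  fin_cases i
  · simp [nullVec, frameFst, frameSnd, visWeight]; ring
  · simp [nullVec, frameFst, frameSnd]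
    field_simp
    linear_combination -kC
  · simp [nullVec, frameFst, frameSnd]
    field_simp
    linear_combination -kS

theorem nullL_visAngle (p : H2) (τ : ℝ) (x : Mink) :
    visWeight p τ * nullL (visAngle p τ) x = mink (nullVec p τ) x := by
  rw [nullVec_eq, nullL_apply, mink_smul_left]
  simp [mink]

theorem nullL_visAngle_self (p : H2) (τ : ℝ) : (-nullL (visAngle p τ) p.1)⁻¹ = visWeight p τ := by
  have h := nullL_visAngle p τ p.1
  have hpos := visWeight_pos p τ
  rw [nullVec, mink_add_left, mink_add_left, mink_smul_left, mink_smul_left,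
    mink_comm _ p.1, mink_comm (frameFst p), mink_comm (frameSnd p), mink_frameFst, mink_frameSnd,
    p.2.1] at h
  rw [inv_eq_iff_eq_inv]
  field_simp
  linarith

theorem mink_nullVec_frame (p : H2) (τ x y : ℝ) :
    mink (nullVec p τ) (x • frameFst p + y • frameSnd p) = x * Real.cos τ + y * Real.sin τ := by
  simp only [nullVec, mink_add_left, mink_add_right, mink_smul_left, mink_smul_right,
    mink_frameFst, mink_frameSnd, mink_frameFst_self, mink_frameSnd_self, mink_frameFst_frameSnd,
    mink_comm (frameSnd p) (frameFst p)]
  ring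

/-- The visual angle grows by exactly `2π` over a period, so the substitution covers one period of
`F`. -/
theorem integral_eq_integral_visAngle (p : H2) {F : ℝ → ℝ} (hF : Continuous F)
    (hper : Function.Periodic F (2 * Real.pi)) :
    ∫ θ in 0..2 * Real.pi, F θ
      = ∫ τ in 0..2 * Real.pi, F (visAngle p τ) * (visWeight p τ)⁻¹ := by
  have h1 := intervalIntegral.integral_comp_mul_deriv (a := 0) (b := 2 * Real.pi) (g := F)
    (fun τ _ => hasDerivAt_visAngle p τ)
    ((continuous_visWeight p).inv₀ fun τ => (visWeight_pos p τ).ne').continuousOn hF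
  have h2 := visAngle_add_two_pi p 0
  rw [zero_add] at h2
  rw [h2, hper.intervalIntegral_add_eq (visAngle p 0) 0, zero_add] at h1
  exact h1.symm

theorem nullL_add_two_pi (θ : ℝ) : nullL (θ + 2 * Real.pi) = nullL θ := by
  simp [nullL]

theorem kerInt_two_eq (p : H2) {G : ℝ → ℝ} (hG : Continuous G)
    (hper : Function.Periodic G (2 * Real.pi)) :
    kerInt 2 G p.1 = ∫ τ in 0..2 * Real.pi, visWeight p τ * G (visAngle p τ) := by
  rw [kerInt, integral_eq_integral_visAngle p (continuous_kernel 2 hG p.mem_futureCone)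
    (fun θ => by simp only [nullL_add_two_pi, hper θ])]
  congr 1
  ext τ
  have := visWeight_pos p τ
  rw [nullL_visAngle_self, smul_eq_mul]
  field_simp

/-- The kernel gives four powers of the weight, the two factors `nullL θ v` take away two and the
Jacobian a third, so one is left, as in `kerInt_two_eq`. -/
theorem kerInt_four_eq (p : H2) {G : ℝ → ℝ} (hG : Continuous G)
    (hper : Function.Periodic G (2 * Real.pi)) (v : Mink) :
    kerInt 4 (fun θ => nullL θ v * (nullL θ v * G θ)) p.1 = ∫ τ in 0..2 * Real.pi,
      visWeight p τ * mink (nullVec p τ) v ^ 2 * G (visAngle p τ) := by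
  have hG' : Continuous fun θ => nullL θ v * (nullL θ v * G θ) :=
    (continuous_nullL.clm_apply continuous_const).mul
      ((continuous_nullL.clm_apply continuous_const).mul hG)
  rw [kerInt, integral_eq_integral_visAngle p (continuous_kernel 4 hG' p.mem_futureCone)
    (fun θ => by simp only [nullL_add_two_pi, hper θ])]
  congr 1
  ext τ
  have := visWeight_pos p τ
  rw [nullL_visAngle_self, smul_eq_mul, ← nullL_visAngle]
  field_simp

theorem kerInt_two_one (p : H2) : kerInt 2 (fun _ => (1 : ℝ)) p.1 = 2 * Real.pi * p.1 0 := by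
  rw [kerInt_two_eq p continuous_const (fun _ => rfl)]
  simp only [visWeight, mul_one]
  rw [intervalIntegral.integral_add (by simp) (Continuous.intervalIntegrable (by fun_prop) _ _),
    intervalIntegral.integral_add (Continuous.intervalIntegrable (by fun_prop) _ _)
      (Continuous.intervalIntegrable (by fun_prop) _ _), intervalIntegral.integral_const_mul,
    intervalIntegral.integral_const_mul]
  simp

theorem periodic_circle (φ : Circle → ℝ) :
    Function.Periodic (fun θ => φ (Circle.exp θ)) (2 * Real.pi) := fun θ => by simp

/-- The boundary function seen from `p`: the values at the null vectors `nullVec p τ` of the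
homogeneous extension of `φ` to the light cone. -/
def visFun (φ : Circle → ℝ) (p : H2) (τ : ℝ) : ℝ :=
  visWeight p τ * φ (Circle.exp (visAngle p τ))

theorem continuous_visFun (hφ : Continuous φ) (p : H2) : Continuous (visFun φ p) :=
  (continuous_visWeight p).mul (hφ.comp (Circle.exp.continuous.comp (continuous_visAngle p)))

theorem periodic_visFun (φ : Circle → ℝ) (p : H2) :
    Function.Periodic (visFun φ p) (2 * Real.pi) := fun τ => by
  simp only [visFun, visWeight_add_two_pi, visAngle_add_two_pi, Circle.periodic_exp _]

/-- For `(x, y) = (cos τ₀, sin τ₀)` the kernel is `3 cos 2(τ - τ₀)`: the Hessian is a second Fourier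
coefficient of the boundary function seen from `p`. -/
theorem hessForm_eq_integral (hφ : Continuous φ) (p : H2) {x y : ℝ} (hxy : x ^ 2 + y ^ 2 = 1) :
    hessForm (kleinFun (poissonSol φ)) p (x • frameFst p + y • frameSnd p)
      (x • frameFst p + y • frameSnd p) = (2 * Real.pi)⁻¹ * ∫ τ in 0..2 * Real.pi,
        visFun φ p τ * (6 * (x * Real.cos τ + y * Real.sin τ) ^ 2 - 3) := by
  have hG : Continuous fun θ => φ (Circle.exp θ) := hφ.comp Circle.exp.continuous
  have hc := continuous_visFun hφ p
  rw [hessForm_poissonSol hφ, kerInt_four_eq p hG (periodic_circle φ),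
    kerInt_two_eq p hG (periodic_circle φ)]
  · congr 1
    rw [← intervalIntegral.integral_const_mul, ← intervalIntegral.integral_const_mul,
      ← intervalIntegral.integral_sub]
    · congr 1
      ext τ
      rw [mink_nullVec_frame, visFun]
      ring
    · simp only [mink_nullVec_frame]
      refine Continuous.intervalIntegrable ?_ _ _
      have : (fun τ => 6 * (visWeight p τ * (x * Real.cos τ + y * Real.sin τ) ^ 2 *
          φ (Circle.exp (visAngle p τ)))) =
          fun τ => 6 * ((x * Real.cos τ + y * Real.sin τ) ^ 2 * visFun φ p τ) := by
        ext τ; rw [visFun]; ring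
      rw [this]
      fun_prop
    · exact (hc.const_mul 3).intervalIntegrable _ _
  · rw [IsTangentAt, mink_add_right, mink_smul_right, mink_smul_right, mink_frameFst,
      mink_frameSnd]
    simp
  · simp only [mink_add_left, mink_add_right, mink_smul_left, mink_smul_right, mink_frameFst_self,
      mink_frameSnd_self, mink_frameFst_frameSnd, mink_comm (frameSnd p) (frameFst p)]
    linear_combination hxy

/-! ### Boundary values and existence -/

theorem kleinFun_poissonSol {η : ℂ} (h : ‖η‖ < 1) : kleinFun (poissonSol φ) η =
    (2 * Real.pi)⁻¹ * √(1 - ‖η‖ ^ 2) ^ 3 * kerInt 2 (fun θ => φ (Circle.exp θ)) (lift1 η) := by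
  rw [kleinFun, poissonSol, kleinInv_val h, kerInt_smul, inv_inv, smul_eq_mul]
  ring

theorem lift1_mem_futureCone {η : ℂ} (h : ‖η‖ < 1) : lift1 η ∈ futureCone := by
  refine mem_futureCone (by simp [lift1]) ?_
  have := sq_norm_eq η
  simp only [lift1, Matrix.cons_val]
  nlinarith [norm_nonneg η]

/-- Normalization of the Poisson kernel: for `φ = 1` the solution is `u p = p₀`, that is, `kleinFun
u = 1`. -/
theorem kerInt_lift1_one {η : ℂ} (h : ‖η‖ < 1) :
    √(1 - ‖η‖ ^ 2) ^ 3 * kerInt 2 (fun _ => (1 : ℝ)) (lift1 η) = 2 * Real.pi := by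
  have hs := sqrt_pos_of_norm_lt h
  have := kerInt_two_one (kleinInv η)
  rw [kleinInv_zero h, kleinInv_val h, kerInt_smul, inv_inv, smul_eq_mul] at this
  field_simp at this
  linarith

/-- The power four matches the kernel `d⁻²`: by `norm_sub_sq_le`, `‖w - η‖⁴ ≤ 4 d²`, so that part of
the error integrates to a bounded quantity, killed by the prefactor `√(1 - ‖η‖²)³`. -/
theorem exists_quartic_bound (hφ : Continuous φ) (z : Circle) {ε : ℝ} (hε : 0 < ε) :
    ∃ C, 0 ≤ C ∧ ∀ w : Circle, |φ w - φ z| ≤ ε + C * ‖(w : ℂ) - z‖ ^ 4 := by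
  obtain ⟨M, hM⟩ := isCompact_univ.exists_bound_of_continuousOn hφ.continuousOn
  obtain ⟨δ, hδ, h⟩ := Metric.continuous_iff.1 hφ z ε hε
  have hM0 : 0 ≤ M := (norm_nonneg _).trans (hM z trivial)
  refine ⟨2 * M / δ ^ 4, by positivity, fun w => ?_⟩
  by_cases hw : dist w z < δ
  · have h1 := (h w hw).le
    rw [Real.dist_eq] at h1
    have : 0 ≤ 2 * M / δ ^ 4 * ‖(w : ℂ) - z‖ ^ 4 := by positivity
    linarith
  · push Not at hw
    have h1 : |φ w - φ z| ≤ 2 * M := by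
      have := abs_sub (φ w) (φ z)
      have h2 := hM w trivial
      have h3 := hM z trivial
      rw [Real.norm_eq_abs] at h2 h3
      linarith
    have h2 : δ ^ 4 ≤ ‖(w : ℂ) - z‖ ^ 4 := by
      have hw' : δ ≤ ‖(w : ℂ) - z‖ := by rw [← dist_eq_norm]; exact hw
      gcongr
    have h3 : 2 * M ≤ 2 * M / δ ^ 4 * ‖(w : ℂ) - z‖ ^ 4 := by
      rw [div_mul_eq_mul_div, le_div_iff₀ (by positivity)]
      gcongr
    linarith

theorem circleExp_re (θ : ℝ) : (Circle.exp θ : ℂ).re = Real.cos θ := by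
  rw [Circle.coe_exp, Complex.exp_ofReal_mul_I_re]

theorem circleExp_im (θ : ℝ) : (Circle.exp θ : ℂ).im = Real.sin θ := by
  rw [Circle.coe_exp, Complex.exp_ofReal_mul_I_im]

theorem norm_sub_sq_le {η : ℂ} (h : ‖η‖ < 1) (θ : ℝ) :
    ‖(Circle.exp θ : ℂ) - η‖ ^ 2 ≤ 2 * -nullL θ (lift1 η) := by
  have h1 := sq_norm_eq η
  rw [sq_norm_eq, nullL_apply, Complex.sub_re, Complex.sub_im, circleExp_re, circleExp_im]
  simp only [lift1, Matrix.cons_val]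
  nlinarith [norm_nonneg η, Real.sin_sq_add_cos_sq θ]

theorem abs_kleinFun_poissonSol_sub_le (hφ : Continuous φ) (z : Circle) {ε C : ℝ} (hC : 0 ≤ C)
    (h : ∀ w : Circle, |φ w - φ z| ≤ ε + C * ‖(w : ℂ) - z‖ ^ 4) {η : ℂ} (hη : ‖η‖ < 1) :
    |kleinFun (poissonSol φ) η - φ z| ≤
      ε + 32 * C * √(1 - ‖η‖ ^ 2) ^ 3 + 8 * C * ‖η - z‖ ^ 4 := by
  have hG : Continuous fun θ => φ (Circle.exp θ) := hφ.comp Circle.exp.continuous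
  have hpi := Real.pi_pos
  have hs := sqrt_pos_of_norm_lt hη
  have hone := kerInt_lift1_one hη
  have hx := lift1_mem_futureCone hη
  have e1 : kleinFun (poissonSol φ) η - φ z = (2 * Real.pi)⁻¹ * √(1 - ‖η‖ ^ 2) ^ 3 *
      ∫ θ in 0..2 * Real.pi, (-nullL θ (lift1 η))⁻¹ ^ 2 • (φ (Circle.exp θ) - φ z) := by
    have : ∫ θ in 0..2 * Real.pi, (-nullL θ (lift1 η))⁻¹ ^ 2 • (φ (Circle.exp θ) - φ z)
        = kerInt 2 (fun θ => φ (Circle.exp θ)) (lift1 η)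
          - φ z * kerInt 2 (fun _ => (1 : ℝ)) (lift1 η) := by
      rw [kerInt, kerInt, ← intervalIntegral.integral_const_mul, ← intervalIntegral.integral_sub]
      · congr 1; ext θ; simp only [smul_eq_mul]; ring
      · exact (continuous_kernel 2 hG hx).intervalIntegrable _ _
      · exact ((continuous_kernel 2 continuous_const hx).const_mul _).intervalIntegrable _ _
    rw [this, kleinFun_poissonSol hη]
    have h2 : φ z = (2 * Real.pi)⁻¹ * φ z * (2 * Real.pi) := by field_simp
    nth_rewrite 1 [h2]
    rw [← hone]
    ring
  have e2 : |∫ θ in 0..2 * Real.pi, (-nullL θ (lift1 η))⁻¹ ^ 2 • (φ (Circle.exp θ) - φ z)| ≤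
      ∫ θ in 0..2 * Real.pi, ((ε + 8 * C * ‖η - z‖ ^ 4) * ((-nullL θ (lift1 η))⁻¹ ^ 2 • (1 : ℝ))
        + 32 * C) := by
    rw [← Real.norm_eq_abs]
    refine intervalIntegral.norm_integral_le_of_norm_le (by positivity) (.of_forall fun θ _ => ?_)
      ?_
    · have h1 := nullL_neg hx θ
      have h2 := norm_sub_sq_le hη θ
      have h3 := h (Circle.exp θ)
      rw [norm_smul, Real.norm_eq_abs, Real.norm_eq_abs, abs_of_pos (by positivity), smul_eq_mul,
        mul_one]
      set d := -nullL θ (lift1 η)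
      -- Here `32 = 8 · 4`, from `(a + b)⁴ ≤ 8 (a⁴ + b⁴)` and `‖exp (iθ) - η‖⁴ ≤ 4 d²`.
      have h4 : ‖(Circle.exp θ : ℂ) - z‖ ^ 4 ≤ 32 * d ^ 2 + 8 * ‖η - z‖ ^ 4 := by
        have h5 : ‖(Circle.exp θ : ℂ) - z‖ ≤ ‖(Circle.exp θ : ℂ) - η‖ + ‖η - z‖ := by
          simpa using norm_add_le ((Circle.exp θ : ℂ) - η) (η - z)
        have h6 : ‖(Circle.exp θ : ℂ) - η‖ ^ 4 ≤ 4 * d ^ 2 := by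
          nlinarith [sq_nonneg ‖(Circle.exp θ : ℂ) - η‖]
        have h7 : (‖(Circle.exp θ : ℂ) - η‖ + ‖η - z‖) ^ 4 ≤
            8 * (‖(Circle.exp θ : ℂ) - η‖ ^ 4 + ‖η - z‖ ^ 4) := by
          have := add_pow_le (norm_nonneg ((Circle.exp θ : ℂ) - η)) (norm_nonneg (η - z)) 4
          norm_num at this
          exact this
        have h8 := pow_le_pow_left₀ (norm_nonneg _) h5 4
        linarith
      calc d⁻¹ ^ 2 * |φ (Circle.exp θ) - φ z|
          ≤ d⁻¹ ^ 2 * (ε + C * (32 * d ^ 2 + 8 * ‖η - z‖ ^ 4)) := by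
            gcongr
            exact h3.trans (by gcongr)
        _ = _ := by field_simp; ring
    · exact (((continuous_kernel 2 continuous_const hx).const_mul _).add
        continuous_const).intervalIntegrable _ _
  rw [intervalIntegral.integral_add
    (((continuous_kernel 2 continuous_const hx).const_mul _).intervalIntegrable _ _)
    (by simp), intervalIntegral.integral_const_mul] at e2
  change _ ≤ _ * kerInt 2 (fun _ => (1 : ℝ)) (lift1 η) + _ at e2
  rw [e1, abs_mul, abs_of_pos (by positivity)]
  refine (mul_le_mul_of_nonneg_left e2 (by positivity)).trans (le_of_eq ?_)
  rw [intervalIntegral.integral_const, sub_zero, smul_eq_mul]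
  have : kerInt 2 (fun _ => (1 : ℝ)) (lift1 η) = 2 * Real.pi / √(1 - ‖η‖ ^ 2) ^ 3 := by
    rw [← hone]; field_simp
  rw [this]
  field_simp
  ring

theorem tendsto_kleinFun_poissonSol (hφ : Continuous φ) (z : Circle) :
    Tendsto (kleinFun (poissonSol φ)) (𝓝[Metric.ball 0 1] (z : ℂ)) (𝓝 (φ z)) := by
  rw [Metric.tendsto_nhds]
  intro ε hε
  obtain ⟨C, hC, h⟩ := exists_quartic_bound hφ z (half_pos hε)
  have hlim : Tendsto (fun η : ℂ => ε / 2 + 32 * C * √(1 - ‖η‖ ^ 2) ^ 3 + 8 * C * ‖η - z‖ ^ 4)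
      (𝓝[Metric.ball 0 1] (z : ℂ)) (𝓝 (ε / 2)) := by
    have hc : Continuous (fun η : ℂ =>
      ε / 2 + 32 * C * √(1 - ‖η‖ ^ 2) ^ 3 + 8 * C * ‖η - z‖ ^ 4) := by fun_prop
    have := hc.tendsto (z : ℂ)
    simp only [Circle.norm_coe, sub_self, norm_zero] at this
    norm_num at this
    exact this.mono_left nhdsWithin_le_nhds
  filter_upwards [hlim.eventually (gt_mem_nhds (half_lt_self hε)), self_mem_nhdsWithin] with η h1 h2
  rw [Real.dist_eq]
  exact (abs_kleinFun_poissonSol_sub_le hφ z hC h (by simpa using h2)).trans_lt h1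

theorem isMeanGraph_poissonSol (hφ : Continuous φ) : IsMeanGraph φ (poissonSol φ) :=
  ⟨isSmooth_poissonSol hφ, isMean_poissonSol hφ, tendsto_kleinFun_poissonSol hφ⟩

theorem existsUnique_isMeanGraph (hφ : Continuous φ) : ∃! u, IsMeanGraph φ u :=
  ⟨poissonSol φ, isMeanGraph_poissonSol hφ, fun _ hu => hu.unique (isMeanGraph_poissonSol hφ)⟩

theorem continuous_supportFun {X : Circle → ℂ} (hX : Continuous X) :
    Continuous (supportFun X) := by
  refine Complex.continuous_re.comp (hX.div (by fun_prop) fun z => ?_)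
  simp

theorem HL_eq {X : Circle → ℂ} (hX : Continuous X) :
    HL X = surfaceField (poissonSol (supportFun X)) := by
  have h := isMeanGraph_poissonSol (continuous_supportFun hX)
  have h1 : IsMeanGraph (supportFun X) (meanFun X) := Classical.epsilon_spec ⟨_, h⟩
  rw [HL, h1.unique h]

/-! ### Neighbourhoods of infinity in the hyperbolic plane -/

theorem sq_norm_poincare (p : H2) : ‖poincare p‖ ^ 2 = (p.1 0 - 1) / (p.1 0 + 1) := by
  have := p.pos
  rw [sq_norm_eq]
  simp only [poincare]
  field_simp
  linear_combination (-1 - p.1 0) * p.sq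

/-- With `r = ‖poincare p‖`, `p₀ = (1 + r²)/(1 - r²)` is an increasing function of `r` that blows up
at `r = 1`. -/
theorem comap_norm_poincare :
    comap (fun p : H2 => ‖poincare p‖) (𝓝[<] 1) = comap (fun p : H2 => p.1 0) atTop := by
  apply le_antisymm
  · rw [← tendsto_iff_comap]
    have h1 : (fun p : H2 => p.1 0) =
        (fun r : ℝ => (1 + r ^ 2) * (1 - r ^ 2)⁻¹) ∘ fun p => ‖poincare p‖ := by
      ext p
      have := p.pos
      have h2 : 1 - ‖poincare p‖ ^ 2 = 2 / (p.1 0 + 1) := by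
        rw [sq_norm_poincare]; field_simp; ring
      simp only [Function.comp_apply]
      rw [h2, sq_norm_poincare]
      field_simp
      ring
    rw [h1]
    refine Tendsto.comp ?_ tendsto_comap
    have h2 : Tendsto (fun r : ℝ => (1 - r ^ 2)⁻¹) (𝓝[<] 1) atTop := by
      refine tendsto_inv_nhdsGT_zero.comp ?_
      rw [tendsto_nhdsWithin_iff]
      constructor
      · have : Tendsto (fun r : ℝ => 1 - r ^ 2) (𝓝 1) (𝓝 (1 - 1 ^ 2)) :=
          Continuous.tendsto (by fun_prop) 1
        simpa using this.mono_left nhdsWithin_le_nhds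
      · have h0 : ∀ᶠ r : ℝ in 𝓝[<] 1, 0 < r :=
          nhdsWithin_le_nhds (lt_mem_nhds zero_lt_one)
        filter_upwards [self_mem_nhdsWithin, h0] with r hr hr0
        have hr : r < 1 := hr
        show 0 < 1 - r ^ 2
        nlinarith
    have h3 : Tendsto (fun r : ℝ => 1 + r ^ 2) (𝓝[<] 1) (𝓝 (1 + 1 ^ 2)) :=
      (Continuous.tendsto (by fun_prop) 1).mono_left nhdsWithin_le_nhds
    exact h3.pos_mul_atTop (by norm_num) h2
  · rw [← tendsto_iff_comap]
    have h1 : (fun p : H2 => ‖poincare p‖) =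
        (fun x : ℝ => √(1 - 2 * (x + 1)⁻¹)) ∘ fun p => p.1 0 := by
      ext p
      have := p.pos
      simp only [Function.comp_apply]
      rw [← Real.sqrt_sq (norm_nonneg (poincare p)), sq_norm_poincare]
      congr 1
      field_simp
      ring
    rw [tendsto_nhdsWithin_iff]
    constructor
    · rw [h1]
      refine Tendsto.comp ?_ tendsto_comap
      have h2 : Tendsto (fun x : ℝ => (x + 1)⁻¹) atTop (𝓝 0) :=
        tendsto_inv_atTop_zero.comp (tendsto_atTop_add_const_right _ 1 tendsto_id)
      have h3 := ((h2.const_mul 2).const_sub 1).sqrt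
      simpa using h3
    · refine .of_forall fun p => ?_
      have h2 := sq_norm_poincare p
      have h3 : (p.1 0 - 1) / (p.1 0 + 1) < 1 := by
        have := p.pos
        rw [div_lt_one (by linarith)]
        linarith
      show ‖poincare p‖ < 1
      nlinarith [norm_nonneg (poincare p)]

theorem tendsto_zero_iff {F : H2 → ℝ} :
    Tendsto F (comap (fun p : H2 => ‖poincare p‖) (𝓝[<] 1)) (𝓝 0) ↔
      ∀ ε > 0, ∃ N, ∀ p : H2, N ≤ p.1 0 → |F p| < ε := by
  rw [comap_norm_poincare, ((atTop_basis (α := ℝ)).comap _).tendsto_iff Metric.nhds_basis_ball]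
  simp

theorem sq_kleinInv_zero_mul {η : ℂ} (h : ‖η‖ < 1) : (kleinInv η).1 0 ^ 2 * (1 - ‖η‖ ^ 2) = 1 := by
  have h0 : 0 < 1 - ‖η‖ ^ 2 := by nlinarith [norm_nonneg η]
  rw [kleinInv_zero h, inv_pow, Real.sq_sqrt h0.le]
  field_simp

theorem tendsto_zero_iff_klein {F : ℂ → ℝ} :
    Tendsto F (comap (fun z : ℂ => ‖z‖) (𝓝[<] 1)) (𝓝 0) ↔
      ∀ ε > 0, ∃ N, ∀ p : H2, N ≤ p.1 0 → |F (klein p)| < ε := by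
  rw [Metric.tendsto_nhds]
  constructor
  · intro h ε hε
    obtain ⟨t, ht, hsub⟩ := mem_comap.1 (h ε hε)
    obtain ⟨a, ha, hat⟩ := (mem_nhdsLT_iff_exists_Ioo_subset' (zero_lt_one' ℝ)).1 ht
    have ha : a < 1 := ha
    -- For such `p`, `1 - ‖klein p‖² = p₀⁻² ≤ p₀⁻¹ ≤ (1 - a)/2`, whence `‖klein p‖ > a`.
    refine ⟨2 / (1 - a), fun p hp => ?_⟩
    have h1 : klein p ∈ (fun z : ℂ => ‖z‖) ⁻¹' t := by
      refine hat ⟨?_, norm_klein_lt p⟩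
      have h2 := one_sub_sq_norm_klein p
      have h3 := norm_klein_lt p
      have hp0 := p.pos
      have h4 : 2 ≤ p.1 0 * (1 - a) := (div_le_iff₀ (by linarith)).1 hp
      have h5 := p.one_le
      have h6 : 1 - ‖klein p‖ ^ 2 ≤ (p.1 0)⁻¹ := by
        rw [h2]
        exact inv_anti₀ hp0 (by nlinarith)
      have h7 : (p.1 0)⁻¹ ≤ (1 - a) / 2 := by
        rw [inv_le_comm₀ hp0 (by linarith)]
        rw [inv_div]
        exact hp
      nlinarith [norm_nonneg (klein p)]
    have := hsub h1
    simpa [Real.dist_eq] using this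
  · intro h ε hε
    obtain ⟨N, hN⟩ := h ε hε
    have h0 : Tendsto (fun r : ℝ => 1 - r ^ 2) (𝓝[<] 1) (𝓝 0) := by
      have : Tendsto (fun r : ℝ => 1 - r ^ 2) (𝓝 1) (𝓝 (1 - 1 ^ 2)) :=
        Continuous.tendsto (by fun_prop) 1
      simpa using this.mono_left nhdsWithin_le_nhds
    have h1 : ∀ᶠ r : ℝ in 𝓝[<] 1, 1 - r ^ 2 < (1 + N ^ 2)⁻¹ :=
      h0.eventually (gt_mem_nhds (by positivity))
    have h2 : ∀ᶠ z : ℂ in comap (fun z : ℂ => ‖z‖) (𝓝[<] 1),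
        ‖z‖ < 1 ∧ 1 - ‖z‖ ^ 2 < (1 + N ^ 2)⁻¹ :=
      tendsto_comap.eventually ((eventually_nhdsWithin_of_forall fun r (hr : r < 1) => hr).and h1)
    filter_upwards [h2] with z ⟨hz, hz2⟩
    have h3 := hN (kleinInv z) (by
      have h4 := sq_kleinInv_zero_mul hz
      have h5 := (kleinInv z).pos
      by_contra! hlt
      have h6 : (1 - ‖z‖ ^ 2) * (1 + N ^ 2) < 1 := by
        rw [← one_div] at hz2
        exact (lt_div_iff₀ (by positivity)).1 hz2
      have h7 : 0 < 1 - ‖z‖ ^ 2 := by nlinarith [norm_nonneg z]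
      nlinarith)
    rw [klein_kleinInv hz] at h3
    simpa [Real.dist_eq] using h3

/-! ### Harmonic quadruples seen from a point -/

/-- The endpoint on the circle of the geodesic ray from `p` with direction
`cos τ e₁ + sin τ e₂`. -/
def visPoint (p : H2) (τ : ℝ) : Circle := Circle.exp (visAngle p τ)

theorem visPoint_add_two_pi (p : H2) (τ : ℝ) : visPoint p (τ + 2 * Real.pi) = visPoint p τ := by
  simp [visPoint, visAngle_add_two_pi]

theorem mink_nullVec (p : H2) (τ τ' : ℝ) :
    mink (nullVec p τ) (nullVec p τ') = -1 + Real.cos (τ' - τ) := by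
  rw [nullVec.eq_1 p τ', mink_add_right, mink_nullVec_frame, nullVec, mink_comm, mink_add_right,
    mink_add_right, mink_smul_right, mink_smul_right, mink_frameFst, mink_frameSnd, p.2.1,
    Real.cos_sub]
  ring

/-- For points `z`, `w` of the circle, `⟨(1, z), (1, w)⟩ = -|z - w|²/2`. -/
theorem sq_norm_visPoint_sub (p : H2) (τ τ' : ℝ) :
    visWeight p τ * visWeight p τ' * ‖(visPoint p τ : ℂ) - visPoint p τ'‖ ^ 2
      = 2 - 2 * Real.cos (τ' - τ) := by
  have h := mink_nullVec p τ τ'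
  rw [nullVec_eq, nullVec_eq, mink_smul_left, mink_smul_right] at h
  simp only [mink, Matrix.cons_val] at h
  rw [sq_norm_eq, visPoint, visPoint, Complex.sub_re, Complex.sub_im, circleExp_re, circleExp_im,
    circleExp_re, circleExp_im]
  linear_combination (-2) * h + visWeight p τ * visWeight p τ' *
    (Real.sin_sq_add_cos_sq (visAngle p τ) + Real.sin_sq_add_cos_sq (visAngle p τ'))

/-- The harmonic quadruple of endpoints of two orthogonal geodesics through `p`. -/
def visQuad (p : H2) (τ : ℝ) : Quadruple where
  a := visPoint p τ
  b := visPoint p (τ + Real.pi / 2)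
  c := visPoint p (τ + Real.pi)
  d := visPoint p (τ + 3 * Real.pi / 2)
  ccw := by
    have hpi := Real.pi_pos
    refine ⟨_, _, _, _, strictMono_visAngle p ?_, strictMono_visAngle p ?_,
      strictMono_visAngle p ?_, ?_, rfl, rfl, rfl, rfl⟩
    · linarith
    · linarith
    · linarith
    · rw [← visAngle_add_two_pi]
      exact strictMono_visAngle p (by linarith)

/-- The complex number `p₁ + i p₂`. -/
def horiz (p : H2) : ℂ := ⟨p.1 1, p.1 2⟩

theorem visDen_eq (p : H2) (τ : ℝ) : visDen p τ =
    (1 + p.1 0 : ℝ) + (starRingEnd ℂ) (horiz p) * Complex.exp (τ * Complex.I) := by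
  rw [Complex.exp_mul_I, ← Complex.ofReal_cos, ← Complex.ofReal_sin]
  apply Complex.ext <;> simp [visDen, visWeight, horiz, -Complex.ofReal_cos, -Complex.ofReal_sin] <;> ring

theorem visDen_ne_zero (p : H2) (τ : ℝ) : visDen p τ ≠ 0 :=
  Complex.slitPlane_ne_zero (visDen_mem_slitPlane p τ)

theorem conj_exp_mul_I (τ : ℝ) : (starRingEnd ℂ) (Complex.exp (τ * Complex.I)) =
    (Complex.exp (τ * Complex.I))⁻¹ := by
  rw [← Complex.exp_conj, map_mul, Complex.conj_ofReal, Complex.conj_I, mul_neg, Complex.exp_neg]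

theorem visPoint_eq (p : H2) (τ : ℝ) : (visPoint p τ : ℂ) =
    ((1 + p.1 0 : ℝ) * Complex.exp (τ * Complex.I) + horiz p) / visDen p τ := by
  have h := exp_visAngle p τ
  rw [eq_div_iff (visDen_ne_zero p τ), visPoint, Circle.coe_exp, mul_comm, h, visDen_eq, map_add,
    map_mul, Complex.conj_conj, Complex.conj_ofReal, conj_exp_mul_I]
  have := Complex.exp_ne_zero (τ * Complex.I)
  field_simp

theorem horiz_mul_conj (p : H2) : horiz p * (starRingEnd ℂ) (horiz p) = (p.1 0 ^ 2 - 1 : ℝ) := by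
  rw [Complex.mul_conj, Complex.normSq_apply]
  congr 1
  simp only [horiz]
  linarith [p.sq]

/-- Difference of two values of a Möbius transformation; its determinant is `(1 + p₀)² - |horiz p|²
= 2 (1 + p₀)`. -/
theorem visPoint_sub (p : H2) (τ τ' : ℝ) : (visPoint p τ : ℂ) - visPoint p τ' =
    2 * (1 + p.1 0 : ℝ) * (Complex.exp (τ * Complex.I) - Complex.exp (τ' * Complex.I))
      / (visDen p τ * visDen p τ') := by
  have h1 := visDen_ne_zero p τ
  have h2 := visDen_ne_zero p τ'
  have h3 := horiz_mul_conj p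
  rw [visPoint_eq, visPoint_eq, div_sub_div _ _ h1 h2]
  congr 1
  rw [visDen_eq, visDen_eq]
  push_cast at h3 ⊢
  linear_combination (Complex.exp (τ' * Complex.I) - Complex.exp (τ * Complex.I)) * h3

theorem visPoint_mul_weight (p : H2) (τ : ℝ) : (visPoint p τ : ℂ) * visDen p τ ^ 2 =
    visWeight p τ * (2 * (1 + p.1 0 : ℝ) * Complex.exp (τ * Complex.I)) := by
  have h := exp_visAngle p τ
  have h1 : visDen p τ * (starRingEnd ℂ) (visDen p τ) = (2 * (1 + p.1 0) * visWeight p τ : ℝ) := by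
    rw [Complex.mul_conj, normSq_visDen]
  rw [visPoint, Circle.coe_exp]
  push_cast at h1 ⊢
  linear_combination visDen p τ * h + Complex.exp (τ * Complex.I) * h1

theorem exp_add_pi_div_two (τ : ℝ) : Complex.exp ((τ + Real.pi / 2 : ℝ) * Complex.I) =
    Complex.I * Complex.exp (τ * Complex.I) := by
  push_cast
  rw [add_mul, Complex.exp_add, Complex.exp_pi_div_two_mul_I, mul_comm]

theorem exp_sub_pi_div_two (τ : ℝ) : Complex.exp ((τ - Real.pi / 2 : ℝ) * Complex.I) =
    -Complex.I * Complex.exp (τ * Complex.I) := by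
  have h := exp_add_pi_div_two (τ - Real.pi / 2)
  rw [sub_add_cancel] at h
  rw [h]
  linear_combination Complex.exp ((τ - Real.pi / 2 : ℝ) * Complex.I) * Complex.I_sq

/-- Seen from the base point the quadruple is a square and the value is `1`; the Möbius
transformation to `p` multiplies it by the conformal factor `visWeight p τ`. -/
theorem visPoint_coeff (p : H2) (τ : ℝ) : Complex.I * visPoint p τ *
    (1 / ((visPoint p τ : ℂ) - visPoint p (τ - Real.pi / 2)) +
      1 / ((visPoint p (τ + Real.pi / 2) : ℂ) - visPoint p τ)) = visWeight p τ := by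
  have h0 := visDen_ne_zero p τ
  have h1 := visDen_ne_zero p (τ - Real.pi / 2)
  have h2 := visDen_ne_zero p (τ + Real.pi / 2)
  have hz := Complex.exp_ne_zero (τ * Complex.I)
  have hk : ((1 + p.1 0 : ℝ) : ℂ) ≠ 0 := by
    have := p.pos
    exact_mod_cast (by positivity : (1 + p.1 0 : ℝ) ≠ 0)
  have hw := visPoint_mul_weight p τ
  have hsum : visDen p (τ - Real.pi / 2) * (1 - Complex.I)
      - visDen p (τ + Real.pi / 2) * (1 + Complex.I) = -2 * Complex.I * visDen p τ := by
    rw [visDen_eq, visDen_eq, visDen_eq, exp_add_pi_div_two, exp_sub_pi_div_two]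
    ring
  rw [visPoint_sub, visPoint_sub, exp_add_pi_div_two, exp_sub_pi_div_two]
  set z := Complex.exp (τ * Complex.I)
  have i1 : (1 + Complex.I) ≠ 0 := by
    intro h; simpa using congrArg Complex.re h
  have i2 : (Complex.I - 1) ≠ 0 := by
    intro h; simpa using congrArg Complex.re h
  have j1 : (1 + Complex.I)⁻¹ = (1 - Complex.I) / 2 := by
    rw [inv_eq_iff_eq_inv, inv_div, eq_div_iff (by intro h; simpa using congrArg Complex.re h)]
    linear_combination -Complex.I_sq
  have j2 : (Complex.I - 1)⁻¹ = -(1 + Complex.I) / 2 := by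
    rw [inv_eq_iff_eq_inv, inv_div, eq_div_iff (neg_ne_zero.2 i1)]
    linear_combination -Complex.I_sq
  rw [show z - -Complex.I * z = (1 + Complex.I) * z by ring,
    show Complex.I * z - z = (Complex.I - 1) * z by ring, one_div_div, one_div_div]
  have e : Complex.I * visPoint p τ * (visDen p τ * visDen p (τ - Real.pi / 2) /
        (2 * (1 + p.1 0 : ℝ) * ((1 + Complex.I) * z)) + visDen p (τ + Real.pi / 2) * visDen p τ /
        (2 * (1 + p.1 0 : ℝ) * ((Complex.I - 1) * z)))
      = Complex.I * visPoint p τ * visDen p τ * (2 * (1 + p.1 0 : ℝ) * z)⁻¹ *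
        (visDen p (τ - Real.pi / 2) * (1 + Complex.I)⁻¹
          + visDen p (τ + Real.pi / 2) * (Complex.I - 1)⁻¹) := by
    simp only [div_eq_mul_inv, mul_inv]
    ring
  rw [e, j1, j2]
  have hz2 : 2 * ((1 + p.1 0 : ℝ) : ℂ) * z ≠ 0 := mul_ne_zero (mul_ne_zero two_ne_zero hk) hz
  generalize 2 * ((1 + p.1 0 : ℝ) : ℂ) * z = y at hw hz2 ⊢
  have hy : y⁻¹ * y = 1 := inv_mul_cancel₀ hz2
  linear_combination Complex.I * visPoint p τ * visDen p τ * y⁻¹ / 2 * hsum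
    - visPoint p τ * visDen p τ ^ 2 * y⁻¹ * Complex.I_sq + y⁻¹ * hw + visWeight p τ * hy

theorem distortion_eq (X : Circle → ℂ) (Q : Quadruple) : distortion X Q =
    X Q.b * (1 / ((Q.b : ℂ) - Q.a) + 1 / ((Q.c : ℂ) - Q.b))
      - X Q.c * (1 / ((Q.c : ℂ) - Q.b) + 1 / ((Q.d : ℂ) - Q.c))
      + X Q.d * (1 / ((Q.d : ℂ) - Q.c) + 1 / ((Q.a : ℂ) - Q.d))
      - X Q.a * (1 / ((Q.a : ℂ) - Q.d) + 1 / ((Q.b : ℂ) - Q.a)) := by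
  rw [distortion]
  ring

/-- The alternating sum of the values of the boundary function at a harmonic quadruple. -/
def altSum (φ : Circle → ℝ) (p : H2) (τ : ℝ) : ℝ :=
  visFun φ p (τ + Real.pi / 2) - visFun φ p (τ + Real.pi) + visFun φ p (τ + 3 * Real.pi / 2)
    - visFun φ p τ

theorem distortion_visQuad {X : Circle → ℂ} (hX : IsTangentField X) (p : H2) (τ : ℝ) :
    distortion X (visQuad p τ) = altSum (supportFun X) p τ := by
  have key (τ : ℝ) : X (visPoint p τ) * (1 / ((visPoint p τ : ℂ) - visPoint p (τ - Real.pi / 2)) +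
      1 / ((visPoint p (τ + Real.pi / 2) : ℂ) - visPoint p τ)) = visFun (supportFun X) p τ := by
    rw [hX.eq_supportFun, visFun]
    push_cast
    rw [← visPoint_coeff p τ]
    simp only [visPoint]
    ring
  have k1 := key (τ + Real.pi / 2)
  have k2 := key (τ + Real.pi)
  have k3 := key (τ + 3 * Real.pi / 2)
  have k0 := key τ
  rw [show τ + Real.pi / 2 - Real.pi / 2 = τ by ring,
    show τ + Real.pi / 2 + Real.pi / 2 = τ + Real.pi by ring] at k1
  rw [show τ + Real.pi - Real.pi / 2 = τ + Real.pi / 2 by ring,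
    show τ + Real.pi + Real.pi / 2 = τ + 3 * Real.pi / 2 by ring] at k2
  rw [show τ + 3 * Real.pi / 2 - Real.pi / 2 = τ + Real.pi by ring,
    show τ + 3 * Real.pi / 2 + Real.pi / 2 = τ + 2 * Real.pi by ring, visPoint_add_two_pi] at k3
  -- The predecessor of the first vertex is the fourth one, a period earlier.
  rw [← visPoint_add_two_pi p (τ - Real.pi / 2),
    show τ - Real.pi / 2 + 2 * Real.pi = τ + 3 * Real.pi / 2 by ring] at k0
  rw [distortion_eq, altSum]
  push_cast
  rw [← k0, ← k1, ← k2, ← k3]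
  rfl

/-- The Möbius denominators cancel in the cross-ratio, leaving that of a square. -/
theorem cr_visQuad (p : H2) (τ : ℝ) : (visQuad p τ).cr = 1 := by
  have h0 := visDen_ne_zero p τ
  have h1 := visDen_ne_zero p (τ + Real.pi / 2)
  have h2 := visDen_ne_zero p (τ + Real.pi)
  have h3 := visDen_ne_zero p (τ + 3 * Real.pi / 2)
  have hz := Complex.exp_ne_zero (τ * Complex.I)
  have hk : ((1 + p.1 0 : ℝ) : ℂ) ≠ 0 := by
    have := p.pos
    exact_mod_cast (by positivity : (1 + p.1 0 : ℝ) ≠ 0)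
  have e1 := exp_add_pi_div_two τ
  have e2 : Complex.exp ((τ + Real.pi : ℝ) * Complex.I) = -Complex.exp (τ * Complex.I) := by
    rw [show τ + Real.pi = τ + Real.pi / 2 + Real.pi / 2 by ring, exp_add_pi_div_two, e1]
    linear_combination Complex.exp (τ * Complex.I) * Complex.I_sq
  have e3 : Complex.exp ((τ + 3 * Real.pi / 2 : ℝ) * Complex.I)
      = -Complex.I * Complex.exp (τ * Complex.I) := by
    rw [show τ + 3 * Real.pi / 2 = τ + Real.pi + Real.pi / 2 by ring, exp_add_pi_div_two, e2]
    ring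
  simp only [Quadruple.cr, visQuad]
  rw [visPoint_sub, visPoint_sub, visPoint_sub, visPoint_sub, e1, e2, e3]
  have i1 : (1 + Complex.I) ≠ 0 := by
    intro h; simpa using congrArg Complex.re h
  have i3 : (-1 - Complex.I) ≠ 0 := by
    intro h; simpa using congrArg Complex.re h
  set z := Complex.exp (τ * Complex.I)
  rw [show -z - Complex.I * z = (-1 - Complex.I) * z by ring,
    show -Complex.I * z - z = (-1 - Complex.I) * z by ring,
    show -Complex.I * z - -z = (1 - Complex.I) * z by ring,
    show Complex.I * z - z = (Complex.I - 1) * z by ring]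
  generalize visDen p (τ + Real.pi / 2) = w₁ at *
  generalize visDen p (τ + 3 * Real.pi / 2) = w₃ at *
  field_simp
  linear_combination (-2) * Complex.I_sq

theorem norm_visPoint_sub_le (p : H2) {τ τ' : ℝ} (h1 : p.1 0 ≤ visWeight p τ)
    (h2 : p.1 0 ≤ visWeight p τ') : ‖(visPoint p τ : ℂ) - visPoint p τ'‖ ≤ 2 / p.1 0 := by
  have h := sq_norm_visPoint_sub p τ τ'
  have hp := p.pos
  rw [le_div_iff₀ hp]
  refine le_of_sq_le_sq ?_ (by norm_num)
  have h3 : p.1 0 * p.1 0 ≤ visWeight p τ * visWeight p τ' := by gcongr; linarith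
  have h4 := Real.neg_one_le_cos (τ' - τ)
  nlinarith [mul_le_mul_of_nonneg_right h3 (sq_nonneg ‖(visPoint p τ : ℂ) - visPoint p τ'‖)]

/-- Opposite vertices have weights adding up to `2 p₀`, so each opposite pair has a vertex of weight
at least `p₀`; these two vertices are adjacent and close together. -/
theorem scale_visQuad_le (p : H2) (τ : ℝ) : (visQuad p τ).scale ≤ 2 / p.1 0 := by
  have e1 : visWeight p τ + visWeight p (τ + Real.pi) = 2 * p.1 0 := by
    simp [visWeight]; ring
  have e2 : visWeight p (τ + Real.pi / 2) + visWeight p (τ + 3 * Real.pi / 2) = 2 * p.1 0 := by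
    rw [show τ + 3 * Real.pi / 2 = τ + Real.pi / 2 + Real.pi by ring]
    simp [visWeight, Real.cos_add_pi_div_two, Real.sin_add_pi_div_two]; ring
  have hac : p.1 0 ≤ visWeight p τ ∨ p.1 0 ≤ visWeight p (τ + Real.pi) := by
    by_contra! h; linarith
  have hbd : p.1 0 ≤ visWeight p (τ + Real.pi / 2) ∨ p.1 0 ≤ visWeight p (τ + 3 * Real.pi / 2) := by
    by_contra! h; linarith
  simp only [Quadruple.scale, visQuad, min_le_iff]
  rcases hac with h1 | h1 <;> rcases hbd with h2 | h2
  · exact Or.inl (Or.inl (norm_visPoint_sub_le p h1 h2))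
  · exact Or.inr (Or.inr (norm_visPoint_sub_le p h2 h1))
  · exact Or.inl (Or.inr (norm_visPoint_sub_le p h2 h1))
  · exact Or.inr (Or.inl (norm_visPoint_sub_le p h1 h2))

/-! ### Little Zygmund vector fields have asymptotically conformal extensions -/

/-- Otherwise points with `p₀ ≥ n + 1` give quadruples of scale at most `2/(n + 1)`, a degenerating
sequence with distortion bounded below. -/
theorem IsLittleZygmund.altSum_small {X : Circle → ℂ} (hX : IsLittleZygmund X)
    (hXt : IsTangentField X) {ε : ℝ} (hε : 0 < ε) :
    ∃ N, ∀ p : H2, N ≤ p.1 0 → ∀ τ, |altSum (supportFun X) p τ| ≤ ε := by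
  by_contra! hcon
  choose p hp τ hτ using fun n : ℕ => hcon (n + 1)
  have hdeg : IsDegenerating fun n => visQuad (p n) (τ n) := by
    refine ⟨fun n => cr_visQuad _ _, ?_⟩
    refine squeeze_zero (g := fun n : ℕ => 2 * (1 / ((n : ℝ) + 1))) (fun n => ?_) (fun n => ?_) ?_
    · simp only [Quadruple.scale]; positivity
    · refine (scale_visQuad_le _ _).trans ?_
      rw [mul_one_div]
      gcongr
      exact hp n
    · simpa using (tendsto_one_div_add_atTop_nhds_zero_nat (𝕜 := ℝ)).const_mul 2
  have h1 := hX.2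
  have h2 : limsup (fun n => ‖distortion X (visQuad (p n) (τ n))‖ₑ) atTop = 0 := by
    have := (ENNReal.iSup_eq_zero.1 h1) (fun n => visQuad (p n) (τ n))
    exact (ENNReal.iSup_eq_zero.1 this) hdeg
  have h3 : ENNReal.ofReal ε ≤ limsup (fun n => ‖distortion X (visQuad (p n) (τ n))‖ₑ) atTop := by
    refine le_limsup_of_frequently_le (Frequently.of_forall fun n => ?_)
    rw [distortion_visQuad hXt, ← ofReal_norm]
    refine ENNReal.ofReal_le_ofReal ?_
    rw [Complex.norm_real, Real.norm_eq_abs]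
    exact (hτ n).le
  rw [h2, nonpos_iff_eq_zero, ENNReal.ofReal_eq_zero] at h3
  linarith

/-- The kernel `q` changes sign under a quarter turn, so averaging over the four quarter turns
replaces `visFun` by `-altSum / 4`; then `|q| ≤ 3` gives even `3ε/4`. -/
theorem abs_hessForm_le_of_altSum (hφ : Continuous φ) (p : H2) {ε : ℝ}
    (h : ∀ τ, |altSum φ p τ| ≤ ε) {x y : ℝ} (hxy : x ^ 2 + y ^ 2 = 1) :
    |hessForm (kleinFun (poissonSol φ)) p (x • frameFst p + y • frameSnd p)
      (x • frameFst p + y • frameSnd p)| ≤ ε := by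
  have hpi := Real.pi_pos
  rw [hessForm_eq_integral hφ p hxy]
  set q : ℝ → ℝ := fun τ => 6 * (x * Real.cos τ + y * Real.sin τ) ^ 2 - 3 with hq
  have hqc : Continuous q := by fun_prop
  have hqs (τ : ℝ) : q (τ + Real.pi / 2) = -q τ := by
    simp only [hq, Real.cos_add_pi_div_two, Real.sin_add_pi_div_two]
    linear_combination 6 * (x ^ 2 + y ^ 2) * Real.sin_sq_add_cos_sq τ + 6 * hxy
  have hqs2 (τ : ℝ) : q (τ + Real.pi) = q τ := by
    rw [show τ + Real.pi = τ + Real.pi / 2 + Real.pi / 2 by ring, hqs, hqs, neg_neg]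
  have hqs3 (τ : ℝ) : q (τ + 3 * Real.pi / 2) = -q τ := by
    rw [show τ + 3 * Real.pi / 2 = τ + Real.pi + Real.pi / 2 by ring, hqs, hqs2]
  have hc := continuous_visFun hφ p
  have hper : Function.Periodic (fun τ => visFun φ p τ * q τ) (2 * Real.pi) := fun τ => by
    simp only [periodic_visFun φ p τ]
    rw [show τ + 2 * Real.pi = τ + Real.pi + Real.pi by ring, hqs2, hqs2]
  have hshift (a : ℝ) : ∫ τ in 0..2 * Real.pi, visFun φ p (τ + a) * q (τ + a)
      = ∫ τ in 0..2 * Real.pi, visFun φ p τ * q τ := by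
    rw [intervalIntegral.integral_comp_add_right (fun τ => visFun φ p τ * q τ) a, zero_add,
      add_comm _ a, hper.intervalIntegral_add_eq a 0, zero_add]
  have hI (a : ℝ) : IntervalIntegrable (fun τ => visFun φ p (τ + a) * q (τ + a))
      MeasureTheory.volume 0 (2 * Real.pi) := Continuous.intervalIntegrable (by fun_prop) _ _
  have hI0 : IntervalIntegrable (fun τ => visFun φ p τ * q τ)
      MeasureTheory.volume 0 (2 * Real.pi) := by simpa using hI 0
  have hD : ∫ τ in 0..2 * Real.pi, altSum φ p τ * q τ
      = -4 * ∫ τ in 0..2 * Real.pi, visFun φ p τ * q τ := by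
    have e (τ : ℝ) : altSum φ p τ * q τ =
        -(visFun φ p (τ + Real.pi / 2) * q (τ + Real.pi / 2)
        + visFun φ p (τ + Real.pi) * q (τ + Real.pi)
        + visFun φ p (τ + 3 * Real.pi / 2) * q (τ + 3 * Real.pi / 2) + visFun φ p τ * q τ) := by
      rw [hqs, hqs2, hqs3, altSum]; ring
    simp only [e]
    rw [intervalIntegral.integral_neg,
      intervalIntegral.integral_add (((hI _).add (hI _)).add (hI _)) hI0,
      intervalIntegral.integral_add ((hI _).add (hI _)) (hI _),
      intervalIntegral.integral_add (hI _) (hI _), hshift, hshift, hshift]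
    ring
  have hε : 0 ≤ ε := (abs_nonneg _).trans (h 0)
  have hb : |∫ τ in 0..2 * Real.pi, altSum φ p τ * q τ| ≤ ε * 3 * |2 * Real.pi - 0| := by
    rw [← Real.norm_eq_abs]
    refine intervalIntegral.norm_integral_le_of_norm_le_const fun τ _ => ?_
    rw [Real.norm_eq_abs, abs_mul]
    have hq3 : |q τ| ≤ 3 := by
      have : (x * Real.cos τ + y * Real.sin τ) ^ 2 ≤ 1 := by
        nlinarith [sq_nonneg (x * Real.sin τ - y * Real.cos τ), Real.sin_sq_add_cos_sq τ]
      rw [abs_le]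
      constructor <;> simp only [hq] <;> nlinarith [sq_nonneg (x * Real.cos τ + y * Real.sin τ)]
    exact mul_le_mul (h τ) hq3 (abs_nonneg _) hε
  rw [hD, abs_mul, sub_zero, abs_of_pos (by positivity : 0 < 2 * Real.pi)] at hb
  rw [abs_mul, abs_of_pos (by positivity), inv_mul_le_iff₀ (by positivity)]
  norm_num at hb
  nlinarith

theorem dbarNorm_le_of_altSum (hφ : Continuous φ) (p : H2) {ε : ℝ}
    (h : ∀ τ, |altSum φ p τ| ≤ ε) : dbarNorm (surfaceField (poissonSol φ)) p ≤ 2 * ε := by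
  have hs := isSmooth_poissonSol hφ
  have hm := isMean_poissonSol hφ
  rw [dbarNorm_surfaceField hs hm]
  have h1 := abs_hessForm_le_of_altSum hφ p h (x := 1) (y := 0) (by norm_num)
  have hr : √2 ^ 2 = (2 : ℝ) := Real.sq_sqrt (by norm_num)
  -- On the diagonal direction the two opposite diagonal entries cancel, which isolates the entry
  -- `c`.
  have h2 := abs_hessForm_le_of_altSum hφ p h (x := √2 / 2) (y := √2 / 2)
    (by rw [div_pow, hr]; norm_num)
  rw [hessForm_frame hs.kleinFun] at h1 h2
  have h3 := (isMean_iff hs).1 hm p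
  generalize hessForm (kleinFun (poissonSol φ)) p (frameFst p) (frameFst p) = b at *
  generalize hessForm (kleinFun (poissonSol φ)) p (frameFst p) (frameSnd p) = c at *
  generalize hessForm (kleinFun (poissonSol φ)) p (frameSnd p) (frameSnd p) = d at *
  have h4 : (√2 / 2) ^ 2 * b + 2 * (√2 / 2) * (√2 / 2) * c + (√2 / 2) ^ 2 * d = c := by
    linear_combination (b / 4 + c / 2 + d / 4) * hr + h3 / 2
  rw [h4] at h2
  simp only [one_pow, one_mul, mul_zero, zero_mul, add_zero, ne_eq, OfNat.ofNat_ne_zero,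
    not_false_eq_true, zero_pow] at h1
  refine le_trans (Real.sqrt_le_sqrt ?_ : _ ≤ √((|b| + |c|) ^ 2)) ?_
  · nlinarith [sq_abs b, sq_abs c, abs_nonneg b, abs_nonneg c,
      mul_nonneg (abs_nonneg b) (abs_nonneg c)]
  · rw [Real.sqrt_sq (by positivity)]
    linarith

theorem dbarNorm_nonneg (V : H2 → Mink) (p : H2) : 0 ≤ dbarNorm V p :=
  Real.sSup_nonneg fun r ⟨Y, _, _, hr⟩ => by
    rw [hr]; exact div_nonneg (Real.sqrt_nonneg _) (Real.sqrt_nonneg _)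

theorem IsLittleZygmund.tendsto_dbarNorm {X : Circle → ℂ} (hX : IsLittleZygmund X)
    (hXt : IsTangentField X) :
    Tendsto (dbarNorm (HL X)) (comap (fun p : H2 => ‖poincare p‖) (𝓝[<] 1)) (𝓝 0) := by
  rw [HL_eq hX.1.1, tendsto_zero_iff]
  intro ε hε
  obtain ⟨N, hN⟩ := hX.altSum_small hXt (ε := ε / 3) (by positivity)
  refine ⟨N, fun p hp => ?_⟩
  rw [abs_of_nonneg (dbarNorm_nonneg _ _)]
  have := dbarNorm_le_of_altSum (continuous_supportFun hX.1.1) p (hN p hp)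
  linarith

/-! ### Affine envelopes -/

theorem affine_apply (a : ℂ →ᵃ[ℝ] ℝ) (x : ℂ) : a x = a.linear x + a 0 := by
  rw [a.decomp]; simp

/-- The point `η` lies on a diameter, and the inequality holds at both of its endpoints. -/
theorem affine_le_of_le_circle {a b : ℂ →ᵃ[ℝ] ℝ} (h : ∀ z : Circle, a z ≤ b z) {η : ℂ}
    (hη : ‖η‖ < 1) : a η ≤ b η := by
  obtain ⟨z, hz⟩ : ∃ z : Circle, η = ‖η‖ • (z : ℂ) := by
    refine ⟨Circle.exp (Complex.arg η), ?_⟩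
    rw [Circle.coe_exp, Complex.real_smul, Complex.norm_mul_exp_arg_mul_I]
  have h1 := h z
  have h2 := h (-z)
  rw [affine_apply a, affine_apply b] at h1 h2 ⊢
  rw [Circle.coe_neg, map_neg, map_neg] at h2
  rw [hz, map_smul, map_smul, smul_eq_mul, smul_eq_mul]
  nlinarith [norm_nonneg η]

theorem exists_affine (L : ℂ →L[ℝ] ℝ) (c : ℝ) : ∃ a : ℂ →ᵃ[ℝ] ℝ, ∀ x, a x = L x + c :=
  ⟨L.toLinearMap.toAffineMap + AffineMap.const ℝ ℂ c, fun x => by simp⟩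

/-- The constants `±M` make the families that define the envelopes nonempty and bounded in the disk,
so there `sSup` and `sInf` take no default value. -/
theorem exists_const_bounds (hφ : Continuous φ) : ∃ M, 0 ≤ M ∧ (∀ z, |φ z| ≤ M) := by
  obtain ⟨M, hM⟩ := isCompact_univ.exists_bound_of_continuousOn hφ.continuousOn
  exact ⟨M, (norm_nonneg _).trans (hM 1 trivial), fun z => hM z trivial⟩

theorem le_lowerEnv (hφ : Continuous φ) {a : ℂ →ᵃ[ℝ] ℝ} (ha : ∀ z : Circle, a z ≤ φ z) {η : ℂ}
    (hη : ‖η‖ < 1) : a η ≤ lowerEnv φ η := by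
  obtain ⟨M, -, hM⟩ := exists_const_bounds hφ
  obtain ⟨b, hb⟩ := exists_affine 0 M
  refine le_csSup ⟨b η, ?_⟩ ⟨a, ha, rfl⟩
  rintro _ ⟨a', ha', rfl⟩
  refine affine_le_of_le_circle (fun z => (ha' z).trans ?_) hη
  rw [hb]; simpa using (le_abs_self _).trans (hM z)

theorem upperEnv_le (hφ : Continuous φ) {a : ℂ →ᵃ[ℝ] ℝ} (ha : ∀ z : Circle, φ z ≤ a z) {η : ℂ}
    (hη : ‖η‖ < 1) : upperEnv φ η ≤ a η := by
  obtain ⟨M, -, hM⟩ := exists_const_bounds hφ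
  obtain ⟨b, hb⟩ := exists_affine 0 (-M)
  refine csInf_le ⟨b η, ?_⟩ ⟨a, ha, rfl⟩
  rintro _ ⟨a', ha', rfl⟩
  refine affine_le_of_le_circle (fun z => le_trans ?_ (ha' z)) hη
  rw [hb]; simpa using (abs_le.1 (hM z)).1

theorem lowerEnv_le (hφ : Continuous φ) {η : ℂ} {c : ℝ}
    (h : ∀ a : ℂ →ᵃ[ℝ] ℝ, (∀ z : Circle, a z ≤ φ z) → a η ≤ c) : lowerEnv φ η ≤ c := by
  obtain ⟨M, -, hM⟩ := exists_const_bounds hφ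
  obtain ⟨b, hb⟩ := exists_affine 0 (-M)
  refine csSup_le ⟨b η, b, fun z => ?_, rfl⟩ ?_
  · rw [hb]; simpa using (abs_le.1 (hM z)).1
  · rintro _ ⟨a', ha', rfl⟩
    exact h a' ha'

theorem le_upperEnv (hφ : Continuous φ) {η : ℂ} {c : ℝ}
    (h : ∀ a : ℂ →ᵃ[ℝ] ℝ, (∀ z : Circle, φ z ≤ a z) → c ≤ a η) : c ≤ upperEnv φ η := by
  obtain ⟨M, -, hM⟩ := exists_const_bounds hφ
  obtain ⟨b, hb⟩ := exists_affine 0 M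
  refine le_csInf ⟨b η, b, fun z => ?_, rfl⟩ ?_
  · rw [hb]; simpa using (le_abs_self _).trans (hM z)
  · rintro _ ⟨a', ha', rfl⟩
    exact h a' ha'

theorem lowerEnv_le_upperEnv (hφ : Continuous φ) {η : ℂ} (hη : ‖η‖ < 1) :
    lowerEnv φ η ≤ upperEnv φ η :=
  lowerEnv_le hφ fun _ ha => le_upperEnv hφ fun _ hb =>
    affine_le_of_le_circle (fun z => (ha z).trans (hb z)) hη

theorem width_klein (X : Circle → ℂ) (p : H2) : width X (klein p) =
    p.1 0 * (upperEnv (supportFun X) (klein p) - lowerEnv (supportFun X) (klein p)) := by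
  rw [width, sqrt_klein, div_inv_eq_mul, mul_comm]

theorem width_klein_nonneg {X : Circle → ℂ} (hX : Continuous X) (p : H2) :
    0 ≤ width X (klein p) := by
  rw [width_klein]
  have := lowerEnv_le_upperEnv (continuous_supportFun hX) (norm_klein_lt p)
  exact mul_nonneg p.pos.le (by linarith)

/-! ### Small `∂̄` implies small width -/

/-- A convex function lies above its tangent at `0`; the interval is half-open because the second
derivatives to be treated may blow up at `1`. -/
theorem tangent_line_le {F F₁ F₂ : ℝ → ℝ} (h : ∀ t, 0 ≤ t → t < 1 → HasDerivAt F (F₁ t) t)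
    (h₁ : ∀ t, 0 ≤ t → t < 1 → HasDerivAt F₁ (F₂ t) t) (h₂ : ∀ t, 0 ≤ t → t < 1 → 0 ≤ F₂ t)
    {t : ℝ} (ht0 : 0 ≤ t) (ht1 : t < 1) : F 0 + t * F₁ 0 ≤ F t := by
  have hint : interior (Set.Ico (0 : ℝ) 1) = Set.Ioo 0 1 := interior_Ico
  have m1 : MonotoneOn F₁ (Set.Ico 0 1) := by
    refine monotoneOn_of_hasDerivWithinAt_nonneg (f' := F₂) (convex_Ico 0 1)
      (fun s hs => (h₁ s hs.1 hs.2).continuousAt.continuousWithinAt) ?_ ?_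
    · rw [hint]; exact fun s hs => (h₁ s hs.1.le hs.2).hasDerivWithinAt
    · rw [hint]; exact fun s hs => h₂ s hs.1.le hs.2
  have m2 : MonotoneOn (fun s => F s - s * F₁ 0) (Set.Ico 0 1) := by
    have hd (s : ℝ) (hs : 0 ≤ s) (hs1 : s < 1) :
        HasDerivAt (fun s => F s - s * F₁ 0) (F₁ s - F₁ 0) s := by
      exact ((h s hs hs1).sub ((hasDerivAt_id s).mul_const (F₁ 0))).congr_deriv (by simp)
    refine monotoneOn_of_hasDerivWithinAt_nonneg (f' := fun s => F₁ s - F₁ 0) (convex_Ico 0 1)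
      (fun s hs => (hd s hs.1 hs.2).continuousAt.continuousWithinAt) ?_ ?_
    · rw [hint]; exact fun s hs => (hd s hs.1.le hs.2).hasDerivWithinAt
    · rw [hint]
      exact fun s hs => sub_nonneg.2 (m1 ⟨le_rfl, one_pos⟩ ⟨hs.1.le, hs.2⟩ hs.1.le)
  have := m2 ⟨le_rfl, one_pos⟩ ⟨ht0, ht1⟩ ht0
  simp only [zero_mul, sub_zero] at this
  linarith

/-- The function `H` has the bound as its second derivative, so `H ± g` are convex. Both exponents
exceed `-2`, hence `H` stays bounded at `1`; since `H ≤ 0` and `H₁ 0 ≥ 0`, the error is at most `-H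
0 = 4A + 16B/3`. -/
theorem abs_sub_tangent_le {g g₁ g₂ : ℝ → ℝ} {A B : ℝ} (hA : 0 ≤ A) (hB : 0 ≤ B)
    (h : ∀ t, 0 ≤ t → t < 1 → HasDerivAt g (g₁ t) t)
    (h₁ : ∀ t, 0 ≤ t → t < 1 → HasDerivAt g₁ (g₂ t) t)
    (h₂ : ∀ t, 0 ≤ t → t < 1 →
      |g₂ t| ≤ A * (1 - t) ^ (-(3 / 2) : ℝ) + B * (1 - t) ^ (-(7 / 4) : ℝ))
    {t : ℝ} (ht0 : 0 ≤ t) (ht1 : t < 1) : |g t - (g 0 + t * g₁ 0)| ≤ 4 * A + 6 * B := by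
  set H : ℝ → ℝ := fun t => -(4 * A) * (1 - t) ^ (1 / 2 : ℝ) - 16 / 3 * B * (1 - t) ^ (1 / 4 : ℝ)
  set H₁ : ℝ → ℝ := fun t => 2 * A * (1 - t) ^ (-(1 / 2) : ℝ) + 4 / 3 * B * (1 - t) ^ (-(3 / 4) : ℝ)
  set H₂ : ℝ → ℝ := fun t => A * (1 - t) ^ (-(3 / 2) : ℝ) + B * (1 - t) ^ (-(7 / 4) : ℝ)
  have hs (t : ℝ) : HasDerivAt (fun t : ℝ => 1 - t) (-1) t := by
    simpa using (hasDerivAt_id t).const_sub 1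
  have hp (r : ℝ) (t : ℝ) (ht1 : t < 1) :
      HasDerivAt (fun t : ℝ => (1 - t) ^ r) (-(r * (1 - t) ^ (r - 1))) t := by
    refine ((hs t).rpow_const (p := r) (Or.inl (by linarith))).congr_deriv (by ring)
  have hH (t : ℝ) (_ : 0 ≤ t) (ht1 : t < 1) : HasDerivAt H (H₁ t) t := by
    refine (((hp (1 / 2) t ht1).const_mul (-(4 * A))).sub
      ((hp (1 / 4) t ht1).const_mul (16 / 3 * B))).congr_deriv ?_
    norm_num [H₁]
    ring
  have hH₁ (t : ℝ) (_ : 0 ≤ t) (ht1 : t < 1) : HasDerivAt H₁ (H₂ t) t := by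
    refine (((hp (-(1 / 2)) t ht1).const_mul (2 * A)).add
      ((hp (-(3 / 4)) t ht1).const_mul (4 / 3 * B))).congr_deriv ?_
    norm_num [H₂]
    ring
  have k1 := tangent_line_le (F := fun t => H t - g t) (F₁ := fun t => H₁ t - g₁ t)
    (F₂ := fun t => H₂ t - g₂ t) (fun t a b => (hH t a b).sub (h t a b))
    (fun t a b => (hH₁ t a b).sub (h₁ t a b))
    (fun t a b => by linarith [(abs_le.1 (h₂ t a b)).2]) ht0 ht1
  have k2 := tangent_line_le (F := fun t => H t + g t) (F₁ := fun t => H₁ t + g₁ t)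
    (F₂ := fun t => H₂ t + g₂ t) (fun t a b => (hH t a b).add (h t a b))
    (fun t a b => (hH₁ t a b).add (h₁ t a b))
    (fun t a b => by linarith [(abs_le.1 (h₂ t a b)).1]) ht0 ht1
  have e0 : H 0 = -(4 * A) - 16 / 3 * B := by simp [H]
  have e1 : 0 ≤ H₁ 0 := by simp [H₁]; positivity
  have e2 : H t ≤ 0 := by
    have h1 : (0 : ℝ) ≤ 1 - t := by linarith
    have h3 : 0 ≤ 4 * A * (1 - t) ^ (1 / 2 : ℝ) := by positivity
    have h4 : 0 ≤ 16 / 3 * B * (1 - t) ^ (1 / 4 : ℝ) := by positivity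
    simp only [H]
    linarith
  have e3 := mul_nonneg ht0 e1
  rw [abs_le]
  constructor <;> nlinarith

/-- The radial direction `p` is in the kernel of `dKlein p`, so `v` may be replaced by its
tangential part. -/
theorem abs_hessForm_le_general {u : H2 → ℝ} (hu : IsSmooth u) (hm : IsMean u) (p : H2) (v : Mink) :
    |hessForm (kleinFun u) p v v| ≤ dbarNorm (surfaceField u) p * (mink v v + mink v p.1 ^ 2) := by
  have hp := p.2.1
  have h1 : IsTangentAt p (tangentProj p v) := by
    rw [IsTangentAt, tangentProj, mink_add_right, mink_smul_right, hp, mink_comm]; ring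
  have h2 : dKlein p (tangentProj p v) = dKlein p v := by
    have h0 := p.pos
    have h : dKlein p p.1 = 0 := by
      apply Complex.ext <;> simp [dKlein, klein] <;> field_simp <;> simp
    rw [tangentProj, dKlein_add, dKlein_smul, h, smul_zero, add_zero]
  have h3 : mink (tangentProj p v) (tangentProj p v) = mink v v + mink v p.1 ^ 2 := by
    simp only [tangentProj, mink_add_left, mink_add_right, mink_smul_left, mink_smul_right, hp,
      mink_comm p.1 v]
    ring
  have h4 := abs_hessForm_le hu hm h1
  rw [h3, hessForm, h2] at h4
  exact h4

/-- Write `p + t v = s n` with `n` in the hyperboloid and `s = √(1 - t²)`. The Hessian of the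
extension has degree `-1`, which gives `s⁻¹`, and the tangential part of `v` at `n` has square
`s⁻²`. -/
theorem abs_second_deriv_line_le {u : H2 → ℝ} (hu : IsSmooth u) (hm : IsMean u) {p : H2} {v : Mink}
    (hv : IsTangentAt p v) (h1 : mink v v = 1) {t : ℝ} (ht : |t| < 1) :
    |(p.1 0 + t * v 0)⁻¹ ^ 3 * p.1 0 ^ 4 *
      fderiv ℝ (fderiv ℝ (kleinFun u)) (kleinLine p v t) (dKlein p v) (dKlein p v)| ≤
      (√(1 - t ^ 2))⁻¹ ^ 3 * dbarNorm (surfaceField u) (kleinInv (kleinLine p v t)) := by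
  have hx := line_zero_pos hv h1 ht.le
  have hb := norm_kleinLine_lt hv h1 ht
  have hval := kleinInv_kleinLine hv h1 ht
  have hp := p.pos
  have h3 : 0 < 1 - t ^ 2 := by linarith [(sq_lt_one_iff_abs_lt_one t).2 ht]
  set s := √(1 - t ^ 2) with hs
  have hs0 : 0 < s := Real.sqrt_pos.2 h3
  have hs2 : s ^ 2 = 1 - t ^ 2 := Real.sq_sqrt h3.le
  set n := kleinInv (kleinLine p v t) with hn
  have hkn : klein n = kleinLine p v t := klein_kleinInv hb
  have hn0 : n.1 0 = s⁻¹ * (p.1 0 + t * v 0) := by rw [hval]; simp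
  have hd : dKlein n v = (s * p.1 0 ^ 2 * (p.1 0 + t * v 0)⁻¹ ^ 2) • dKlein p v := by
    have e1 : (klein p).re = p.1 1 / p.1 0 := rfl
    have e2 : (klein p).im = p.1 2 / p.1 0 := rfl
    apply Complex.ext
    · simp only [dKlein, hkn, hn0, kleinLine_re, Complex.smul_re, smul_eq_mul, e1]
      obtain ⟨x, hx'⟩ : ∃ x, x = p.1 0 + t * v 0 := ⟨_, rfl⟩
      rw [← hx'] at hx ⊢
      field_simp
      linear_combination v 1 * hx'
    · simp only [dKlein, hkn, hn0, kleinLine_im, Complex.smul_im, smul_eq_mul, e2]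
      obtain ⟨x, hx'⟩ : ∃ x, x = p.1 0 + t * v 0 := ⟨_, rfl⟩
      rw [← hx'] at hx ⊢
      field_simp
      linear_combination v 2 * hx'
  have hm2 : mink v v + mink v n.1 ^ 2 = s⁻¹ ^ 2 := by
    rw [hval, mink_smul_right, mink_add_right, mink_smul_right, h1, mink_comm v p.1,
      show mink p.1 v = 0 from hv]
    field_simp
    rw [hs2]; ring
  have h4 := abs_hessForm_le_general hu hm n v
  rw [hm2, hessForm, hd, hkn, map_smul, map_smul, smul_apply, smul_eq_mul, smul_eq_mul,
    hn0] at h4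
  set D := fderiv ℝ (fderiv ℝ (kleinFun u)) (kleinLine p v t) (dKlein p v) (dKlein p v)
  have e : (p.1 0 + t * v 0)⁻¹ ^ 3 * p.1 0 ^ 4 * D = s⁻¹ * (s⁻¹ * (p.1 0 + t * v 0) *
      (s * p.1 0 ^ 2 * (p.1 0 + t * v 0)⁻¹ ^ 2 * (s * p.1 0 ^ 2 * (p.1 0 + t * v 0)⁻¹ ^ 2 * D))) := by
    generalize p.1 0 + t * v 0 = x at *
    field_simp
  rw [e, abs_mul, abs_of_pos (inv_pos.2 hs0)]
  refine (mul_le_mul_of_nonneg_left h4 (inv_pos.2 hs0).le).trans (le_of_eq ?_)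
  ring

/-- The time component of a point on a geodesic ray decays at most exponentially. -/
theorem sq_time_line_ge {p : H2} {v : Mink} (hv : IsTangentAt p v) (h1 : mink v v = 1) {t : ℝ}
    (ht0 : 0 ≤ t) (ht1 : t < 1) :
    p.1 0 ^ 2 * (1 - t) ≤ 2 * (kleinInv (kleinLine p v t)).1 0 ^ 2 := by
  have ht : |t| < 1 := by rwa [abs_of_nonneg ht0]
  have hp := p.pos
  have h3 : 0 < 1 - t ^ 2 := by nlinarith
  have hx : p.1 0 * (1 - t) ≤ p.1 0 + t * v 0 := by
    nlinarith [(abs_lt.1 (abs_lt_of_tangent hv h1)).1]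
  have hx2 : (p.1 0 * (1 - t)) ^ 2 ≤ (p.1 0 + t * v 0) ^ 2 :=
    pow_le_pow_left₀ (by nlinarith) hx 2
  rw [kleinInv_kleinLine hv h1 ht]
  simp only [Pi.smul_apply, Pi.add_apply, smul_eq_mul]
  rw [mul_pow, inv_pow, Real.sq_sqrt h3.le, ← mul_assoc, mul_comm (2 : ℝ), mul_assoc,
    le_inv_mul_iff₀ h3]
  nlinarith [mul_nonneg (mul_nonneg (sq_nonneg (p.1 0)) (sq_nonneg (1 - t)))
    (by linarith : 0 ≤ 1 - t)]

/-- By `sq_time_line_ge`, the decay `n₀^(-1/2)` costs a factor `(1 - t)^(-1/4)`, and `-7/4 = -3/2 -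
1/4` is still above `-2`. Any decay `p₀^(-s)` with `0 < s < 1` would serve. -/
theorem abs_second_deriv_line_le_rpow {u : H2 → ℝ} (hu : IsSmooth u) (hm : IsMean u) {ε K : ℝ}
    (hK : 0 ≤ K)
    (hb : ∀ p : H2, dbarNorm (surfaceField u) p ≤ ε + K * p.1 0 ^ (-(1 / 2) : ℝ)) {p : H2}
    {v : Mink} (hv : IsTangentAt p v) (h1 : mink v v = 1) {t : ℝ} (ht0 : 0 ≤ t) (ht1 : t < 1) :
    |(p.1 0 + t * v 0)⁻¹ ^ 3 * p.1 0 ^ 4 *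
      fderiv ℝ (fderiv ℝ (kleinFun u)) (kleinLine p v t) (dKlein p v) (dKlein p v)| ≤
      ε * (1 - t) ^ (-(3 / 2) : ℝ) +
        2 * K * p.1 0 ^ (-(1 / 2) : ℝ) * (1 - t) ^ (-(7 / 4) : ℝ) := by
  have ht : |t| < 1 := by rwa [abs_of_nonneg ht0]
  refine (abs_second_deriv_line_le hu hm hv h1 ht).trans ?_
  have hs : 0 < 1 - t := by linarith
  have hp := p.pos
  set n := kleinInv (kleinLine p v t)
  have hn := n.pos
  have k1 : (√(1 - t ^ 2))⁻¹ ^ 3 ≤ (1 - t) ^ (-(3 / 2) : ℝ) := by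
    have e : (1 - t) ^ (-(3 / 2) : ℝ) = (√(1 - t))⁻¹ ^ 3 := by
      rw [Real.rpow_neg hs.le, inv_pow, Real.sqrt_eq_rpow, ← Real.rpow_natCast, ← Real.rpow_mul hs.le]
      norm_num
    rw [e]
    have : √(1 - t) ≤ √(1 - t ^ 2) := Real.sqrt_le_sqrt (by nlinarith)
    have := Real.sqrt_pos.2 hs
    gcongr
  have k2 : n.1 0 ^ (-(1 / 2) : ℝ) ≤ 2 * p.1 0 ^ (-(1 / 2) : ℝ) * (1 - t) ^ (-(1 / 4) : ℝ) := by
    have h2 := sq_time_line_ge hv h1 ht0 ht1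
    have h3 : (n.1 0 ^ 2) ^ (-(1 / 4) : ℝ) ≤ (p.1 0 ^ 2 * (1 - t) / 2) ^ (-(1 / 4) : ℝ) :=
      Real.rpow_le_rpow_of_nonpos (by positivity) (by linarith) (by norm_num)
    have e (x : ℝ) (hx : 0 < x) : (x ^ 2) ^ (-(1 / 4) : ℝ) = x ^ (-(1 / 2) : ℝ) := by
      rw [← Real.rpow_natCast, ← Real.rpow_mul hx.le]; norm_num
    rw [e _ hn, Real.div_rpow (by positivity) (by norm_num),
      Real.mul_rpow (by positivity) hs.le, e _ hp] at h3
    refine h3.trans ?_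
    rw [div_eq_mul_inv, ← Real.rpow_neg (by norm_num), mul_assoc 2, mul_comm]
    have : (2 : ℝ) ^ (- -(1 / 4) : ℝ) ≤ 2 := by
      conv_rhs => rw [← Real.rpow_one 2]
      exact Real.rpow_le_rpow_of_exponent_le (by norm_num) (by norm_num)
    gcongr
  calc (√(1 - t ^ 2))⁻¹ ^ 3 * dbarNorm (surfaceField u) n
      ≤ (1 - t) ^ (-(3 / 2) : ℝ) *
        (ε + K * (2 * p.1 0 ^ (-(1 / 2) : ℝ) * (1 - t) ^ (-(1 / 4) : ℝ))) := by
        refine mul_le_mul k1 ((hb n).trans (by gcongr)) (dbarNorm_nonneg _ _) (by positivity)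
    _ = _ := by
        have e : (1 - t) ^ (-(7 / 4) : ℝ) = (1 - t) ^ (-(3 / 2) : ℝ) * (1 - t) ^ (-(1 / 4) : ℝ) := by
          rw [← Real.rpow_add hs]; norm_num
        rw [e]; ring

/-- The values of `φ` differ little from those of the tangent plane of the mean surface. -/
theorem abs_boundary_sub_tangent_le {u : H2 → ℝ} (hu : IsMeanGraph φ u) {ε K : ℝ}
    (hε : 0 ≤ ε) (hK : 0 ≤ K)
    (hb : ∀ p : H2, dbarNorm (surfaceField u) p ≤ ε + K * p.1 0 ^ (-(1 / 2) : ℝ)) (p : H2)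
    (z : Circle) :
    |φ z - (kleinFun u (klein p) + fderiv ℝ (kleinFun u) (klein p) (z - klein p))| ≤
      (4 * ε + 12 * K * p.1 0 ^ (-(1 / 2) : ℝ)) * -mink p.1 (lift1 z) := by
  have hp := p.pos
  have hsq := p.sq
  have hzn : (z : ℂ).re ^ 2 + (z : ℂ).im ^ 2 = 1 := by
    rw [← sq_norm_eq, Circle.norm_coe, one_pow]
  have hm : 0 < -mink p.1 (lift1 z) := by
    have : p.1 1 * (z : ℂ).re + p.1 2 * (z : ℂ).im < p.1 0 := by
      refine lt_of_pow_lt_pow_left₀ 2 hp.le ?_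
      nlinarith [sq_nonneg (p.1 1 * (z : ℂ).im - p.1 2 * (z : ℂ).re)]
    simp only [mink, lift1, Matrix.cons_val]
    linarith
  obtain ⟨m, hmdef⟩ : ∃ m, m = -mink p.1 (lift1 z) := ⟨_, rfl⟩
  rw [← hmdef] at hm ⊢
  have hmp : mink p.1 (lift1 z) = -m := by rw [hmdef, neg_neg]
  have hnull : mink (lift1 z) (lift1 z) = 0 := by
    simp only [mink, lift1, Matrix.cons_val]; linarith
  -- This is the unit tangent vector at `p` pointing to `z`: `p + v` is the null vector `m⁻¹ (1,
  -- z)`.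
  set v : Mink := m⁻¹ • lift1 z + (-1 : ℝ) • p.1 with hvdef
  have hv : IsTangentAt p v := by
    rw [IsTangentAt, hvdef, mink_add_right, mink_smul_right, mink_smul_right, hmp, p.2.1]
    field_simp; ring
  have hv1 : mink v v = 1 := by
    simp only [hvdef, mink_add_left, mink_add_right, mink_smul_left, mink_smul_right, hnull,
      mink_comm (lift1 z) p.1, hmp, p.2.1]
    field_simp; ring
  have v0 : v 0 = m⁻¹ - p.1 0 := by
    simp only [hvdef, Pi.add_apply, Pi.smul_apply, smul_eq_mul, lift1, Matrix.cons_val]; ring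
  have v1 : v 1 = m⁻¹ * (z : ℂ).re - p.1 1 := by
    simp only [hvdef, Pi.add_apply, Pi.smul_apply, smul_eq_mul, lift1, Matrix.cons_val]; ring
  have v2 : v 2 = m⁻¹ * (z : ℂ).im - p.1 2 := by
    simp only [hvdef, Pi.add_apply, Pi.smul_apply, smul_eq_mul, lift1, Matrix.cons_val]; ring
  have hf := hu.smooth.kleinFun
  set f := kleinFun u with hfdef
  have hline1 : kleinLine p v 1 = z := by
    apply Complex.ext
    · rw [kleinLine_re, v0, v1]; simp; field_simp
    · rw [kleinLine_im, v0, v2]; simp; field_simp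
  have hpos (t : ℝ) (ht0 : 0 ≤ t) (ht1 : t < 1) : |t| < 1 := by rwa [abs_of_nonneg ht0]
  have key (t : ℝ) (ht0 : 0 ≤ t) (ht1 : t < 1) :=
    abs_sub_tangent_le (g := lineFun f p v) (g₁ := lineFunD f p v) hε
      (by positivity : 0 ≤ 2 * K * p.1 0 ^ (-(1 / 2) : ℝ))
      (fun t a b => hasDerivAt_lineFun hf (line_zero_pos hv hv1 (hpos t a b).le)
        (norm_kleinLine_lt hv hv1 (hpos t a b)))
      (fun t a b => hasDerivAt_lineFunD hf (line_zero_pos hv hv1 (hpos t a b).le)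
        (norm_kleinLine_lt hv hv1 (hpos t a b)))
      (fun t a b => abs_second_deriv_line_le_rpow hu.smooth hu.mean hK hb hv hv1 a b) ht0 ht1
  -- The estimate is known for `t < 1` only; the boundary condition along this ray carries it to `t
  -- = 1`.
  have hlim1 : Tendsto (kleinLine p v) (𝓝[<] 1) (𝓝[Metric.ball 0 1] (z : ℂ)) := by
    rw [tendsto_nhdsWithin_iff]
    constructor
    · have := (hasDerivAt_kleinLine (line_zero_pos hv hv1 (t := 1) (by simp))).continuousAt.tendsto
      rw [hline1] at this
      exact this.mono_left nhdsWithin_le_nhds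
    · have h0 : ∀ᶠ r : ℝ in 𝓝[<] 1, 0 < r := nhdsWithin_le_nhds (lt_mem_nhds zero_lt_one)
      filter_upwards [self_mem_nhdsWithin, h0] with t ht ht0
      simpa using norm_kleinLine_lt hv hv1 (hpos t ht0.le ht)
  have hlim2 : Tendsto (lineFun f p v) (𝓝[<] 1) (𝓝 ((p.1 0 + 1 * v 0) * φ z)) := by
    refine Tendsto.mul ?_ ((hu.boundary z).comp hlim1)
    exact (Continuous.tendsto (by fun_prop : Continuous fun t : ℝ => p.1 0 + t * v 0) 1).mono_left
      nhdsWithin_le_nhds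
  have hlim3 : Tendsto (fun t => |lineFun f p v t - (lineFun f p v 0 + t * lineFunD f p v 0)|)
      (𝓝[<] 1) (𝓝 |(p.1 0 + 1 * v 0) * φ z - (lineFun f p v 0 + 1 * lineFunD f p v 0)|) := by
    refine (hlim2.sub ?_).abs
    exact (Continuous.tendsto (by fun_prop :
      Continuous fun t : ℝ => lineFun f p v 0 + t * lineFunD f p v 0) 1).mono_left
      nhdsWithin_le_nhds
  have hle : |(p.1 0 + 1 * v 0) * φ z - (lineFun f p v 0 + 1 * lineFunD f p v 0)| ≤
      4 * ε + 6 * (2 * K * p.1 0 ^ (-(1 / 2) : ℝ)) := by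
    refine le_of_tendsto hlim3 ?_
    have h0 : ∀ᶠ r : ℝ in 𝓝[<] 1, 0 < r := nhdsWithin_le_nhds (lt_mem_nhds zero_lt_one)
    filter_upwards [self_mem_nhdsWithin, h0] with t ht ht0
    exact key t ht0.le ht
  have hdk : p.1 0 • dKlein p v = m⁻¹ • ((z : ℂ) - klein p) := by
    apply Complex.ext
    · simp only [Complex.smul_re, smul_eq_mul, dKlein, Complex.sub_re, v0, v1, klein]
      field_simp; ring
    · simp only [Complex.smul_im, smul_eq_mul, dKlein, Complex.sub_im, v0, v2, klein]
      field_simp; ring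
  have hT : lineFun f p v 0 + 1 * lineFunD f p v 0
      = m⁻¹ * (f (klein p) + fderiv ℝ f (klein p) (z - klein p)) := by
    rw [lineFun, lineFunD, kleinLine_zero, pow_two, mul_smul, hdk, map_smul, map_smul, v0]
    simp only [smul_eq_mul]
    field_simp
    ring
  rw [hT, v0, one_mul, add_sub_cancel, ← mul_sub, abs_mul, abs_of_pos (inv_pos.2 hm),
    inv_mul_le_iff₀ hm] at hle
  linarith

/-- Adding `±δ (-⟨p, (1, ·)⟩)` to the tangent plane gives affine functions enclosing `φ`. At `klein
p` they are `2δ / p₀` apart, and the width carries a factor `p₀`. -/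
theorem width_klein_le {X : Circle → ℂ} (hX : Continuous X) {p : H2} {δ : ℝ}
    {L : ℂ →L[ℝ] ℝ} {c : ℝ}
    (h : ∀ z : Circle, |supportFun X z - (c + L (z - klein p))| ≤ δ * -mink p.1 (lift1 z)) :
    width X (klein p) ≤ 2 * δ := by
  have hp := p.pos
  have hsq := p.sq
  have hφ := continuous_supportFun hX
  have hη := norm_klein_lt p
  have aff (s : ℝ) : ∃ a : ℂ →ᵃ[ℝ] ℝ, ∀ x, a x = c + L (x - klein p) + s * -mink p.1 (lift1 x) := by
    obtain ⟨a, ha⟩ := exists_affine (L - (s * p.1 0) • dotL (klein p))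
      (c - L (klein p) + s * p.1 0)
    refine ⟨a, fun x => ?_⟩
    rw [ha, sub_apply, smul_apply, dotL_apply, map_sub]
    simp only [mink, lift1, klein, Matrix.cons_val, smul_eq_mul]
    field_simp
    ring
  obtain ⟨a, ha⟩ := aff δ
  obtain ⟨b, hb⟩ := aff (-δ)
  have h1 := upperEnv_le hφ (a := a) (fun z => by
    rw [ha]; linarith [(abs_le.1 (h z)).2]) hη
  have h2 := le_lowerEnv hφ (a := b) (fun z => by
    rw [hb]; linarith [(abs_le.1 (h z)).1]) hη
  have e : p.1 0 * -mink p.1 (lift1 (klein p)) = 1 := by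
    simp only [mink, lift1, klein, Matrix.cons_val]
    field_simp
    linarith
  rw [ha, sub_self, map_zero, add_zero] at h1
  rw [hb, sub_self, map_zero, add_zero] at h2
  rw [width_klein]
  have := mul_le_mul_of_nonneg_left (sub_le_sub h1 h2) hp.le
  refine this.trans (le_of_eq ?_)
  linear_combination 2 * δ * e

/-- A crude bound, needed where `p₀` is bounded: each of the four terms of `altSum` is at most `2 p₀
M`. -/
theorem exists_dbarNorm_le_mul (hφ : Continuous φ) :
    ∃ C, 0 ≤ C ∧ ∀ p : H2, dbarNorm (surfaceField (poissonSol φ)) p ≤ C * p.1 0 := by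
  obtain ⟨M, hM0, hM⟩ := exists_const_bounds hφ
  refine ⟨16 * M, by positivity, fun p => ?_⟩
  have hv (τ : ℝ) : |visFun φ p τ| ≤ 2 * p.1 0 * M := by
    rw [visFun, abs_mul, abs_of_pos (visWeight_pos p τ)]
    exact mul_le_mul (visWeight_le p τ) (hM _) (abs_nonneg _) (by linarith [p.pos])
  refine (dbarNorm_le_of_altSum hφ p (ε := 8 * p.1 0 * M) fun τ => ?_).trans (by linarith)
  have h1 := abs_le.1 (hv τ)
  have h2 := abs_le.1 (hv (τ + Real.pi / 2))
  have h3 := abs_le.1 (hv (τ + Real.pi))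
  have h4 := abs_le.1 (hv (τ + 3 * Real.pi / 2))
  rw [altSum, abs_le]
  constructor <;> linarith

theorem tendsto_width_of_tendsto_dbarNorm {X : Circle → ℂ} (hX : Continuous X)
    (h : Tendsto (dbarNorm (HL X)) (comap (fun p : H2 => ‖poincare p‖) (𝓝[<] 1)) (𝓝 0)) :
    Tendsto (width X) (comap (fun z : ℂ => ‖z‖) (𝓝[<] 1)) (𝓝 0) := by
  have hφ := continuous_supportFun hX
  rw [HL_eq hX, tendsto_zero_iff] at h
  rw [tendsto_zero_iff_klein]
  intro ε hε
  -- The final bound is `2 (4 · ε/16 + 12 K p₀^(-1/2)) = ε/2 + 24 K p₀^(-1/2)`.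
  obtain ⟨N, hN⟩ := h (ε / 16) (by positivity)
  obtain ⟨C, hC, hCp⟩ := exists_dbarNorm_le_mul hφ
  set N' := max N 1 with hN'
  have hN1 : 1 ≤ N' := le_max_right _ _
  -- Where `p₀ < N'`, the crude bound `C p₀` is at most `C N'`, and `(N' / p₀)^(1/2) ≥ 1`.
  set K := C * N' * N' ^ (1 / 2 : ℝ) with hKdef
  have hK : 0 ≤ K := by positivity
  have hb (p : H2) : dbarNorm (surfaceField (poissonSol (supportFun X))) p ≤
      ε / 16 + K * p.1 0 ^ (-(1 / 2) : ℝ) := by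
    have hp := p.pos
    by_cases hpN : N' ≤ p.1 0
    · have h1 := hN p ((le_max_left _ _).trans hpN)
      have h2 : 0 ≤ K * p.1 0 ^ (-(1 / 2) : ℝ) := by positivity
      linarith [le_abs_self (dbarNorm (surfaceField (poissonSol (supportFun X))) p)]
    · push Not at hpN
      have h1 : 1 ≤ N' ^ (1 / 2 : ℝ) * p.1 0 ^ (-(1 / 2) : ℝ) := by
        rw [Real.rpow_neg hp.le, ← div_eq_mul_inv, one_le_div (by positivity)]
        exact Real.rpow_le_rpow hp.le hpN.le (by norm_num)
      have h2 : C * p.1 0 ≤ C * N' * (N' ^ (1 / 2 : ℝ) * p.1 0 ^ (-(1 / 2) : ℝ)) := by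
        refine (mul_le_mul_of_nonneg_left hpN.le hC).trans ?_
        exact le_mul_of_one_le_right (by positivity) h1
      have h3 := hCp p
      rw [hKdef]
      linarith
  have hlim : Tendsto (fun x : ℝ => 24 * K * x ^ (-(1 / 2) : ℝ)) atTop (𝓝 0) := by
    simpa using (tendsto_rpow_neg_atTop (by norm_num : (0 : ℝ) < 1 / 2)).const_mul (24 * K)
  obtain ⟨N₂, hN₂⟩ := eventually_atTop.1 (hlim.eventually (gt_mem_nhds (half_pos hε)))
  refine ⟨N₂, fun p hp => ?_⟩
  have h1 := width_klein_le hX (abs_boundary_sub_tangent_le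
    (isMeanGraph_poissonSol hφ) (by positivity) hK hb p)
  have h2 := hN₂ (p.1 0) hp
  rw [abs_of_nonneg (width_klein_nonneg hX p)]
  linarith

/-! ### Harmonic quadruples -/

theorem circleExp_sub (α β : ℝ) : (Circle.exp β : ℂ) - Circle.exp α =
    2 * Complex.I * Real.sin ((β - α) / 2) * Complex.exp (((α + β) / 2 : ℝ) * Complex.I) := by
  rw [Complex.ofReal_sin, Complex.sin, Circle.coe_exp, Circle.coe_exp]
  have e1 : Complex.exp (β * Complex.I) = Complex.exp (((β - α) / 2 : ℝ) * Complex.I) *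
      Complex.exp (((α + β) / 2 : ℝ) * Complex.I) := by
    rw [← Complex.exp_add]; push_cast; ring_nf
  have e2 : Complex.exp (α * Complex.I) = Complex.exp (-((β - α) / 2 : ℝ) * Complex.I) *
      Complex.exp (((α + β) / 2 : ℝ) * Complex.I) := by
    rw [← Complex.exp_add]; push_cast; ring_nf
  rw [e1, e2]
  linear_combination -(Complex.exp (-((β - α) / 2 : ℝ) * Complex.I) -
    Complex.exp (((β - α) / 2 : ℝ) * Complex.I)) *
    Complex.exp (((α + β) / 2 : ℝ) * Complex.I) * Complex.I_sq

theorem norm_circleExp_sub (α β : ℝ) :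
    ‖(Circle.exp β : ℂ) - Circle.exp α‖ = 2 * |Real.sin ((β - α) / 2)| := by
  rw [circleExp_sub, norm_mul, Complex.norm_exp_ofReal_mul_I, norm_mul, norm_mul, Complex.norm_I,
    Complex.norm_real, Complex.norm_two, Real.norm_eq_abs, mul_one, mul_one]

/-- The coefficient in the cross-ratio distortion of the middle one of three consecutive points. -/
theorem circleExp_coeff {α β γ : ℝ} (h1 : Real.sin ((β - α) / 2) ≠ 0)
    (h2 : Real.sin ((γ - β) / 2) ≠ 0) :
    Complex.I * Circle.exp β * (1 / ((Circle.exp β : ℂ) - Circle.exp α) +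
      1 / ((Circle.exp γ : ℂ) - Circle.exp β)) =
      (Real.sin ((γ - α) / 2) / (2 * Real.sin ((β - α) / 2) * Real.sin ((γ - β) / 2)) : ℝ) := by
  have k1 : (Real.sin ((β - α) / 2) : ℂ) ≠ 0 := Complex.ofReal_ne_zero.2 h1
  have k2 : (Real.sin ((γ - β) / 2) : ℂ) ≠ 0 := Complex.ofReal_ne_zero.2 h2
  have n1 : (Circle.exp β : ℂ) - Circle.exp α ≠ 0 := by
    rw [circleExp_sub]; simp only [ne_eq, mul_eq_zero, not_or]; simp_all
  have n2 : (Circle.exp γ : ℂ) - Circle.exp β ≠ 0 := by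
    rw [circleExp_sub]; simp only [ne_eq, mul_eq_zero, not_or]; simp_all
  have e : 1 / ((Circle.exp β : ℂ) - Circle.exp α) + 1 / ((Circle.exp γ : ℂ) - Circle.exp β) =
      ((Circle.exp γ : ℂ) - Circle.exp α) /
        (((Circle.exp β : ℂ) - Circle.exp α) * ((Circle.exp γ : ℂ) - Circle.exp β)) := by
    field_simp; ring
  have hE : Complex.exp (β * Complex.I) * Complex.exp (((α + γ) / 2 : ℝ) * Complex.I) =
      Complex.exp (((α + β) / 2 : ℝ) * Complex.I) *
        Complex.exp (((β + γ) / 2 : ℝ) * Complex.I) := by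
    rw [← Complex.exp_add, ← Complex.exp_add]; push_cast; ring_nf
  have m1 := Complex.exp_ne_zero (((α + β) / 2 : ℝ) * Complex.I)
  have m2 := Complex.exp_ne_zero (((β + γ) / 2 : ℝ) * Complex.I)
  rw [e, circleExp_sub α β, circleExp_sub β γ, circleExp_sub α γ, Circle.coe_exp, mul_div_assoc',
    Complex.ofReal_div (Real.sin _), Complex.ofReal_mul, Complex.ofReal_mul, Complex.ofReal_ofNat,
    div_eq_div_iff (by simp_all) (by simp_all)]
  linear_combination (4 * Complex.I ^ 2 * Real.sin ((γ - α) / 2) * Real.sin ((β - α) / 2) *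
    Real.sin ((γ - β) / 2)) * hE

/-- The weights of the vertices of a quadruple of cross-ratio one in the cross-ratio distortion. -/
theorem exists_weights {Q : Quadruple} (hQ : Q.cr = 1) :
    ∃ wa wb wc wd : ℝ, (0 < wa ∧ 0 < wb ∧ 0 < wc ∧ 0 < wd) ∧ wa + wc = wb + wd ∧
      wa * (Q.a : ℂ) + wc * Q.c = wb * (Q.b : ℂ) + wd * Q.d ∧
      (wa * wb * ‖(Q.a - Q.b : ℂ)‖ ^ 2 = 2 ∧ wb * wc * ‖(Q.b - Q.c : ℂ)‖ ^ 2 = 2 ∧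
        wc * wd * ‖(Q.c - Q.d : ℂ)‖ ^ 2 = 2 ∧ wd * wa * ‖(Q.d - Q.a : ℂ)‖ ^ 2 = 2) ∧
      wa * wc * ‖(Q.c - Q.a : ℂ)‖ ^ 2 = 4 ∧
      ∀ X : Circle → ℂ, IsTangentField X → distortion X Q =
        ((wb * supportFun X Q.b + wd * supportFun X Q.d -
          (wa * supportFun X Q.a + wc * supportFun X Q.c) : ℝ) : ℂ) := by
  obtain ⟨a, b, c, d, α, β, γ, δ, h1, h2, h3, h4, rfl, rfl, rfl, rfl⟩ := Q
  have pos {x : ℝ} (hx : 0 < x) (hx' : x < 2 * Real.pi) : 0 < Real.sin (x / 2) :=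
    Real.sin_pos_of_pos_of_lt_pi (by linarith) (by linarith)
  have sA := pos (x := β - α) (by linarith) (by linarith)
  have sB := pos (x := γ - β) (by linarith) (by linarith)
  have sC := pos (x := δ - γ) (by linarith) (by linarith)
  have sD := pos (x := δ - α) (by linarith) (by linarith)
  have sp := pos (x := γ - α) (by linarith) (by linarith)
  have sq := pos (x := δ - β) (by linarith) (by linarith)
  have shift (x y : ℝ) : Real.sin ((x - (y - 2 * Real.pi)) / 2) = Real.sin ((y - x) / 2) := by
    rw [← Real.sin_pi_sub]; ring_nf
  have shift' (x y : ℝ) : Real.sin ((x + 2 * Real.pi - y) / 2) = Real.sin ((y - x) / 2) := by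
    rw [← Real.sin_pi_sub]; ring_nf
  have ptol : Real.sin ((γ - α) / 2) * Real.sin ((δ - β) / 2) =
      Real.sin ((β - α) / 2) * Real.sin ((δ - γ) / 2) +
        Real.sin ((γ - β) / 2) * Real.sin ((δ - α) / 2) := by
    simp only [sub_div, Real.sin_sub]
    ring
  -- In cyclic order the predecessor of `α` is `δ - 2π`, and the successor of `δ` is `α + 2π`.
  have wa := circleExp_coeff (α := δ - 2 * Real.pi) (β := α) (γ := β) (by rw [shift]; exact sD.ne')
    sA.ne'
  have wb := circleExp_coeff (α := α) (β := β) (γ := γ) sA.ne' sB.ne'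
  have wc := circleExp_coeff (α := β) (β := γ) (γ := δ) sB.ne' sC.ne'
  have wd := circleExp_coeff (α := γ) (β := δ) (γ := α + 2 * Real.pi) sC.ne'
    (by rw [shift']; exact sD.ne')
  rw [shift, shift, Circle.exp_sub_two_pi] at wa
  rw [shift', shift', Circle.exp_add_two_pi] at wd
  have nA := norm_circleExp_sub α β
  have nB := norm_circleExp_sub β γ
  have nC := norm_circleExp_sub γ δ
  have nD := norm_circleExp_sub α δ
  have np := norm_circleExp_sub α γ
  have ne {x y : ℝ} (h : ‖(Circle.exp y : ℂ) - Circle.exp x‖ = 2 * |Real.sin ((y - x) / 2)|)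
      (h' : 0 < Real.sin ((y - x) / 2)) : (Circle.exp y : ℂ) - Circle.exp x ≠ 0 := by
    rw [← norm_pos_iff, h]; positivity
  have zA := ne nA sA
  have zB := ne nB sB
  have zC := ne nC sC
  have zD := ne nD sD
  have zD' : (Circle.exp α : ℂ) - Circle.exp δ ≠ 0 := by rw [← neg_sub]; exact neg_ne_zero.2 zD
  -- Cross-ratio one makes the two products of opposite sides equal; by Ptolemy, the product of the
  -- diagonals is then twice either of them.
  have harm : Real.sin ((β - α) / 2) * Real.sin ((δ - γ) / 2) =
      Real.sin ((γ - β) / 2) * Real.sin ((δ - α) / 2) := by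
    rw [Quadruple.cr, div_eq_one_iff_eq (mul_ne_zero zB zD)] at hQ
    have := congrArg norm hQ
    simp only [norm_mul, nA, nB, nC, nD, abs_of_pos, sA, sB, sC, sD] at this
    linarith
  rw [abs_of_pos (by assumption)] at nA nB nC nD np
  -- `tele1` and `tele2` say that the fields `iz` and `iz²` have zero distortion: their difference
  -- quotients `i` and `i(z + w)` cancel in the alternating sum.
  have tele1 : (Complex.I * Circle.exp α * (1 / ((Circle.exp α : ℂ) - Circle.exp δ) +
        1 / ((Circle.exp β : ℂ) - Circle.exp α))) +
      (Complex.I * Circle.exp γ * (1 / ((Circle.exp γ : ℂ) - Circle.exp β) +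
        1 / ((Circle.exp δ : ℂ) - Circle.exp γ))) =
      (Complex.I * Circle.exp β * (1 / ((Circle.exp β : ℂ) - Circle.exp α) +
        1 / ((Circle.exp γ : ℂ) - Circle.exp β))) +
      (Complex.I * Circle.exp δ * (1 / ((Circle.exp δ : ℂ) - Circle.exp γ) +
        1 / ((Circle.exp α : ℂ) - Circle.exp δ))) := by
    field_simp
    ring
  have tele2 : (Complex.I * Circle.exp α * (1 / ((Circle.exp α : ℂ) - Circle.exp δ) +
        1 / ((Circle.exp β : ℂ) - Circle.exp α))) * Circle.exp α +
      (Complex.I * Circle.exp γ * (1 / ((Circle.exp γ : ℂ) - Circle.exp β) +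
        1 / ((Circle.exp δ : ℂ) - Circle.exp γ))) * Circle.exp γ =
      (Complex.I * Circle.exp β * (1 / ((Circle.exp β : ℂ) - Circle.exp α) +
        1 / ((Circle.exp γ : ℂ) - Circle.exp β))) * Circle.exp β +
      (Complex.I * Circle.exp δ * (1 / ((Circle.exp δ : ℂ) - Circle.exp γ) +
        1 / ((Circle.exp α : ℂ) - Circle.exp δ))) * Circle.exp δ := by
    field_simp
    ring
  refine ⟨Real.sin ((δ - β) / 2) / (2 * Real.sin ((δ - α) / 2) * Real.sin ((β - α) / 2)),
    Real.sin ((γ - α) / 2) / (2 * Real.sin ((β - α) / 2) * Real.sin ((γ - β) / 2)),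
    Real.sin ((δ - β) / 2) / (2 * Real.sin ((γ - β) / 2) * Real.sin ((δ - γ) / 2)),
    Real.sin ((γ - α) / 2) / (2 * Real.sin ((δ - γ) / 2) * Real.sin ((δ - α) / 2)),
    ⟨by positivity, by positivity, by positivity, by positivity⟩, ?_, ?_, ?_, ?_, ?_⟩
  · rw [wa, wb, wc, wd] at tele1
    exact_mod_cast tele1
  · rwa [wa, wb, wc, wd] at tele2
  · simp only
    rw [norm_sub_rev, nA, norm_sub_rev, nB, norm_sub_rev, nC, nD]
    clear wa wb wc wd tele1 tele2 nA nB nC nD np zA zB zC zD zD' shift shift' hQ ne pos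
    refine ⟨?_, ?_, ?_, ?_⟩ <;> field_simp <;> linarith
  · simp only
    rw [np]
    clear wa wb wc wd tele1 tele2 nA nB nC nD np zA zB zC zD zD' shift shift' hQ ne pos
    generalize Real.sin ((β - α) / 2) = A at *
    generalize Real.sin ((γ - β) / 2) = B at *
    generalize Real.sin ((δ - γ) / 2) = C at *
    generalize Real.sin ((δ - α) / 2) = D at *
    generalize Real.sin ((γ - α) / 2) = r at *
    generalize Real.sin ((δ - β) / 2) = s at *
    have hrs : r * s = 2 * (B * D) := by linarith
    have : s / (2 * D * A) * (s / (2 * B * C)) * (2 * r) ^ 2 =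
        (r * s) ^ 2 / ((A * C) * (B * D)) := by
      field_simp
    rw [this, hrs, harm]
    field_simp; ring
  · intro X hX
    rw [distortion_eq, hX.eq_supportFun, hX.eq_supportFun, hX.eq_supportFun, hX.eq_supportFun]
    push_cast at wa wb wc wd ⊢
    linear_combination (supportFun X (Circle.exp β) : ℂ) * wb +
      (supportFun X (Circle.exp δ) : ℂ) * wd - (supportFun X (Circle.exp α) : ℂ) * wa -
      (supportFun X (Circle.exp γ) : ℂ) * wc

/-- The squared distance to the circle of a point of a chord. -/
theorem sq_norm_chord (z w : Circle) (s t : ℝ) :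
    (s + t) ^ 2 - ‖(s * z + t * w : ℂ)‖ ^ 2 = s * t * ‖(w - z : ℂ)‖ ^ 2 := by
  have hz : (z : ℂ).re ^ 2 + (z : ℂ).im ^ 2 = 1 := by rw [← sq_norm_eq, Circle.norm_coe, one_pow]
  have hw : (w : ℂ).re ^ 2 + (w : ℂ).im ^ 2 = 1 := by rw [← sq_norm_eq, Circle.norm_coe, one_pow]
  rw [sq_norm_eq, sq_norm_eq]
  simp
  linear_combination (-s ^ 2 - s * t) * hz + (-t ^ 2 - s * t) * hw

/-- The diagonals of the ideal quadrilateral whose vertices form a quadruple of cross-ratio one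
meet in a point of the hyperbolic plane, and the cross-ratio distortion is bounded by the width at
that point. -/
theorem exists_norm_distortion_le {Q : Quadruple} (hQ : Q.cr = 1) :
    ∃ p : H2, 1 ≤ 2 * (p.1 0 * Q.scale) ^ 2 ∧ ∀ X : Circle → ℂ, Continuous X → IsTangentField X →
      ‖distortion X Q‖ ≤ 2 * width X (klein p) := by
  obtain ⟨wa, wb, wc, wd, ⟨pa, pb, pc, pd⟩, hs, hbar, ⟨ab, bc, cd, da⟩, ac, hdist⟩ :=
    exists_weights hQ
  -- The weighted barycentre of `a` and `c` is by `hbar` also that of `b` and `d`, so it is the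
  -- intersection of the diagonals.
  obtain ⟨η, hη⟩ : ∃ η : ℂ, (wa + wc : ℂ) * η = wa * Q.a + wc * Q.c := by
    have : (wa + wc : ℂ) ≠ 0 := by exact_mod_cast (by positivity : wa + wc ≠ 0)
    exact ⟨(wa * Q.a + wc * Q.c) / (wa + wc), mul_div_cancel₀ _ this⟩
  have hηn : (wa + wc) ^ 2 * (1 - ‖η‖ ^ 2) = 4 := by
    rw [← ac, ← sq_norm_chord, ← hη, norm_mul, ← Complex.ofReal_add, Complex.norm_real,
      Real.norm_eq_abs, mul_pow, sq_abs]
    ring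
  have hη1 : ‖η‖ < 1 := by
    by_contra! h
    nlinarith [mul_nonneg (sq_nonneg (wa + wc)) (show 0 ≤ ‖η‖ ^ 2 - 1 by nlinarith)]
  obtain ⟨p, rfl⟩ : ∃ p, η = klein p := ⟨_, (klein_kleinInv hη1).symm⟩
  have hp := p.pos
  have h0 : wa + wc = 2 * p.1 0 := by
    rw [one_sub_sq_norm_klein] at hηn
    field_simp at hηn
    nlinarith
  have h0' : wb + wd = 2 * p.1 0 := hs ▸ h0
  have hη' : (wb + wd : ℂ) * klein p = wb * Q.b + wd * Q.d := by
    rw [← hbar, ← hη]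
    congr 1
    exact_mod_cast hs.symm
  refine ⟨p, ?_, fun X hX hXt => ?_⟩
  · have key {x y n : ℝ} (hy : 0 < y) (hx' : x ≤ 2 * p.1 0) (hy' : y ≤ 2 * p.1 0)
        (h : x * y * n ^ 2 = 2) : 1 ≤ 2 * (p.1 0 * n) ^ 2 := by
      have h1 : x * y ≤ (2 * p.1 0) * (2 * p.1 0) :=
        mul_le_mul_of_nonneg' hx' hy' hy.le (by positivity)
      nlinarith [mul_le_mul_of_nonneg_right h1 (sq_nonneg n)]
    have la : wa ≤ 2 * p.1 0 := by linarith
    have lb : wb ≤ 2 * p.1 0 := by linarith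
    have lc : wc ≤ 2 * p.1 0 := by linarith
    have ld : wd ≤ 2 * p.1 0 := by linarith
    rw [Quadruple.scale]
    rcases min_cases (min ‖(Q.a - Q.b : ℂ)‖ ‖(Q.b - Q.c : ℂ)‖)
      (min ‖(Q.c - Q.d : ℂ)‖ ‖(Q.d - Q.a : ℂ)‖) with h | h <;> rw [h.1]
    · rcases min_cases ‖(Q.a - Q.b : ℂ)‖ ‖(Q.b - Q.c : ℂ)‖ with h | h <;> rw [h.1]
      · exact key pb la lb ab
      · exact key pc lb lc bc
    · rcases min_cases ‖(Q.c - Q.d : ℂ)‖ ‖(Q.d - Q.a : ℂ)‖ with h | h <;> rw [h.1]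
      · exact key pd lc ld cd
      · exact key pa ld la da
  · have hφ := continuous_supportFun hX
    have hconv (a : ℂ →ᵃ[ℝ] ℝ) {s t : ℝ} {z w : Circle} (hst : s + t = 2 * p.1 0)
        (h : (s + t : ℂ) * klein p = s * z + t * w) :
        2 * p.1 0 * a (klein p) = s * a z + t * a w := by
      have h1 : (s + t) • klein p = s • (z : ℂ) + t • (w : ℂ) := by
        simpa only [Complex.real_smul, Complex.ofReal_add] using h
      have h2 := congrArg a.linear h1
      simp only [map_add, map_smul, smul_eq_mul] at h2
      rw [affine_apply a (klein p), affine_apply a z, affine_apply a w, ← hst]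
      linarith
    have hlow {s t : ℝ} {z w : Circle} (hs : 0 < s) (ht : 0 < t) (hst : s + t = 2 * p.1 0)
        (h : (s + t : ℂ) * klein p = s * z + t * w) :
        2 * p.1 0 * lowerEnv (supportFun X) (klein p) ≤
          s * supportFun X z + t * supportFun X w := by
      rw [mul_comm, ← le_div_iff₀ (by positivity)]
      refine lowerEnv_le hφ fun a ha => ?_
      rw [le_div_iff₀ (by positivity), mul_comm, hconv a hst h]
      gcongr <;> exact ha _
    have hup {s t : ℝ} {z w : Circle} (hs : 0 < s) (ht : 0 < t) (hst : s + t = 2 * p.1 0)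
        (h : (s + t : ℂ) * klein p = s * z + t * w) :
        s * supportFun X z + t * supportFun X w ≤
          2 * p.1 0 * upperEnv (supportFun X) (klein p) := by
      rw [mul_comm (2 * p.1 0), ← div_le_iff₀ (by positivity)]
      refine le_upperEnv hφ fun a ha => ?_
      rw [div_le_iff₀ (by positivity), mul_comm (a _), hconv a hst h]
      gcongr <;> exact ha _
    -- Each diagonal's weighted sum of `φ` lies between `2 p₀` times the lower and upper envelopes
    -- at `klein p`, so their difference is at most twice the width.
    rw [hdist X hXt, Complex.norm_real, Real.norm_eq_abs, width_klein, abs_le]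
    constructor
    · linarith [hlow pb pd h0' hη', hup pa pc h0 hη]
    · linarith [hlow pa pc h0 hη, hup pb pd h0' hη']

/-! ### From vanishing width to the little Zygmund condition. -/

theorem width_klein_le_const {X : Circle → ℂ} (hX : Continuous X) :
    ∃ M, 0 ≤ M ∧ ∀ p : H2, width X (klein p) ≤ M * p.1 0 := by
  have hφ := continuous_supportFun hX
  obtain ⟨M, hM0, hM⟩ := exists_const_bounds hφ
  obtain ⟨a, ha⟩ := exists_affine 0 M
  obtain ⟨b, hb⟩ := exists_affine 0 (-M)
  refine ⟨2 * M, by positivity, fun p => ?_⟩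
  have h1 := upperEnv_le hφ (a := a) (fun z => by
    rw [ha]; simpa using (abs_le.1 (hM z)).2) (norm_klein_lt p)
  have h2 := le_lowerEnv hφ (a := b) (fun z => by
    rw [hb]; simpa using (abs_le.1 (hM z)).1) (norm_klein_lt p)
  rw [ha, zero_apply] at h1
  rw [hb, zero_apply] at h2
  rw [width_klein]
  nlinarith [p.pos]

theorem isLittleZygmund_of_tendsto_width {X : Circle → ℂ} (hX : Continuous X)
    (hXt : IsTangentField X)
    (h : Tendsto (width X) (comap (fun z : ℂ => ‖z‖) (𝓝[<] 1)) (𝓝 0)) : IsLittleZygmund X := by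
  rw [tendsto_zero_iff_klein] at h
  refine ⟨⟨hX, ?_⟩, ?_⟩
  · obtain ⟨N, hN⟩ := h 1 one_pos
    obtain ⟨M, hM0, hM⟩ := width_klein_le_const hX
    -- The width is below `1` where `p₀ ≥ N` and at most `M N` elsewhere.
    have hb : crNorm X ≤ ENNReal.ofReal (2 * max 1 (M * N)) := by
      refine iSup₂_le fun Q hQ => ?_
      obtain ⟨p, -, hp⟩ := exists_norm_distortion_le hQ
      rw [← ofReal_norm]
      refine ENNReal.ofReal_le_ofReal ((hp X hX hXt).trans ?_)
      gcongr
      rcases le_total N (p.1 0) with h1 | h1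
      · exact le_max_of_le_left ((le_abs_self _).trans (hN p h1).le)
      · exact le_max_of_le_right ((hM p).trans (by gcongr))
    exact hb.trans_lt ENNReal.ofReal_lt_top
  · simp only [ENNReal.iSup_eq_zero]
    rintro Q ⟨hQ, hs⟩
    refine Tendsto.limsup_eq ?_
    choose p hp hd using fun n => exists_norm_distortion_le (hQ n)
    have hlim : Tendsto (fun n => ‖distortion X (Q n)‖) atTop (𝓝 0) := by
      rw [Metric.tendsto_atTop]
      intro ε hε
      obtain ⟨N, hN⟩ := h (ε / 2) (by positivity)
      -- If `p₀ < N`, this threshold would give `p₀ · scale ≤ 1/2`, against `1 ≤ 2 (p₀ · scale)²`.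
      obtain ⟨n₀, hn₀⟩ := Metric.tendsto_atTop.1 hs (1 / (2 * (|N| + 1))) (by positivity)
      refine ⟨n₀, fun n hn => ?_⟩
      have h1 : N ≤ (p n).1 0 := by
        by_contra! h2
        have h3 := hn₀ n hn
        rw [Real.dist_eq, sub_zero, lt_div_iff₀ (by positivity)] at h3
        have h4 : |(p n).1 0 * (Q n).scale| ≤ 1 / 2 := by
          rw [abs_mul, abs_of_pos (p n).pos]
          nlinarith [abs_nonneg (Q n).scale, le_abs_self N]
        have h5 := hp n
        rw [← sq_abs] at h5
        nlinarith [abs_nonneg ((p n).1 0 * (Q n).scale)]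
      have := hN (p n) h1
      rw [Real.dist_eq, sub_zero, abs_norm]
      linarith [hd n X hX hXt, le_abs_self (width X (klein (p n)))]
    have hlim' := (ENNReal.continuous_ofReal.tendsto 0).comp hlim
    rw [ENNReal.ofReal_zero] at hlim'
    exact hlim'.congr fun n => ofReal_norm _

end HalfPipe

end

open HalfPipe

theorem theorem1p6 (X : Circle → ℂ) (hX : Continuous X) (hXt : IsTangentField X) :
    (∃! u : H2 → ℝ, IsMeanGraph (supportFun X) u) ∧
    List.TFAE [
      IsLittleZygmund X,
      Tendsto (dbarNorm (HL X)) (comap (fun p : H2 => ‖poincare p‖) (𝓝[<] 1)) (𝓝 0),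
      Tendsto (width X) (comap (fun z : ℂ => ‖z‖) (𝓝[<] 1)) (𝓝 0)] := by
  refine ⟨existsUnique_isMeanGraph (continuous_supportFun hX), ?_⟩
  tfae_have 1 → 2 := fun h => h.tendsto_dbarNorm hXt
  tfae_have 2 → 3 := tendsto_width_of_tendsto_dbarNorm hX
  tfae_have 3 → 1 := isLittleZygmund_of_tendsto_width hX hXt
  tfae_finish
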